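/- Conventions. All bicategories are small and enriched over simplicial sets: between parallel $1$-morphisms $f,g$ there is a simplicial set of $2$-cells whose vertices are the $2$-morphisms $f\Rightarrow g$, vertical composition and whiskering are simplicial, and the associativity and unit constraints (which are vertices) are natural with respect to simplices of $2$-cells of every dimension. Ordinary bicategories are those whose simplicial sets of $2$-cells are discrete. Pseudofunctors and (pseudonatural) transformations are understood in the enriched sense. $Bicat$ is the category of bicategories and pseudofunctors. A natural equivalence is a transformation all of whose components are equivalences, and a pseudofunctor $F:\mathcal C\to\mathcal D$ is an equivalence of bicategories if there are a pseudofunctor $G:\mathcal D\to\mathcal C$ and natural equivalences $\mathrm{id}_{\mathcal C}\simeq G\circ F$ and $\mathrm{id}_{\mathcal D}\simeq F\circ G$. A pseudofunctor is normal if its identity constraints are identities; a normalization of a pseudofunctor $F$ is a normal pseudofunctor naturally equivalent to $F$. The Segal nerve of a bicategory $\mathcal C$ is the simplicial object $\mathbf N_n\mathcal C=\underline{NorHom}([n],\mathcal C)$ in simplicially enriched categories: its objects are the normal pseudofunctors $[n]\to\mathcal C$ and its morphisms are icons, that is oplax transformations with identity components on objects (the $k$-simplices of the simplicial set of icons have $k$-simplices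 of $2$-cells as components). The classifying space $|\mathbf N\mathcal C|$ is the geometric realization of the diagonal of the trisimplicial set $(n,k,p)\mapsto N_p\big((\mathbf N_n\mathcal C)_k\big)$, where $(\mathbf N_n\mathcal C)_k$ is the category of $k$-simplices of $\mathbf N_n\mathcal C$ and $N$ is the nerve of a category. It is a functor on bicategories and normal pseudofunctors. Let $Fin_*$ be the category of the pointed sets $\underline n=\{0,1,\dots,n\}$ (base point $0$, $n\ge 0$) and pointed maps, and for $1\le k\le n$ let $i_k:\underline n\to\underline 1$ send $k$ to $1$ and all other elements to $0$. A $\Gamma$-space is a functor $X:Fin_*\to Top$; it is special if for every $n\ge0$ the map $P_n=(X(i_k))_k:X(\underline n)\to X(\underline 1)^{\times n}$ is a weak homotopy equivalence. A $\Gamma$-bicategory is a functor $A:Fin_*\to Bicat$; it is special if for every $n\ge0$ the pseudofunctor $P_n=(A(i_k))_k:A(\underline n)\to A(\underline 1)^{\times n}$ is an equivalence of bicategories. **Lemma 3.5.** Let $A$ be a special $\Gamma$-bicategory. Then $|\mathbf N A|$ is a special $\Gamma$-space. Precisely: (1) If all the pseudofunctors $A(f)$ are normal, so that $|\mathbf N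 A|:Fin_*\to Top$, $\underline n\mapsto|\mathbf N A(\underline n)|$, is a functor, then this $\Gamma$-space is special. (2) In general, call a $\Gamma$-space $X$ a model of $|\mathbf N A|$ if there are homotopy equivalences $e_n:|\mathbf N A(\underline n)|\to X(\underline n)$, $n\ge 0$, such that for every $f:\underline m\to\underline n$ in $Fin_*$ the pseudofunctor $A(f)$ has a normalization and, for every normalization $F$ of $A(f)$, the maps $X(f)\circ e_m$ and $e_n\circ|\mathbf N F|$ are homotopic. Then $|\mathbf N A|$ has a model, and every model of $|\mathbf N A|$ is a special $\Gamma$-space. -/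

import Mathlib

open CategoryTheory Opposite

universe u

namespace SegalGamma

/-! ### Bicategories enriched over simplicial sets -/

/-- The data of an enrichment over simplicial sets of the categories of 1-morphisms of a
bicategory: simplicial sets of 2-cells whose vertices are the given 2-morphisms, together with
simplicial vertical composition and whiskering. -/
class SimplicialCells (B : Type u) [Bicategory.{u, u} B] where
  /-- the simplicial set of 2-cells between parallel 1-morphisms -/
  cell {a b : B} (f g : a ⟶ b) : SSet.{u}
  /-- the 2-morphisms are the vertices -/
  vertex {a b : B} {f g : a ⟶ b} : (f ⟶ g) ≃ (cell f g).obj (op (SimplexCategory.mk 0))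
  /-- vertical composition of `k`-simplices of 2-cells -/
  comp {a b : B} {f g h : a ⟶ b} {k : SimplexCategoryᵒᵖ} :
    (cell f g).obj k → (cell g h).obj k → (cell f h).obj k
  /-- left whiskering of `k`-simplices of 2-cells -/
  whiskerLeft {a b c : B} (f : a ⟶ b) {g h : b ⟶ c} {k : SimplexCategoryᵒᵖ} :
    (cell g h).obj k → (cell (f ≫ g) (f ≫ h)).obj k
  /-- right whiskering of `k`-simplices of 2-cells -/
  whiskerRight {a b c : B} {f g : a ⟶ b} {k : SimplexCategoryᵒᵖ} :
    (cell f g).obj k → ∀ h : b ⟶ c, (cell (f ≫ h) (g ≫ h)).obj k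

namespace SimplicialCells

variable {B : Type u} [Bicategory.{u, u} B] [SimplicialCells B]

/-- The totally degenerate `k`-simplex on the vertex given by a 2-morphism. -/
def deg (k : SimplexCategoryᵒᵖ) {a b : B} {f g : a ⟶ b} (η : f ⟶ g) : (cell f g).obj k :=
  (cell f g).map (SimplexCategory.const k.unop (SimplexCategory.mk 0) 0).op (vertex η)

end SimplicialCells

open SimplicialCells

/-- A bicategory enriched over simplicial sets: every category of 1-morphisms is enriched over
simplicial sets, whiskering is simplicially enriched, and the associators and unitors (which are
vertices) are natural with respect to simplices of 2-cells of every dimension. -/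
class SimplicialBicategory (B : Type u) [Bicategory.{u, u} B] extends SimplicialCells B where
  map_comp {a b : B} {f g h : a ⟶ b} {k l : SimplexCategoryᵒᵖ} (θ : k ⟶ l)
    (x : (cell f g).obj k) (y : (cell g h).obj k) :
    (cell f h).map θ (comp x y) = comp ((cell f g).map θ x) ((cell g h).map θ y)
  vertex_comp {a b : B} {f g h : a ⟶ b} (η : f ⟶ g) (θ : g ⟶ h) :
    vertex (η ≫ θ) = comp (vertex η) (vertex θ)
  id_comp {a b : B} {f g : a ⟶ b} {k : SimplexCategoryᵒᵖ} (x : (cell f g).obj k) :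
    comp (deg k (𝟙 f)) x = x
  comp_id {a b : B} {f g : a ⟶ b} {k : SimplexCategoryᵒᵖ} (x : (cell f g).obj k) :
    comp x (deg k (𝟙 g)) = x
  assoc {a b : B} {f g h i : a ⟶ b} {k : SimplexCategoryᵒᵖ} (x : (cell f g).obj k)
    (y : (cell g h).obj k) (z : (cell h i).obj k) : comp (comp x y) z = comp x (comp y z)
  map_whiskerLeft {a b c : B} (f : a ⟶ b) {g h : b ⟶ c} {k l : SimplexCategoryᵒᵖ} (θ : k ⟶ l)
    (x : (cell g h).obj k) :
    (cell (f ≫ g) (f ≫ h)).map θ (whiskerLeft f x) = whiskerLeft f ((cell g h).map θ x)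
  vertex_whiskerLeft {a b c : B} (f : a ⟶ b) {g h : b ⟶ c} (η : g ⟶ h) :
    vertex (Bicategory.whiskerLeft f η) = whiskerLeft f (vertex η)
  whiskerLeft_comp {a b c : B} (f : a ⟶ b) {g h i : b ⟶ c} {k : SimplexCategoryᵒᵖ}
    (x : (cell g h).obj k) (y : (cell h i).obj k) :
    whiskerLeft f (comp x y) = comp (whiskerLeft f x) (whiskerLeft f y)
  map_whiskerRight {a b c : B} {f g : a ⟶ b} {k l : SimplexCategoryᵒᵖ} (θ : k ⟶ l)
    (x : (cell f g).obj k) (h : b ⟶ c) :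
    (cell (f ≫ h) (g ≫ h)).map θ (whiskerRight x h) = whiskerRight ((cell f g).map θ x) h
  vertex_whiskerRight {a b c : B} {f g : a ⟶ b} (η : f ⟶ g) (h : b ⟶ c) :
    vertex (Bicategory.whiskerRight η h) = whiskerRight (vertex η) h
  whiskerRight_comp {a b c : B} {f g h : a ⟶ b} {k : SimplexCategoryᵒᵖ}
    (x : (cell f g).obj k) (y : (cell g h).obj k) (i : b ⟶ c) :
    whiskerRight (comp x y) i = comp (whiskerRight x i) (whiskerRight y i)
  whisker_exchange {a b c : B} {f g : a ⟶ b} {h i : b ⟶ c} {k : SimplexCategoryᵒᵖ}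
    (x : (cell f g).obj k) (y : (cell h i).obj k) :
    comp (whiskerLeft f y) (whiskerRight x i) = comp (whiskerRight x h) (whiskerLeft g y)
  leftUnitor_naturality {a b : B} {f g : a ⟶ b} {k : SimplexCategoryᵒᵖ} (x : (cell f g).obj k) :
    comp (whiskerLeft (𝟙 a) x) (deg k (Bicategory.leftUnitor g).hom) =
      comp (deg k (Bicategory.leftUnitor f).hom) x
  rightUnitor_naturality {a b : B} {f g : a ⟶ b} {k : SimplexCategoryᵒᵖ} (x : (cell f g).obj k) :
    comp (whiskerRight x (𝟙 b)) (deg k (Bicategory.rightUnitor g).hom) =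
      comp (deg k (Bicategory.rightUnitor f).hom) x
  associator_naturality_left {a b c d : B} {f f' : a ⟶ b} {k : SimplexCategoryᵒᵖ}
    (x : (cell f f').obj k) (g : b ⟶ c) (h : c ⟶ d) :
    comp (whiskerRight (whiskerRight x g) h) (deg k (Bicategory.associator f' g h).hom) =
      comp (deg k (Bicategory.associator f g h).hom) (whiskerRight x (g ≫ h))
  associator_naturality_middle {a b c d : B} (f : a ⟶ b) {g g' : b ⟶ c} {k : SimplexCategoryᵒᵖ}
    (x : (cell g g').obj k) (h : c ⟶ d) :
    comp (whiskerRight (whiskerLeft f x) h) (deg k (Bicategory.associator f g' h).hom) =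
      comp (deg k (Bicategory.associator f g h).hom) (whiskerLeft f (whiskerRight x h))
  associator_naturality_right {a b c d : B} (f : a ⟶ b) (g : b ⟶ c) {h h' : c ⟶ d}
    {k : SimplexCategoryᵒᵖ} (x : (cell h h').obj k) :
    comp (whiskerLeft (f ≫ g) x) (deg k (Bicategory.associator f g h').hom) =
      comp (deg k (Bicategory.associator f g h).hom) (whiskerLeft f (whiskerLeft g x))

section deg

variable {B : Type u} [Bicategory.{u, u} B] [SimplicialBicategory B]

theorem map_deg {k l : SimplexCategoryᵒᵖ} (θ : k ⟶ l) {a b : B} {f g : a ⟶ b} (η : f ⟶ g) :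
    (cell f g).map θ (deg k η) = deg l η := by
  unfold deg
  rw [← CategoryTheory.comp_apply, ← Functor.map_comp]
  rfl

theorem deg_comp (k : SimplexCategoryᵒᵖ) {a b : B} {f g h : a ⟶ b} (η : f ⟶ g) (θ : g ⟶ h) :
    deg k (η ≫ θ) = comp (deg k η) (deg k θ) := by
  simp only [deg, SimplicialBicategory.vertex_comp, SimplicialBicategory.map_comp]

theorem deg_whiskerLeft (k : SimplexCategoryᵒᵖ) {a b c : B} (f : a ⟶ b) {g h : b ⟶ c}
    (η : g ⟶ h) : deg k (Bicategory.whiskerLeft f η) = whiskerLeft f (deg k η) := by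
  simp only [deg, SimplicialBicategory.vertex_whiskerLeft, SimplicialBicategory.map_whiskerLeft]

theorem deg_whiskerRight (k : SimplexCategoryᵒᵖ) {a b c : B} {f g : a ⟶ b} (η : f ⟶ g)
    (h : b ⟶ c) : deg k (Bicategory.whiskerRight η h) = whiskerRight (deg k η) h := by
  simp only [deg, SimplicialBicategory.vertex_whiskerRight, SimplicialBicategory.map_whiskerRight]

end deg

/-! ### Enriched pseudofunctors and transformations -/

/-- A pseudofunctor between bicategories enriched over simplicial sets: a pseudofunctor whose
action on 2-morphisms is extended to simplices of 2-cells, and whose composition constraints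
are natural with respect to these. -/
structure SPseudofunctor (B C : Type u) [Bicategory.{u, u} B] [SimplicialBicategory B]
    [Bicategory.{u, u} C] [SimplicialBicategory C] extends Pseudofunctor B C where
  /-- the simplicial map on 2-cells -/
  mapCell {a b : B} (f g : a ⟶ b) : cell f g ⟶ cell (map f) (map g)
  mapCell_vertex {a b : B} {f g : a ⟶ b} (η : f ⟶ g) :
    (mapCell f g).app _ (vertex η) = vertex (map₂ η)
  mapCell_comp {a b : B} {f g h : a ⟶ b} {k : SimplexCategoryᵒᵖ}
    (x : (cell f g).obj k) (y : (cell g h).obj k) :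
    (mapCell f h).app k (comp x y) = comp ((mapCell f g).app k x) ((mapCell g h).app k y)
  mapCell_whiskerLeft {a b c : B} (f : a ⟶ b) {g h : b ⟶ c} {k : SimplexCategoryᵒᵖ}
    (x : (cell g h).obj k) :
    comp ((mapCell (f ≫ g) (f ≫ h)).app k (whiskerLeft f x)) (deg k (mapComp f h).hom) =
      comp (deg k (mapComp f g).hom) (whiskerLeft (map f) ((mapCell g h).app k x))
  mapCell_whiskerRight {a b c : B} {f g : a ⟶ b} {k : SimplexCategoryᵒᵖ}
    (x : (cell f g).obj k) (h : b ⟶ c) :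
    comp ((mapCell (f ≫ h) (g ≫ h)).app k (whiskerRight x h)) (deg k (mapComp g h).hom) =
      comp (deg k (mapComp f h).hom) (whiskerRight ((mapCell f g).app k x) (map h))

namespace SPseudofunctor

variable {B C D E : Type u} [Bicategory.{u, u} B] [SimplicialBicategory B]
  [Bicategory.{u, u} C] [SimplicialBicategory C] [Bicategory.{u, u} D] [SimplicialBicategory D]
  [Bicategory.{u, u} E] [SimplicialBicategory E]

theorem mapCell_deg (F : SPseudofunctor B C) (k : SimplexCategoryᵒᵖ) {a b : B} {f g : a ⟶ b}
    (η : f ⟶ g) : (F.mapCell f g).app k (deg k η) = deg k (F.map₂ η) := by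
  unfold deg
  rw [← F.mapCell_vertex, ← CategoryTheory.comp_apply, (F.mapCell f g).naturality,
    CategoryTheory.comp_apply]

theorem mapCell_map (F : SPseudofunctor B C) {k l : SimplexCategoryᵒᵖ} (θ : k ⟶ l) {a b : B}
    {f g : a ⟶ b} (x : (cell f g).obj k) :
    (F.mapCell f g).app l ((cell f g).map θ x) =
      (cell (F.map f) (F.map g)).map θ ((F.mapCell f g).app k x) := by
  rw [← CategoryTheory.comp_apply, (F.mapCell f g).naturality, CategoryTheory.comp_apply]

theorem ext' {F G : SPseudofunctor B C} (h : F.toPseudofunctor = G.toPseudofunctor)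
    (h' : ∀ {a b : B} (f g : a ⟶ b), HEq (F.mapCell f g) (G.mapCell f g)) : F = G := by
  obtain ⟨F, m, _, _, _, _⟩ := F
  obtain ⟨G, m', _, _, _, _⟩ := G
  obtain rfl : F = G := h
  obtain rfl : @m = @m' := by
    funext a b f g
    exact eq_of_heq (h' f g)
  rfl

/-- The identity pseudofunctor. -/
def id (B : Type u) [Bicategory.{u, u} B] [SimplicialBicategory B] : SPseudofunctor B B where
  toPseudofunctor := Pseudofunctor.id B
  mapCell f g := 𝟙 (cell f g)
  mapCell_vertex _ := rfl
  mapCell_comp _ _ := rfl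
  mapCell_whiskerLeft _ _ _ _ _ :=
    (SimplicialBicategory.comp_id _).trans (SimplicialBicategory.id_comp _).symm
  mapCell_whiskerRight _ _ :=
    (SimplicialBicategory.comp_id _).trans (SimplicialBicategory.id_comp _).symm

/-- Composition of pseudofunctors (in diagrammatic order). -/
def comp (F : SPseudofunctor B C) (G : SPseudofunctor C D) : SPseudofunctor B D where
  toPseudofunctor := F.toPseudofunctor.comp G.toPseudofunctor
  mapCell f g := F.mapCell f g ≫ G.mapCell (F.map f) (F.map g)
  mapCell_vertex η := by
    change (G.mapCell _ _).app _ ((F.mapCell _ _).app _ _) = _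
    rw [F.mapCell_vertex, G.mapCell_vertex]
    rfl
  mapCell_comp x y := by
    change (G.mapCell _ _).app _ ((F.mapCell _ _).app _ _) = _
    rw [F.mapCell_comp, G.mapCell_comp]
    rfl
  mapCell_whiskerLeft f g h k x := by
    change SimplicialCells.comp ((G.mapCell _ _).app _ ((F.mapCell _ _).app _ _))
        (deg k (G.map₂ (F.mapComp f h).hom ≫ (G.mapComp (F.map f) (F.map h)).hom)) =
      SimplicialCells.comp (deg k (G.map₂ (F.mapComp f g).hom ≫
        (G.mapComp (F.map f) (F.map g)).hom)) (whiskerLeft (G.map (F.map f))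
          ((G.mapCell _ _).app _ ((F.mapCell _ _).app _ x)))
    rw [deg_comp, deg_comp, ← mapCell_deg, ← mapCell_deg, ← SimplicialBicategory.assoc,
      ← G.mapCell_comp, F.mapCell_whiskerLeft, G.mapCell_comp, SimplicialBicategory.assoc,
      G.mapCell_whiskerLeft, SimplicialBicategory.assoc]
  mapCell_whiskerRight {a b c f g k} x h := by
    change SimplicialCells.comp ((G.mapCell _ _).app _ ((F.mapCell _ _).app _ _))
        (deg k (G.map₂ (F.mapComp g h).hom ≫ (G.mapComp (F.map g) (F.map h)).hom)) =
      SimplicialCells.comp (deg k (G.map₂ (F.mapComp f h).hom ≫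
        (G.mapComp (F.map f) (F.map h)).hom)) (whiskerRight
          ((G.mapCell _ _).app _ ((F.mapCell _ _).app _ x)) (G.map (F.map h)))
    rw [deg_comp, deg_comp, ← mapCell_deg, ← mapCell_deg, ← SimplicialBicategory.assoc,
      ← G.mapCell_comp, F.mapCell_whiskerRight, G.mapCell_comp, SimplicialBicategory.assoc,
      G.mapCell_whiskerRight, SimplicialBicategory.assoc]

theorem pseudo_ext {B C : Type u} [Bicategory.{u, u} B] [Bicategory.{u, u} C] {F G : Pseudofunctor B C} (h : F.toPrelaxFunctor = G.toPrelaxFunctor)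
    (h₁ : ∀ a, HEq (F.mapId a) (G.mapId a))
    (h₂ : ∀ {a b c : B} (f : a ⟶ b) (g : b ⟶ c), HEq (F.mapComp f g) (G.mapComp f g)) :
    F = G := by
  obtain ⟨F, i, m, _, _, _, _, _⟩ := F
  obtain ⟨G, i', m', _, _, _, _, _⟩ := G
  obtain rfl : F = G := h
  obtain rfl : @i = @i' := by
    funext a
    exact eq_of_heq (h₁ a)
  obtain rfl : @m = @m' := by
    funext a b c f g
    exact eq_of_heq (h₂ f g)
  rfl

theorem id_comp (F : SPseudofunctor B C) : (id B).comp F = F := by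
  refine ext' (pseudo_ext rfl (fun a => heq_of_eq ?_) (fun f g => heq_of_eq ?_))
    (fun f g => HEq.rfl)
  · ext
    exact (congrArg (· ≫ _) (F.map₂_id _)).trans (Category.id_comp _)
  · ext
    exact (congrArg (· ≫ _) (F.map₂_id _)).trans (Category.id_comp _)

theorem comp_id (F : SPseudofunctor B C) : F.comp (id C) = F := by
  refine ext' (pseudo_ext rfl (fun a => heq_of_eq ?_) (fun f g => heq_of_eq ?_))
    (fun f g => HEq.rfl)
  · ext
    exact Category.comp_id _
  · ext
    exact Category.comp_id _

theorem assoc (F : SPseudofunctor B C) (G : SPseudofunctor C D) (H : SPseudofunctor D E) :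
    (F.comp G).comp H = F.comp (G.comp H) := by
  refine ext' (pseudo_ext rfl (fun a => heq_of_eq ?_) (fun f g => heq_of_eq ?_))
    (fun f g => HEq.rfl)
  · ext
    exact (congrArg (· ≫ _) (H.map₂_comp _ _)).trans (Category.assoc _ _ _)
  · ext
    exact (congrArg (· ≫ _) (H.map₂_comp _ _)).trans (Category.assoc _ _ _)

/-- A pseudofunctor is normal if its identity constraints are identities. -/
def IsNormal (F : SPseudofunctor B C) : Prop :=
  ∃ h : ∀ a : B, F.map (𝟙 a) = 𝟙 (F.obj a), ∀ a : B, F.mapId a = eqToIso (h a)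

theorem isNormal_id : (id B).IsNormal :=
  ⟨fun _ => rfl, fun _ => rfl⟩

theorem IsNormal.comp {F : SPseudofunctor B C} {G : SPseudofunctor C D} (hF : F.IsNormal)
    (hG : G.IsNormal) : (F.comp G).IsNormal := by
  obtain ⟨hF, hF'⟩ := hF
  obtain ⟨hG, hG'⟩ := hG
  refine ⟨fun a => (congrArg G.map (hF a)).trans (hG _), fun a => ?_⟩
  ext
  change G.map₂ (F.mapId a).hom ≫ (G.mapId (F.obj a)).hom = _
  rw [hF', hG', eqToIso.hom, eqToIso.hom, PrelaxFunctor.map₂_eqToHom, eqToHom_trans]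
  rfl

end SPseudofunctor

section Transformations

variable {B C : Type u} [Bicategory.{u, u} B] [SimplicialBicategory B]
  [Bicategory.{u, u} C] [SimplicialBicategory C]

/-- A (pseudonatural) transformation of enriched pseudofunctors: the naturality constraints are
natural with respect to simplices of 2-cells. -/
structure STrans (F G : SPseudofunctor B C) extends
    Pseudofunctor.StrongTrans F.toPseudofunctor G.toPseudofunctor where
  naturality_cell {a b : B} {f g : a ⟶ b} {k : SimplexCategoryᵒᵖ} (x : (cell f g).obj k) :
    comp (whiskerRight ((F.mapCell f g).app k x) (app b)) (deg k (naturality g).hom) =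
      comp (deg k (naturality f).hom) (whiskerLeft (app a) ((G.mapCell f g).app k x))

/-- A 1-morphism which is invertible up to invertible 2-morphisms. -/
def IsEquivalence₁ {a b : C} (f : a ⟶ b) : Prop :=
  ∃ g : b ⟶ a, Nonempty (f ≫ g ≅ 𝟙 a) ∧ Nonempty (g ≫ f ≅ 𝟙 b)

/-- `F` and `G` are related by a natural equivalence, that is by a transformation whose
components are equivalences (equivalently, a weakly invertible transformation). -/
def NatEquivalent (F G : SPseudofunctor B C) : Prop :=
  ∃ η : STrans F G, ∀ a : B, IsEquivalence₁ (η.app a)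

/-- `F` is an equivalence of bicategories. -/
def IsBiequivalence (F : SPseudofunctor B C) : Prop :=
  ∃ G : SPseudofunctor C B, NatEquivalent (SPseudofunctor.id B) (F.comp G) ∧
    NatEquivalent (SPseudofunctor.id C) (G.comp F)

end Transformations

/-! ### The categories of bicategories -/

/-- Small bicategories enriched over simplicial sets. -/
structure Bicat : Type (u + 1) where
  /-- the type of objects -/
  carrier : Type u
  [bicategory : Bicategory.{u, u} carrier]
  [simplicial : SimplicialBicategory carrier]

attribute [instance] Bicat.bicategory Bicat.simplicial

/-- The category of small bicategories and pseudofunctors. -/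
instance : Category Bicat.{u} where
  Hom B C := SPseudofunctor B.carrier C.carrier
  id B := SPseudofunctor.id B.carrier
  comp F G := SPseudofunctor.comp F G
  id_comp := SPseudofunctor.id_comp
  comp_id := SPseudofunctor.comp_id
  assoc := SPseudofunctor.assoc

/-- The pseudofunctor underlying a morphism of `Bicat`. -/
abbrev Bicat.toPseudo {B C : Bicat.{u}} (F : B ⟶ C) : SPseudofunctor B.carrier C.carrier := F

/-- The class of normal pseudofunctors. -/
def normal : MorphismProperty Bicat.{u} := fun _ _ F => (Bicat.toPseudo F).IsNormal

instance : normal.{u}.IsMultiplicative where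
  id_mem _ := SPseudofunctor.isNormal_id
  comp_mem _ _ hF hG := SPseudofunctor.IsNormal.comp hF hG

/-- The category of small bicategories and normal pseudofunctors. -/
abbrev NormalBicat : Type (u + 1) := WideSubcategory normal.{u}

/-! ### Products of bicategories -/

section Pi

variable {ι : Type} (B : ι → Type u) [∀ i, Bicategory.{u, u} (B i)]

/-- The product of a family of bicategories. -/
instance piBicategory : Bicategory.{u, u} (∀ i, B i) where
  Hom a b := ∀ i, a i ⟶ b i
  id a := fun i => 𝟙 (a i)
  comp f g := fun i => f i ≫ g i
  homCategory a b := CategoryTheory.pi (fun i => (a i ⟶ b i))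
  whiskerLeft f _ _ η := fun i => Bicategory.whiskerLeft (f i) (η i)
  whiskerRight η h := fun i => Bicategory.whiskerRight (η i) (h i)
  associator f g h := Pi.isoMk fun i => Bicategory.associator (f i) (g i) (h i)
  leftUnitor f := Pi.isoMk fun i => Bicategory.leftUnitor (f i)
  rightUnitor f := Pi.isoMk fun i => Bicategory.rightUnitor (f i)
  whiskerLeft_id _ _ := funext fun _ => Bicategory.whiskerLeft_id _ _
  whiskerLeft_comp _ _ _ _ _ _ := funext fun _ => Bicategory.whiskerLeft_comp _ _ _
  id_whiskerLeft _ := funext fun _ => Bicategory.id_whiskerLeft _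
  comp_whiskerLeft _ _ _ _ _ := funext fun _ => Bicategory.comp_whiskerLeft _ _ _
  id_whiskerRight _ _ := funext fun _ => Bicategory.id_whiskerRight _ _
  comp_whiskerRight _ _ _ := funext fun _ => Bicategory.comp_whiskerRight _ _ _
  whiskerRight_id _ := funext fun _ => Bicategory.whiskerRight_id _
  whiskerRight_comp _ _ _ := funext fun _ => Bicategory.whiskerRight_comp _ _ _
  whisker_assoc _ _ _ _ _ := funext fun _ => Bicategory.whisker_assoc _ _ _
  whisker_exchange _ _ := funext fun _ => Bicategory.whisker_exchange _ _
  pentagon _ _ _ _ := funext fun _ => Bicategory.pentagon _ _ _ _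
  triangle _ _ := funext fun _ => Bicategory.triangle _ _

/-- The product simplicial set. -/
def piSSet {ι : Type} (X : ι → SSet.{u}) : SSet.{u} where
  obj k := ∀ i, (X i).obj k
  map θ := TypeCat.ofHom fun x i => (X i).map θ (x i)
  map_id k := by
    ext x i
    exact (X i).map_id_apply k (x i)
  map_comp θ θ' := by
    ext x i
    exact (X i).map_comp_apply θ θ' (x i)

variable [∀ i, SimplicialBicategory (B i)]

instance piSimplicialCells : SimplicialCells (∀ i, B i) where
  cell f g := piSSet fun i => cell (f i) (g i)
  vertex := Equiv.piCongrRight fun _ => vertex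
  comp x y := fun i => comp (x i) (y i)
  whiskerLeft f _ _ _ x := fun i => whiskerLeft (f i) (x i)
  whiskerRight x h := fun i => whiskerRight (x i) (h i)

/-- The product of a family of enriched bicategories is enriched. -/
instance piSimplicialBicategory : SimplicialBicategory (∀ i, B i) where
  map_comp _ _ _ := funext fun _ => SimplicialBicategory.map_comp _ _ _
  vertex_comp _ _ := funext fun _ => SimplicialBicategory.vertex_comp _ _
  id_comp _ := funext fun _ => SimplicialBicategory.id_comp _
  comp_id _ := funext fun _ => SimplicialBicategory.comp_id _
  assoc _ _ _ := funext fun _ => SimplicialBicategory.assoc _ _ _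
  map_whiskerLeft _ _ _ _ _ _ _ := funext fun _ => SimplicialBicategory.map_whiskerLeft _ _ _
  vertex_whiskerLeft _ _ _ _ := funext fun _ => SimplicialBicategory.vertex_whiskerLeft _ _
  whiskerLeft_comp _ _ _ _ _ _ _ := funext fun _ => SimplicialBicategory.whiskerLeft_comp _ _ _
  map_whiskerRight _ _ _ := funext fun _ => SimplicialBicategory.map_whiskerRight _ _ _
  vertex_whiskerRight _ _ := funext fun _ => SimplicialBicategory.vertex_whiskerRight _ _
  whiskerRight_comp _ _ _ := funext fun _ => SimplicialBicategory.whiskerRight_comp _ _ _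
  whisker_exchange _ _ := funext fun _ => SimplicialBicategory.whisker_exchange _ _
  leftUnitor_naturality _ := funext fun _ => SimplicialBicategory.leftUnitor_naturality _
  rightUnitor_naturality _ := funext fun _ => SimplicialBicategory.rightUnitor_naturality _
  associator_naturality_left _ _ _ :=
    funext fun _ => SimplicialBicategory.associator_naturality_left _ _ _
  associator_naturality_middle _ _ _ _ _ _ :=
    funext fun _ => SimplicialBicategory.associator_naturality_middle _ _ _
  associator_naturality_right _ _ _ _ _ _ :=
    funext fun _ => SimplicialBicategory.associator_naturality_right _ _ _

variable {B} {A : Type u} [Bicategory.{u, u} A]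

/-- The pseudofunctor to a product with given components (without enrichment). -/
def piLift₀ (F : ∀ i, Pseudofunctor A (B i)) : Pseudofunctor A (∀ i, B i) where
  obj a := fun i => (F i).obj a
  map f := fun i => (F i).map f
  map₂ η := fun i => (F i).map₂ η
  map₂_id _ := funext fun i => (F i).map₂_id _
  map₂_comp _ _ := funext fun i => (F i).map₂_comp _ _
  mapId a := Pi.isoMk fun i => (F i).mapId a
  mapComp f g := Pi.isoMk fun i => (F i).mapComp f g
  map₂_whisker_left _ _ _ _ := funext fun i => (F i).map₂_whisker_left _ _
  map₂_whisker_right _ _ := funext fun i => (F i).map₂_whisker_right _ _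
  map₂_associator _ _ _ := funext fun i => (F i).map₂_associator _ _ _
  map₂_left_unitor _ := funext fun i => (F i).map₂_left_unitor _
  map₂_right_unitor _ := funext fun i => (F i).map₂_right_unitor _

/-- The pseudofunctor to a product with given components. -/
def piLift [SimplicialBicategory A] (F : ∀ i, SPseudofunctor A (B i)) :
    SPseudofunctor A (∀ i, B i) where
  toPseudofunctor := piLift₀ fun i => (F i).toPseudofunctor
  mapCell f g :=
    { app := fun k => TypeCat.ofHom fun x i => ((F i).mapCell f g).app k x
      naturality := fun k l θ => by
        ext x
        funext i
        exact (F i).mapCell_map θ x }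
  mapCell_vertex _ := funext fun i => (F i).mapCell_vertex _
  mapCell_comp _ _ := funext fun i => (F i).mapCell_comp _ _
  mapCell_whiskerLeft _ _ _ _ _ := funext fun i => (F i).mapCell_whiskerLeft _ _
  mapCell_whiskerRight _ _ := funext fun i => (F i).mapCell_whiskerRight _ _

end Pi

/-! ### The Segal nerve -/

section Nerve

variable {C : Type u} [Bicategory.{u, u} C]

/-- A normal pseudofunctor from a preordered set `I` (regarded as a bicategory with only identity
2-morphisms) to `C` whose action on objects is `c`. -/
@[ext]
structure NorHom {I : Type} [Preorder I] (C : Type u) [Bicategory.{u, u} C] (c : I → C) where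
  /-- the 1-morphisms -/
  map {i j : I} : i ≤ j → (c i ⟶ c j)
  /-- the identity constraints -/
  mapId (i : I) : map (le_refl i) ≅ 𝟙 (c i)
  /-- the composition constraints -/
  mapComp {i j k : I} (hij : i ≤ j) (hjk : j ≤ k) :
    map (hij.trans hjk) ≅ map hij ≫ map hjk
  map_assoc {i j k l : I} (hij : i ≤ j) (hjk : j ≤ k) (hkl : k ≤ l) :
    (mapComp (hij.trans hjk) hkl).hom ≫
        Bicategory.whiskerRight (mapComp hij hjk).hom (map hkl) ≫
          (Bicategory.associator (map hij) (map hjk) (map hkl)).hom =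
      (mapComp hij (hjk.trans hkl)).hom ≫
        Bicategory.whiskerLeft (map hij) (mapComp hjk hkl).hom
  map_left_unitor {i j : I} (h : i ≤ j) :
    (mapComp (le_refl i) h).hom ≫ Bicategory.whiskerRight (mapId i).hom (map h) ≫
      (Bicategory.leftUnitor (map h)).hom = 𝟙 (map h)
  map_right_unitor {i j : I} (h : i ≤ j) :
    (mapComp h (le_refl j)).hom ≫ Bicategory.whiskerLeft (map h) (mapId j).hom ≫
      (Bicategory.rightUnitor (map h)).hom = 𝟙 (map h)
  normal : ∃ h : ∀ i, map (le_refl i) = 𝟙 (c i), ∀ i, mapId i = eqToIso (h i)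

variable [SimplicialBicategory C]

/-- The `k`-simplices of the simplicial set of icons between normal pseudofunctors from `I`
with the same action on objects. -/
@[ext]
structure Icon {I : Type} [Preorder I] {c : I → C} (k : SimplexCategoryᵒᵖ)
    (X Y : NorHom C c) where
  /-- the components -/
  app {i j : I} (h : i ≤ j) : (cell (X.map h) (Y.map h)).obj k
  app_id (i : I) : comp (app (le_refl i)) (deg k (Y.mapId i).hom) = deg k (X.mapId i).hom
  app_comp {i j l : I} (hij : i ≤ j) (hjl : j ≤ l) :
    comp (app (hij.trans hjl)) (deg k (Y.mapComp hij hjl).hom) =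
      comp (deg k (X.mapComp hij hjl).hom)
        (comp (whiskerRight (app hij) (X.map hjl)) (whiskerLeft (Y.map hij) (app hjl)))

/-- The objects of the `k`-th level of the simplicially enriched category of normal pseudofunctors
`I → C` with action on objects `c`. -/
def NorLevel {I : Type} [Preorder I] (_k : SimplexCategoryᵒᵖ) (c : I → C) : Type u :=
  NorHom C c

/-- Icons compose vertically. -/
instance {I : Type} [Preorder I] (k : SimplexCategoryᵒᵖ) (c : I → C) :
    Category.{u} (NorLevel k c) where
  Hom X Y := Icon k X Y
  id X :=
    { app := fun h => deg k (𝟙 (X.map h))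
      app_id := fun i => SimplicialBicategory.id_comp _
      app_comp := fun hij hjl => by
        rw [SimplicialBicategory.id_comp, ← deg_whiskerLeft, ← deg_whiskerRight,
          Bicategory.id_whiskerRight, Bicategory.whiskerLeft_id, SimplicialBicategory.id_comp,
          SimplicialBicategory.comp_id] }
  comp {X Y Z} x y :=
    { app := fun h => comp (x.app h) (y.app h)
      app_id := fun i => by
        rw [SimplicialBicategory.assoc, y.app_id, x.app_id]
      app_comp := fun hij hjl => by
        rw [SimplicialBicategory.assoc, y.app_comp, ← SimplicialBicategory.assoc, x.app_comp,
          SimplicialBicategory.whiskerRight_comp, SimplicialBicategory.whiskerLeft_comp]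
        simp only [SimplicialBicategory.assoc]
        rw [← SimplicialBicategory.assoc (whiskerLeft (Y.map hij) (x.app hjl)),
          SimplicialBicategory.whisker_exchange]
        simp only [SimplicialBicategory.assoc] }
  id_comp x := Icon.ext (by
    funext i j h
    exact SimplicialBicategory.id_comp _)
  comp_id x := Icon.ext (by
    funext i j h
    exact SimplicialBicategory.comp_id _)
  assoc x y z := Icon.ext (by
    funext i j h
    exact SimplicialBicategory.assoc _ _ _)

/-- The `k`-th level of the simplicially enriched category of normal pseudofunctors `I → C` and
icons between them. Icons exist only between pseudofunctors with the same action on objects. -/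
abbrev NorCat (I : Type) [Preorder I] (C : Type u) [Bicategory.{u, u} C]
    [SimplicialBicategory C] (k : SimplexCategoryᵒᵖ) : Type u :=
  Σ c : I → C, NorLevel k c

variable {I J K : Type} [Preorder I] [Preorder J] [Preorder K]

/-- Restriction of normal pseudofunctors along a monotone map. -/
def NorHom.restrict (t : J →o I) {c : I → C} (X : NorHom C c) : NorHom C (c ∘ t) where
  map h := X.map (t.monotone h)
  mapId j := X.mapId (t j)
  mapComp hij hjk := X.mapComp (t.monotone hij) (t.monotone hjk)
  map_assoc hij hjk hkl := X.map_assoc (t.monotone hij) (t.monotone hjk) (t.monotone hkl)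
  map_left_unitor h := X.map_left_unitor (t.monotone h)
  map_right_unitor h := X.map_right_unitor (t.monotone h)
  normal := X.normal.elim fun h h' => ⟨fun j => h (t j), fun j => h' (t j)⟩

/-- The effect of restriction along a monotone map and a simplicial operator on icons. -/
def Icon.restrict (t : J →o I) {k l : SimplexCategoryᵒᵖ} (θ : k ⟶ l) {c : I → C}
    {X Y : NorHom C c} (x : Icon k X Y) : Icon l (X.restrict t) (Y.restrict t) where
  app h := (cell _ _).map θ (x.app (t.monotone h))
  app_id i := by
    have := congrArg ((cell _ _).map θ) (x.app_id (t i))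
    rw [SimplicialBicategory.map_comp, map_deg, map_deg] at this
    exact this
  app_comp hij hjl := by
    have := congrArg ((cell _ _).map θ) (x.app_comp (t.monotone hij) (t.monotone hjl))
    rw [SimplicialBicategory.map_comp, SimplicialBicategory.map_comp,
      SimplicialBicategory.map_comp, SimplicialBicategory.map_whiskerLeft,
      SimplicialBicategory.map_whiskerRight, map_deg, map_deg] at this
    exact this

/-- Restriction of normal pseudofunctors and icons along a monotone map and a simplicial
operator. -/
def restrictFunctor (C : Type u) [Bicategory.{u, u} C] [SimplicialBicategory C] (t : J →o I)
    {k l : SimplexCategoryᵒᵖ} (θ : k ⟶ l) : NorCat I C k ⥤ NorCat J C l :=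
  Sigma.desc fun c =>
    { obj := fun X => ⟨c ∘ t, NorHom.restrict t X⟩
      map := fun x => Sigma.SigmaHom.mk (Icon.restrict t θ x)
      map_id := fun _ => congrArg Sigma.SigmaHom.mk (Icon.ext (by
        funext i j h
        exact map_deg θ _))
      map_comp := fun x y => congrArg Sigma.SigmaHom.mk (Icon.ext (by
        funext i j h
        exact SimplicialBicategory.map_comp θ _ _)) }

variable {D E : Type u} [Bicategory.{u, u} D] [SimplicialBicategory D]
  [Bicategory.{u, u} E] [SimplicialBicategory E]

/-- Composition of a normal pseudofunctor `I → C` with a normal pseudofunctor `F : C → D`. -/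
def NorHom.postcomp (F : SPseudofunctor C D) (hF : F.IsNormal) {c : I → C} (X : NorHom C c) :
    NorHom D (F.obj ∘ c) where
  map h := F.map (X.map h)
  mapId i := F.map₂Iso (X.mapId i) ≪≫ F.mapId (c i)
  mapComp hij hjk := F.map₂Iso (X.mapComp hij hjk) ≪≫ F.mapComp (X.map hij) (X.map hjk)
  map_assoc hij hjk hkl := by
    have := congrArg (fun z => F.map₂ z) (X.map_assoc hij hjk hkl)
    simp at this
    have := congrArg (fun z => z ≫ (F.mapComp (X.map hij) (X.map hjk ≫ X.map hkl)).hom ≫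
      Bicategory.whiskerLeft (F.map (X.map hij)) (F.mapComp (X.map hjk) (X.map hkl)).hom) this
    simpa [← Bicategory.whiskerLeft_comp] using this
  map_left_unitor h := by
    have := congrArg (fun z => F.map₂ z) (X.map_left_unitor h)
    simpa using this
  map_right_unitor h := by
    have := congrArg (fun z => F.map₂ z) (X.map_right_unitor h)
    simpa using this
  normal := by
    obtain ⟨hF, hF'⟩ := hF
    obtain ⟨hX, hX'⟩ := X.normal
    refine ⟨fun i => (congrArg F.map (hX i)).trans (hF _), fun i => ?_⟩
    ext
    change F.map₂ (X.mapId i).hom ≫ (F.mapId (c i)).hom = _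
    rw [hF', hX', eqToIso.hom, eqToIso.hom, PrelaxFunctor.map₂_eqToHom, eqToHom_trans]
    rfl

/-- The effect of composition with a pseudofunctor on icons. -/
def Icon.postcomp (F : SPseudofunctor C D) (hF : F.IsNormal) {k : SimplexCategoryᵒᵖ} {c : I → C}
    {X Y : NorHom C c} (x : Icon k X Y) : Icon k (X.postcomp F hF) (Y.postcomp F hF) where
  app h := (F.mapCell _ _).app k (x.app h)
  app_id i := by
    change comp _ (deg k (F.map₂ (Y.mapId i).hom ≫ _)) = deg k (F.map₂ (X.mapId i).hom ≫ _)
    rw [deg_comp, deg_comp, ← SPseudofunctor.mapCell_deg, ← SPseudofunctor.mapCell_deg,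
      ← SimplicialBicategory.assoc, ← F.mapCell_comp, x.app_id]
  app_comp {i j l} hij hjl := by
    change comp _ (deg k (F.map₂ (Y.mapComp hij hjl).hom ≫ _)) =
      comp (deg k (F.map₂ (X.mapComp hij hjl).hom ≫ _)) (comp
        (whiskerRight ((F.mapCell _ _).app k (x.app hij)) (F.map (X.map hjl)))
        (whiskerLeft (F.map (Y.map hij)) ((F.mapCell _ _).app k (x.app hjl))))
    rw [deg_comp, deg_comp, ← SPseudofunctor.mapCell_deg, ← SPseudofunctor.mapCell_deg,
      ← SimplicialBicategory.assoc, ← F.mapCell_comp, x.app_comp, F.mapCell_comp, F.mapCell_comp]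
    simp only [SimplicialBicategory.assoc]
    rw [F.mapCell_whiskerLeft,
      ← SimplicialBicategory.assoc (deg k (F.mapComp (X.map hij) (X.map hjl)).hom),
      ← F.mapCell_whiskerRight]
    simp only [SimplicialBicategory.assoc]

/-- Composition of normal pseudofunctors and icons with a normal pseudofunctor. -/
def postcompFunctor (I : Type) [Preorder I] (F : SPseudofunctor C D) (hF : F.IsNormal)
    (k : SimplexCategoryᵒᵖ) : NorCat I C k ⥤ NorCat I D k :=
  Sigma.desc fun c =>
    { obj := fun X => ⟨F.obj ∘ c, NorHom.postcomp F hF X⟩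
      map := fun x => Sigma.SigmaHom.mk (Icon.postcomp F hF x)
      map_id := fun X => congrArg Sigma.SigmaHom.mk (Icon.ext (by
        funext i j h
        exact (F.mapCell_deg k _).trans (congrArg (deg k) (F.map₂_id _))))
      map_comp := fun x y => congrArg Sigma.SigmaHom.mk (Icon.ext (by
        funext i j h
        exact F.mapCell_comp _ _)) }

theorem norCat_functor_ext {𝒟 : Type u} [Category.{u} 𝒟] {k : SimplexCategoryᵒᵖ}
    {P Q : NorCat I C k ⥤ 𝒟} (h₀ : ∀ (c : I → C) (X : NorLevel k c), P.obj ⟨c, X⟩ = Q.obj ⟨c, X⟩)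
    (h₁ : ∀ (c : I → C) (X Y : NorLevel k c) (x : X ⟶ Y),
      HEq (P.map (Sigma.SigmaHom.mk x)) (Q.map (Sigma.SigmaHom.mk x))) : P = Q := by
  refine CategoryTheory.Functor.hext (fun X => h₀ X.1 X.2) ?_
  rintro _ _ ⟨x⟩
  exact h₁ _ _ _ x

theorem sigmaHom_hext {k : SimplexCategoryᵒᵖ} {c : I → C} {X X' Y Y' : NorHom C c}
    (hX : X = X') (hY : Y = Y') (x : Icon k X Y) (x' : Icon k X' Y')
    (h : ∀ {i j : I} (h : i ≤ j), HEq (x.app h) (x'.app h)) :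
    HEq (Sigma.SigmaHom.mk (C := NorLevel (C := C) (I := I) k) (X := X) (Y := Y) x)
      (Sigma.SigmaHom.mk (C := NorLevel (C := C) (I := I) k) (X := X') (Y := Y') x') := by
  subst hX hY
  obtain rfl : x = x' := Icon.ext (by
    funext i j hij
    exact eq_of_heq (h hij))
  rfl

theorem restrictFunctor_id (k : SimplexCategoryᵒᵖ) :
    restrictFunctor C (OrderHom.id : I →o I) (𝟙 k) = 𝟭 (NorCat I C k) :=
  norCat_functor_ext (fun _ _ => rfl) fun _ _ _ x => sigmaHom_hext rfl rfl _ x fun _ =>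
    heq_of_eq (Functor.map_id_apply _ _ _)

theorem restrictFunctor_comp (t : J →o I) (s : K →o J) {k l m : SimplexCategoryᵒᵖ}
    (θ : k ⟶ l) (θ' : l ⟶ m) :
    restrictFunctor C (t.comp s) (θ ≫ θ') = restrictFunctor C t θ ⋙ restrictFunctor C s θ' :=
  norCat_functor_ext (fun _ _ => rfl) fun _ _ _ _ => sigmaHom_hext rfl rfl _ _ fun _ =>
    heq_of_eq (Functor.map_comp_apply _ _ _ _)

theorem postcompFunctor_id (k : SimplexCategoryᵒᵖ) :
    postcompFunctor I (SPseudofunctor.id C) SPseudofunctor.isNormal_id k =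
      𝟭 (NorCat I C k) := by
  have key : ∀ (c : I → C) (X : NorHom C c),
      X.postcomp (SPseudofunctor.id C) SPseudofunctor.isNormal_id = X := by
    intro c X
    refine NorHom.ext rfl (heq_of_eq ?_) (heq_of_eq ?_)
    · funext i
      ext
      exact Category.comp_id _
    · funext i j l h h'
      ext
      exact Category.comp_id _
  exact norCat_functor_ext (fun c X => congrArg (Sigma.mk c) (key c X)) fun c X Y x =>
    sigmaHom_hext (key c X) (key c Y) _ x fun _ => HEq.rfl

theorem postcompFunctor_comp (F : SPseudofunctor C D) (hF : F.IsNormal) (G : SPseudofunctor D E)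
    (hG : G.IsNormal) (k : SimplexCategoryᵒᵖ) :
    postcompFunctor I (F.comp G) (hF.comp hG) k =
      postcompFunctor I F hF k ⋙ postcompFunctor I G hG k := by
  have key : ∀ (c : I → C) (X : NorHom C c),
      X.postcomp (F.comp G) (hF.comp hG) = (X.postcomp F hF).postcomp G hG := by
    intro c X
    refine NorHom.ext rfl (heq_of_eq ?_) (heq_of_eq ?_)
    · funext i
      ext
      exact (Category.assoc _ _ _).symm.trans (congrArg (· ≫ _) (G.map₂_comp _ _).symm)
    · funext i j l h h'
      ext
      exact (Category.assoc _ _ _).symm.trans (congrArg (· ≫ _) (G.map₂_comp _ _).symm)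
  exact norCat_functor_ext (fun c X => congrArg (Sigma.mk _) (key c X)) fun c X Y _ =>
    sigmaHom_hext (key c X) (key c Y) _ _ fun _ => HEq.rfl

theorem restrictFunctor_postcompFunctor (F : SPseudofunctor C D) (hF : F.IsNormal) (t : J →o I)
    {k l : SimplexCategoryᵒᵖ} (θ : k ⟶ l) :
    restrictFunctor C t θ ⋙ postcompFunctor J F hF l =
      postcompFunctor I F hF k ⋙ restrictFunctor D t θ :=
  norCat_functor_ext (fun _ _ => rfl) fun _ _ _ _ => sigmaHom_hext rfl rfl _ _ fun _ =>
    heq_of_eq (F.mapCell_map _ _)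

end Nerve

/-- The Segal nerve of a bicategory. It is a simplicial object `n ↦ NorHom([n], C)` in simplicially
enriched categories; a simplicially enriched category is recorded as the simplicial category
formed by its levels, so that the value at `(n, k)` is the category of normal pseudofunctors
`[n] → C` and `k`-simplices of icons. -/
def segalNerve (C : Type u) [Bicategory.{u, u} C] [SimplicialBicategory C] :
    SimplexCategoryᵒᵖ × SimplexCategoryᵒᵖ ⥤ Cat.{u, u} where
  obj p := Cat.of (NorCat (Fin (p.1.unop.len + 1)) C p.2)
  map f := (restrictFunctor C f.1.unop.toOrderHom f.2).toCatHom
  map_id p := congrArg Functor.toCatHom (restrictFunctor_id p.2)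
  map_comp f g := congrArg Functor.toCatHom (restrictFunctor_comp _ _ f.2 g.2)

/-- The Segal nerve, as a functor on bicategories and normal pseudofunctors. -/
def segalNerveFunctor :
    NormalBicat.{u} ⥤ (SimplexCategoryᵒᵖ × SimplexCategoryᵒᵖ ⥤ Cat.{u, u}) where
  obj C := segalNerve C.obj.carrier
  map F :=
    { app := fun p => (postcompFunctor _ (Bicat.toPseudo F.hom) F.property p.2).toCatHom
      naturality := fun _ _ f => congrArg Functor.toCatHom
        (restrictFunctor_postcompFunctor (Bicat.toPseudo F.hom) F.property _ f.2) }
  map_id C := by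
    ext p : 2
    exact congrArg Functor.toCatHom (postcompFunctor_id p.2)
  map_comp F G := by
    ext p : 2
    exact congrArg Functor.toCatHom (postcompFunctor_comp _ F.property _ G.property p.2)

/-- The diagonal of a trisimplicial set. -/
def diagonal : (SimplexCategoryᵒᵖ × SimplexCategoryᵒᵖ ⥤ SSet.{u}) ⥤ SSet.{u} :=
  Functor.uncurry ⋙ (Functor.whiskeringLeft _ _ _).obj
    (Functor.prod' (Functor.diag SimplexCategoryᵒᵖ) (𝟭 SimplexCategoryᵒᵖ))

/-- The classifying space of bicategories, as a functor on normal pseudofunctors: the geometric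
realization of the Segal nerve, that is of the trisimplicial set whose `(n, k, p)`-simplices are the
`p`-simplices of the nerve of the category of normal pseudofunctors `[n] → C` and `k`-simplices of
icons. -/
noncomputable def classifyingSpace : NormalBicat.{u} ⥤ TopCat.{u} :=
  segalNerveFunctor ⋙ (Functor.whiskeringRight _ _ _).obj nerveFunctor ⋙ diagonal ⋙ SSet.toTop

/-! ### Weak homotopy equivalences -/

section WeakEquivalence

variable {X Y : Type u} [TopologicalSpace X] [TopologicalSpace Y]

/-- The map induced on sets of path components. -/
def pi₀Map (f : C(X, Y)) : ZerothHomotopy X → ZerothHomotopy Y :=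
  Quotient.map' f fun _ _ h => h.map f.continuous

/-- The map induced on homotopy groups. -/
def piMap (f : C(X, Y)) (n : ℕ) (x : X) :
    HomotopyGroup (Fin n) X x → HomotopyGroup (Fin n) Y (f x) :=
  Quotient.map' (fun γ => ⟨f.comp γ.1, fun y hy => congrArg f (γ.2 y hy)⟩)
    fun _ _ h => h.comp_continuousMap f

/-- Weak homotopy equivalences: bijections on path components and on all homotopy groups for all
base points. -/
def IsWeakEquivalence (f : C(X, Y)) : Prop :=
  Function.Bijective (pi₀Map f) ∧ ∀ (n : ℕ) (x : X), 1 ≤ n → Function.Bijective (piMap f n x)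

end WeakEquivalence

/-! ### Γ-spaces and Γ-bicategories -/

/-- The skeletal category of finite pointed sets: the object `n` is the set `{0, 1, …, n}` pointed
by `0`. -/
structure FinStar : Type where
  /-- the number of points different from the base point -/
  n : ℕ

instance : Category FinStar where
  Hom m n := {f : Fin (m.n + 1) → Fin (n.n + 1) // f 0 = 0}
  id _ := ⟨fun x => x, rfl⟩
  comp f g := ⟨fun x => g.1 (f.1 x), (congrArg g.1 f.2).trans g.2⟩

/-- The pointed map `i_k` sending `k` to `1` and all other elements to `0`; here `k : Fin n`
stands for the element `k + 1` of `{1, …, n}`. -/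
def proj (n : ℕ) (k : Fin n) : FinStar.mk n ⟶ FinStar.mk 1 :=
  ⟨fun j => if j = k.succ then 1 else 0, if_neg (Fin.succ_ne_zero k).symm⟩

/-- The map `P_n : X(n) → X(1)^n` of a Γ-space. -/
def segalMap (X : FinStar ⥤ TopCat.{u}) (n : ℕ) :
    C(X.obj ⟨n⟩, Fin n → X.obj ⟨1⟩) :=
  ContinuousMap.pi fun k => (X.map (proj n k)).hom

/-- Special Γ-spaces. -/
def IsSpecialΓSpace (X : FinStar ⥤ TopCat.{u}) : Prop :=
  ∀ n : ℕ, IsWeakEquivalence (segalMap X n)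

/-- The pseudofunctor `P_n : A(n) → A(1)^n` of a Γ-bicategory. -/
def segalPseudofunctor (A : FinStar ⥤ Bicat.{u}) (n : ℕ) :
    SPseudofunctor (A.obj ⟨n⟩).carrier (Fin n → (A.obj ⟨1⟩).carrier) :=
  piLift fun k => Bicat.toPseudo (A.map (proj n k))

/-- Special Γ-bicategories. -/
def IsSpecialΓBicategory (A : FinStar ⥤ Bicat.{u}) : Prop :=
  ∀ n : ℕ, IsBiequivalence (segalPseudofunctor A n)

/-- The classifying space of a bicategory. -/
noncomputable abbrev classifyingSpaceObj (B : Bicat.{u}) : TopCat.{u} :=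
  classifyingSpace.obj ⟨B⟩

/-- The map of classifying spaces induced by a normal pseudofunctor. -/
noncomputable def classifyingSpaceMap {B C : Bicat.{u}}
    (F : SPseudofunctor B.carrier C.carrier) (hF : F.IsNormal) :
    C(classifyingSpaceObj B, classifyingSpaceObj C) :=
  (classifyingSpace.map (X := ⟨B⟩) (Y := ⟨C⟩) ⟨F, hF⟩).hom

/-- A Γ-space `X` is a model of the classifying space `|N A|` of a Γ-bicategory `A` whose
pseudofunctors `A(f)` need not be normal: its values are homotopy equivalent to the classifying
spaces `|N A(s)|`, in such a way that, up to homotopy, `X(f)` corresponds to `|N F|` for every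
normalization `F` of the pseudofunctor `A(f)` (and `A(f)` has a normalization). -/
def IsClassifyingΓSpace (A : FinStar ⥤ Bicat.{u}) (X : FinStar ⥤ TopCat.{u}) : Prop :=
  ∃ e : ∀ s : FinStar, ContinuousMap.HomotopyEquiv (classifyingSpaceObj (A.obj s)) (X.obj s),
    ∀ ⦃s t : FinStar⦄ (f : s ⟶ t),
      (∃ F : SPseudofunctor (A.obj s).carrier (A.obj t).carrier,
        F.IsNormal ∧ NatEquivalent F (Bicat.toPseudo (A.map f))) ∧
      ∀ (F : SPseudofunctor (A.obj s).carrier (A.obj t).carrier) (hF : F.IsNormal),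
        NatEquivalent F (Bicat.toPseudo (A.map f)) →
          ContinuousMap.Homotopic ((X.map f).hom.comp (e s).toFun)
            ((e t).toFun.comp (classifyingSpaceMap F hF))

end SegalGamma

/-! Two facts carry the theorem: a transformation between normal pseudofunctors gives a homotopy of
classifying spaces, and the classifying space of a finite power of a bicategory is weakly equivalent
to the power of the classifying space.

Homotopies. For `η : F → G` and a normal pseudofunctor `X : [n] → C`, the composites `FX` and `GX`
are the two ends of a normal pseudofunctor on `{0 < 1} × [n]`; its crossing 1-morphisms are
components of `η` followed by values of `GX`. Restricting it to the graphs of monotone maps `[n] →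
{0 < 1}`, which are the simplices of `Δ[1]`, gives a simplicial homotopy (`nerveHomotopy`), hence
`homotopic_classifyingSpaceMap`. The direction of `η` is irrelevant and no inverse of `η` enters.

Normality. Classifying spaces are functorial for normal pseudofunctors only, while the inverse of an
equivalence need not be normal. Therefore a new identity is adjoined at every object. A
pseudofunctor `F` then extends to a normal `augMap F` that sends new identities to new identities;
this is strictly functorial (`normalization`), and forgetting the distinction is a homotopy
equivalence on classifying spaces (`augHomotopyEquiv`). So `normalization ⋙ classifyingSpace`
supplies the model, equivalences of bicategories become homotopy equivalences there, and
`homotopic_augClassifyingSpaceMap` carries this back to any normalization of a given pseudofunctor.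

Products. The Segal nerve commutes strictly with products. The realization of a levelwise product
maps bijectively to the product of the realizations, because finitely many points of simplices have
a common subdivision. This bijection need not be a homeomorphism for the product topology, but maps
from compact spaces lift through it, which is enough for homotopy groups
(`isWeakEquivalence_realizationPi`).

Conclusion. Up to homotopy and homotopy equivalences, the Segal map of a model is the map to
`|N(A(1)^n)|` induced by a normalization of `P_n`, followed by the comparison with the n-th power.
Weak equivalences are invariant under homotopy; as homotopies move base points, this rests on
transport of generalized loops along paths. -/

namespace SegalGamma

/-! ### Weak homotopy equivalences: stability properties -/

/-! ### Retraction of the cylinder over a cube onto its bottom and sides. -/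

section CubeRetraction

open unitInterval

variable {n : ℕ}

/-- The distance of a point of the cube to the centre, normalized to be `1` on the boundary. -/
noncomputable def cubeRadius (y : Fin n → I) : ℝ :=
  ‖fun i => 2 * (y i : ℝ) - 1‖

theorem continuous_cubeRadius : Continuous (cubeRadius (n := n)) := by
  unfold cubeRadius
  fun_prop

theorem cubeRadius_le_one (y : Fin n → I) : cubeRadius y ≤ 1 := by
  refine (pi_norm_le_iff_of_nonneg zero_le_one).2 fun i => ?_
  rw [Real.norm_eq_abs, abs_le]
  constructor <;> linarith [(y i).2.1, (y i).2.2]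

theorem le_cubeRadius (y : Fin n → I) (i : Fin n) : |2 * (y i : ℝ) - 1| ≤ cubeRadius y :=
  norm_le_pi_norm (fun i => 2 * (y i : ℝ) - 1) i

theorem cubeRadius_boundary {y : Fin n → I} (hy : y ∈ Cube.boundary (Fin n)) :
    cubeRadius y = 1 := by
  obtain ⟨i, hi⟩ := hy
  refine le_antisymm (cubeRadius_le_one y) ?_
  refine le_trans ?_ (le_cubeRadius y i)
  rcases hi with hi | hi <;> rw [hi] <;> norm_num

theorem exists_eq_cubeRadius (y : Fin n → I) (h : 0 < cubeRadius y) :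
    ∃ i, |2 * (y i : ℝ) - 1| = cubeRadius y := by
  by_contra! hne
  have : ∀ i, ‖(fun i => 2 * (y i : ℝ) - 1) i‖ < cubeRadius y := fun i =>
    lt_of_le_of_ne (le_cubeRadius y i) (hne i)
  exact lt_irrefl _ ((pi_norm_lt_iff h).2 this)

/-- The scaling factor of the radial projection of the cylinder over a cube. -/
noncomputable def cubeScale (z : I × (Fin n → I)) : ℝ :=
  max ((2 - (z.1 : ℝ)) / 2) (cubeRadius z.2)

theorem cubeScale_pos (z : I × (Fin n → I)) : 0 < cubeScale z :=
  lt_of_lt_of_le (by linarith [z.1.2.2]) (le_max_left _ _)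

theorem continuous_cubeScale : Continuous (cubeScale (n := n)) := by
  have := continuous_cubeRadius (n := n)
  unfold cubeScale
  fun_prop

/-- The retraction of the cylinder over a cube to the union of its bottom and its sides. -/
noncomputable def cubeRetraction : C(I × (Fin n → I), I × (Fin n → I)) where
  -- Radial projection from the point at height 2 over the centre. In the coordinates `2y - 1` the
  -- ray through `z` is rescaled by `1 / cubeScale z`; it meets the bottom at scale `(2 - t) / 2`
  -- and the sides at scale `cubeRadius`, and the larger scale is the exit reached first. The values
  -- already lie in `[0, 1]`, so `projIcc` only supplies the type.
  toFun z := (Set.projIcc 0 1 zero_le_one (2 - (2 - (z.1 : ℝ)) / cubeScale z),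
    fun i => Set.projIcc 0 1 zero_le_one ((1 + (2 * (z.2 i : ℝ) - 1) / cubeScale z) / 2))
  continuous_toFun := by
    have h := continuous_cubeScale (n := n)
    have h' : ∀ z : I × (Fin n → I), cubeScale z ≠ 0 := fun z => (cubeScale_pos z).ne'
    refine Continuous.prodMk ?_ (continuous_pi fun i => ?_)
    · exact continuous_projIcc.comp
        (continuous_const.sub (Continuous.div (by fun_prop) h h'))
    · exact continuous_projIcc.comp
        ((continuous_const.add (Continuous.div (by fun_prop) h h')).div_const 2)

theorem cubeRetraction_mem (z : I × (Fin n → I)) :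
    (cubeRetraction z).1 = 0 ∨ (cubeRetraction z).2 ∈ Cube.boundary (Fin n) := by
  have hpos := cubeScale_pos z
  rcases le_total (cubeRadius z.2) ((2 - (z.1 : ℝ)) / 2) with h | h
  · left
    have h1 : cubeScale z = (2 - (z.1 : ℝ)) / 2 := max_eq_left h
    refine Set.projIcc_of_le_left zero_le_one ?_
    have : (2 - (z.1 : ℝ)) / cubeScale z = 2 := by
      rw [div_eq_iff hpos.ne', h1]
      ring
    rw [this]
    norm_num
  · right
    have h1 : cubeScale z = cubeRadius z.2 := max_eq_right h
    obtain ⟨i, hi⟩ := exists_eq_cubeRadius z.2 (h1 ▸ hpos)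
    refine ⟨i, ?_⟩
    rw [← h1] at hi
    rcases abs_choice (2 * (z.2 i : ℝ) - 1) with h2 | h2
    · right
      refine Set.projIcc_of_right_le zero_le_one ?_
      rw [show 2 * (z.2 i : ℝ) - 1 = cubeScale z by linarith, div_self hpos.ne']
      norm_num
    · left
      refine Set.projIcc_of_le_left zero_le_one ?_
      rw [show 2 * (z.2 i : ℝ) - 1 = -cubeScale z by linarith, neg_div, div_self hpos.ne']
      norm_num

theorem cubeRetraction_eq {z : I × (Fin n → I)}
    (hz : z.1 = 0 ∨ z.2 ∈ Cube.boundary (Fin n)) : cubeRetraction z = z := by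
  have h : cubeScale z = 1 := by
    rcases hz with h | h
    · refine (max_eq_left ?_).trans ?_
      · rw [h]
        simpa using cubeRadius_le_one z.2
      · rw [h]
        norm_num
    · refine (max_eq_right ?_).trans (cubeRadius_boundary h)
      rw [cubeRadius_boundary h]
      linarith [z.1.2.1]
  refine Prod.ext ?_ (funext fun i => ?_)
  · change Set.projIcc 0 1 zero_le_one (2 - (2 - (z.1 : ℝ)) / cubeScale z) = z.1
    rw [h, show 2 - (2 - (z.1 : ℝ)) / 1 = (z.1 : ℝ) by ring, Set.projIcc_val]
  · change Set.projIcc 0 1 zero_le_one ((1 + (2 * (z.2 i : ℝ) - 1) / cubeScale z) / 2) = z.2 i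
    rw [h, show (1 + (2 * (z.2 i : ℝ) - 1) / 1) / 2 = (z.2 i : ℝ) by ring, Set.projIcc_val]

theorem isClosed_cubeBoundary : IsClosed (Cube.boundary (Fin n)) := by
  have : Cube.boundary (Fin n) =
      ⋃ i : Fin n, ({y | y i = 0} ∪ {y | y i = 1} : Set (Fin n → I)) := by
    ext y
    simp [Cube.boundary]
  rw [this]
  exact isClosed_iUnion_of_finite fun i =>
    (isClosed_eq (continuous_apply i) continuous_const).union
      (isClosed_eq (continuous_apply i) continuous_const)

end CubeRetraction

/-! ### Transport of generalized loops along paths. -/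

section Transport

open unitInterval

variable {X : Type u} [TopologicalSpace X] {n : ℕ}

/-- Two generalized loops are freely homotopic along a path if there is a homotopy between them
which follows the path on the boundary of the cube. -/
def FreelyHomotopic {x y : X} (p : Path x y) (γ : GenLoop (Fin n) X x) (δ : GenLoop (Fin n) X y) :
    Prop :=
  ∃ K : ContinuousMap.Homotopy γ.1 δ.1, ∀ s, ∀ z ∈ Cube.boundary (Fin n), K (s, z) = p s

theorem FreelyHomotopic.symm {x y : X} {p : Path x y} {γ : GenLoop (Fin n) X x}
    {δ : GenLoop (Fin n) X y} (h : FreelyHomotopic p γ δ) : FreelyHomotopic p.symm δ γ := by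
  obtain ⟨K, hK⟩ := h
  exact ⟨K.symm, fun s z hz => hK _ z hz⟩

/-- Homotopy extension for the cube and its boundary: `γ` on the bottom and `p` on the sides glue to
a map, which extends over the cylinder by the retraction; `δ` is its top. -/
theorem exists_freelyHomotopic {x y : X} (p : Path x y) (γ : GenLoop (Fin n) X x) :
    ∃ δ : GenLoop (Fin n) X y, FreelyHomotopic p γ δ := by
  classical
  let K : I × (Fin n → I) → X := fun z =>
    if (cubeRetraction z).1 = 0 then γ (cubeRetraction z).2 else p (cubeRetraction z).1
  have hA : IsClosed {z : I × (Fin n → I) | (cubeRetraction z).1 = 0} :=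
    isClosed_eq (continuous_fst.comp cubeRetraction.continuous) continuous_const
  have hB : IsClosed {z : I × (Fin n → I) | (cubeRetraction z).2 ∈ Cube.boundary (Fin n)} :=
    isClosed_cubeBoundary.preimage (continuous_snd.comp cubeRetraction.continuous)
  -- The two branches agree where bottom and sides meet, since `γ` is constant on the boundary with
  -- value the source of `p`; hence gluing over two closed sets applies.
  have hKB : ∀ z, (cubeRetraction z).2 ∈ Cube.boundary (Fin n) →
      K z = p (cubeRetraction z).1 := by
    intro z hz
    by_cases h : (cubeRetraction z).1 = 0
    · simp only [K, if_pos h, h]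
      rw [p.source]
      exact γ.2 _ hz
    · simp only [K, if_neg h]
  have hK : Continuous K := by
    rw [← continuousOn_univ, show (Set.univ : Set (I × (Fin n → I))) = _ ∪ _ from
      (Set.eq_univ_of_forall fun z => cubeRetraction_mem z).symm]
    refine ContinuousOn.union_of_isClosed ?_ ?_ hA hB
    · refine ContinuousOn.congr (f := fun z => γ.1 (cubeRetraction z).2) ?_ fun z hz => if_pos hz
      exact (γ.1.continuous.comp (continuous_snd.comp cubeRetraction.continuous)).continuousOn
    · refine ContinuousOn.congr (f := fun z => p (cubeRetraction z).1) ?_ fun z hz => hKB z hz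
      exact (p.continuous.comp (continuous_fst.comp cubeRetraction.continuous)).continuousOn
  have hside : ∀ s, ∀ z ∈ Cube.boundary (Fin n), K (s, z) = p s := by
    intro s z hz
    have := cubeRetraction_eq (z := (s, z)) (Or.inr hz)
    rw [hKB _ (by rwa [this]), this]
  refine ⟨⟨⟨fun z => K (1, z), by fun_prop⟩, fun z hz => (hside 1 z hz).trans p.target⟩,
    { toFun := K
      map_zero_left := fun z => ?_
      map_one_left := fun z => rfl }, hside⟩
  have := cubeRetraction_eq (z := ((0 : I), z)) (Or.inl rfl)
  change (if _ then _ else _) = _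
  rw [this, if_pos rfl]
  rfl

/-- The top of a cylinder is determined up to homotopy by the bottom and the sides. -/
theorem homotopicRel_top {K L : C(I × (Fin n → I), X)}
    (h : ∀ z : I × (Fin n → I), z.1 = 0 ∨ z.2 ∈ Cube.boundary (Fin n) → K z = L z) :
    (K.comp ((ContinuousMap.const _ 1).prodMk (ContinuousMap.id _))).HomotopicRel
      (L.comp ((ContinuousMap.const _ 1).prodMk (ContinuousMap.id _))) (Cube.boundary (Fin n)) := by
  -- The straight-line homotopy inside the cylinder from the top to its image under the retraction
  -- is stationary over the boundary. After the retraction only the bottom and the sides matter, and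
  -- there `K` and `L` agree.
  have key : ∀ M : C(I × (Fin n → I), X),
      (M.comp ((ContinuousMap.const _ 1).prodMk (ContinuousMap.id _))).HomotopicRel
        ((M.comp cubeRetraction).comp ((ContinuousMap.const _ 1).prodMk (ContinuousMap.id _)))
        (Cube.boundary (Fin n)) := by
    intro M
    let c : C(I × (Fin n → I), I × (Fin n → I)) :=
      ⟨fun w => (Set.Icc.convexComb 1 (cubeRetraction (1, w.2)).1 w.1,
        fun i => Set.Icc.convexComb (w.2 i) ((cubeRetraction (1, w.2)).2 i) w.1), by
        have hr := (cubeRetraction (n := n)).continuous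
        have h0 : Continuous fun w : I × (Fin n → I) => cubeRetraction (1, w.2) := by fun_prop
        refine Continuous.prodMk ?_ (continuous_pi fun i => ?_)
        · exact Set.Icc.continuous_convexComb_prod.comp
            (continuous_const.prodMk (h0.fst.prodMk continuous_fst))
        · exact Set.Icc.continuous_convexComb_prod.comp
            (((continuous_apply i).comp continuous_snd).prodMk
              (((continuous_apply i).comp h0.snd).prodMk continuous_fst))⟩
    refine ⟨{ toContinuousMap := M.comp c, map_zero_left := ?_, map_one_left := ?_, prop' := ?_ }⟩
    · intro z
      simp [c]
    · intro z
      simp [c]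
    · intro t z hz
      have : cubeRetraction (1, z) = (1, z) := cubeRetraction_eq (Or.inr hz)
      simp [c, this]
  have e : K.comp cubeRetraction = L.comp cubeRetraction := by
    ext z
    exact h _ (cubeRetraction_mem z)
  exact (key K).trans (e ▸ (key L).symm)

/-- Stacking `K` on the constant homotopy of `γ`, and `K'` on the homotopy from `γ` to `γ'`, gives
two cylinders with the same bottom and the same sides; so their tops are homotopic relative to the
boundary. -/
theorem FreelyHomotopic.homotopic {x y : X} {p : Path x y} {γ γ' : GenLoop (Fin n) X x}
    {δ δ' : GenLoop (Fin n) X y} (h : FreelyHomotopic p γ δ) (h' : FreelyHomotopic p γ' δ')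
    (hγ : GenLoop.Homotopic γ γ') : GenLoop.Homotopic δ δ' := by
  obtain ⟨K, hK⟩ := h
  obtain ⟨K', hK'⟩ := h'
  obtain ⟨G⟩ := hγ
  let M := (ContinuousMap.Homotopy.refl γ.1).trans K
  let M' := G.toHomotopy.trans K'
  have hM : ∀ z : I × (Fin n → I), z.1 = 0 ∨ z.2 ∈ Cube.boundary (Fin n) → M z = M' z := by
    rintro ⟨s, z⟩ (h | h)
    · dsimp at h
      subst h
      rw [M.apply_zero, M'.apply_zero]
    · dsimp at h
      simp only [M, M', ContinuousMap.Homotopy.trans_apply]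
      split_ifs with hs
      · exact (G.eq_fst _ h).symm
      · rw [hK _ _ h, hK' _ _ h]
  have := homotopicRel_top (K := M.toContinuousMap) (L := M'.toContinuousMap) hM
  have e : ∀ {a b : C(Fin n → I, X)} (N : ContinuousMap.Homotopy a b), N.toContinuousMap.comp
      ((ContinuousMap.const _ 1).prodMk (ContinuousMap.id _)) = b := fun N => by
    ext z
    exact N.apply_one z
  rwa [e, e] at this

end Transport

/-! ### Homotopy invariance and criteria for weak equivalences. -/

section WeakEquivalenceLemmas

open unitInterval

variable {X Y Z : Type u} [TopologicalSpace X] [TopologicalSpace Y] [TopologicalSpace Z]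

/-- The image of a generalized loop under a continuous map. -/
def mapGenLoop (f : C(X, Y)) {n : ℕ} {x : X} (γ : GenLoop (Fin n) X x) :
    GenLoop (Fin n) Y (f x) :=
  ⟨f.comp γ.1, fun y hy => congrArg f (γ.2 y hy)⟩

theorem piMap_injective_iff (f : C(X, Y)) (n : ℕ) (x : X) :
    Function.Injective (piMap f n x) ↔ ∀ γ γ' : GenLoop (Fin n) X x,
      GenLoop.Homotopic (mapGenLoop f γ) (mapGenLoop f γ') → GenLoop.Homotopic γ γ' := by
  constructor
  · intro h γ γ' hγ
    exact Quotient.exact (h (a₁ := ⟦γ⟧) (a₂ := ⟦γ'⟧) (Quotient.sound hγ))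
  · rintro h ⟨γ⟩ ⟨γ'⟩ hγ
    exact Quotient.sound (h γ γ' (Quotient.exact hγ))

theorem piMap_surjective_iff (f : C(X, Y)) (n : ℕ) (x : X) :
    Function.Surjective (piMap f n x) ↔ ∀ δ : GenLoop (Fin n) Y (f x),
      ∃ γ : GenLoop (Fin n) X x, GenLoop.Homotopic (mapGenLoop f γ) δ := by
  constructor
  · intro h δ
    obtain ⟨⟨γ⟩, hγ⟩ := h ⟦δ⟧
    exact ⟨γ, Quotient.exact hγ⟩
  · rintro h ⟨δ⟩
    obtain ⟨γ, hγ⟩ := h δ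
    exact ⟨⟦γ⟧, Quotient.sound hγ⟩

theorem pi₀Map_injective_iff (f : C(X, Y)) :
    Function.Injective (pi₀Map f) ↔ ∀ x y : X, Joined (f x) (f y) → Joined x y := by
  constructor
  · intro h x y hxy
    exact Quotient.exact (h (a₁ := ⟦x⟧) (a₂ := ⟦y⟧) (Quotient.sound hxy))
  · rintro h ⟨x⟩ ⟨y⟩ hxy
    exact Quotient.sound (h x y (Quotient.exact hxy))

theorem pi₀Map_surjective_iff (f : C(X, Y)) :
    Function.Surjective (pi₀Map f) ↔ ∀ y : Y, ∃ x : X, Joined (f x) y := by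
  constructor
  · intro h y
    obtain ⟨⟨x⟩, hx⟩ := h ⟦y⟧
    exact ⟨x, Quotient.exact hx⟩
  · rintro h ⟨y⟩
    obtain ⟨x, hx⟩ := h y
    exact ⟨⟦x⟧, Quotient.sound hx⟩

theorem pi₀Map_comp (g : C(Y, Z)) (f : C(X, Y)) : pi₀Map (g.comp f) = pi₀Map g ∘ pi₀Map f := by
  funext x
  obtain ⟨x⟩ := x
  rfl

theorem piMap_comp (g : C(Y, Z)) (f : C(X, Y)) (n : ℕ) (x : X) :
    piMap (g.comp f) n x = piMap g n (f x) ∘ piMap f n x := by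
  funext γ
  obtain ⟨γ⟩ := γ
  rfl

theorem IsWeakEquivalence.comp {g : C(Y, Z)} {f : C(X, Y)} (hg : IsWeakEquivalence g)
    (hf : IsWeakEquivalence f) : IsWeakEquivalence (g.comp f) := by
  refine ⟨?_, fun n x hn => ?_⟩
  · rw [pi₀Map_comp]
    exact hg.1.comp hf.1
  · rw [piMap_comp]
    exact (hg.2 n _ hn).comp (hf.2 n x hn)

theorem isWeakEquivalence_id : IsWeakEquivalence (ContinuousMap.id X) := by
  refine ⟨?_, fun n x _ => ?_⟩
  · convert Function.bijective_id
    funext x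
    obtain ⟨x⟩ := x
    rfl
  · have : piMap (ContinuousMap.id X) n x = id := by
      funext γ
      obtain ⟨γ⟩ := γ
      rfl
    rw [this]
    exact Function.bijective_id

/-- The trace of a homotopy on a generalized loop. -/
theorem freelyHomotopic_of_homotopy {f g : C(X, Y)} (H : ContinuousMap.Homotopy f g) {n : ℕ}
    {x : X} (γ : GenLoop (Fin n) X x) :
    FreelyHomotopic (H.evalAt x) (mapGenLoop f γ) (mapGenLoop g γ) := by
  refine ⟨H.compContinuousMap γ.1, fun s z hz => ?_⟩
  change H (s, γ z) = H (s, x)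
  exact congrArg (fun w => H (s, w)) (γ.2 z hz)

/-- The maps induced by `f` and `g` differ by transport along the path traced by the base point.
Transport along the path and along its reverse respects homotopy classes, so bijectivity passes from
`f` to `g`. -/
theorem IsWeakEquivalence.of_homotopic {f g : C(X, Y)} (h : f.Homotopic g)
    (hf : IsWeakEquivalence f) : IsWeakEquivalence g := by
  obtain ⟨H⟩ := h
  have hH : ∀ x, Joined (f x) (g x) := fun x => ⟨H.evalAt x⟩
  refine ⟨⟨?_, ?_⟩, fun n x hn => ⟨?_, ?_⟩⟩
  · rw [pi₀Map_injective_iff]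
    intro x y hxy
    exact (pi₀Map_injective_iff f).1 hf.1.1 x y ((hH x).trans (hxy.trans (hH y).symm))
  · rw [pi₀Map_surjective_iff]
    intro y
    obtain ⟨x, hx⟩ := (pi₀Map_surjective_iff f).1 hf.1.2 y
    exact ⟨x, (hH x).symm.trans hx⟩
  · rw [piMap_injective_iff]
    intro γ γ' hγ
    refine (piMap_injective_iff f n x).1 (hf.2 n x hn).1 γ γ' ?_
    exact (freelyHomotopic_of_homotopy H γ).symm.homotopic
      (freelyHomotopic_of_homotopy H γ').symm hγ
  · rw [piMap_surjective_iff]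
    intro δ
    -- `δ` is based at `g x`; it is moved back to `f x`, where surjectivity is known for `f`.
    obtain ⟨δ₀, hδ₀⟩ := exists_freelyHomotopic (H.evalAt x).symm δ
    obtain ⟨γ, hγ⟩ := (piMap_surjective_iff f n x).1 (hf.2 n x hn).2 δ₀
    refine ⟨γ, (freelyHomotopic_of_homotopy H γ).homotopic (δ' := δ) ?_ hγ⟩
    have := hδ₀.symm
    rwa [Path.symm_symm] at this

theorem isWeakEquivalence_of_homotopyInverse {f : C(X, Y)} {g : C(Y, X)}
    (h₁ : (g.comp f).Homotopic (ContinuousMap.id X))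
    (h₂ : (f.comp g).Homotopic (ContinuousMap.id Y)) : IsWeakEquivalence f := by
  have w₁ := isWeakEquivalence_id.of_homotopic h₁.symm
  have w₂ := isWeakEquivalence_id.of_homotopic h₂.symm
  refine ⟨⟨?_, ?_⟩, fun n x hn => ?_⟩
  · have := w₁.1.1
    rw [pi₀Map_comp] at this
    exact this.of_comp
  · have := w₂.1.2
    rw [pi₀Map_comp] at this
    exact this.of_comp
  · have a := w₁.2 n x hn
    have b := w₂.2 n (f x) hn
    rw [piMap_comp] at a b
    -- `g` at the base point `f x` is the last factor of `g ∘ f` and the first factor of `f ∘ g`. It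
    -- is therefore bijective and can be cancelled, which avoids comparing `f` at `x` with `f` at `g
    -- (f x)`.
    have hg : Function.Bijective (piMap g n (f x)) := ⟨b.1.of_comp, a.2.of_comp⟩
    exact (Function.Bijective.of_comp_iff' hg _).1 a

theorem isWeakEquivalence_homotopyEquiv (e : ContinuousMap.HomotopyEquiv X Y) :
    IsWeakEquivalence e.toFun :=
  isWeakEquivalence_of_homotopyInverse e.left_inv e.right_inv

/-- A map through which maps from compact Hausdorff spaces lift uniquely is a weak equivalence. -/
theorem isWeakEquivalence_of_lift {f : C(X, Y)} (hf : Function.Injective f)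
    (h : ∀ (S : Type) [TopologicalSpace S] [CompactSpace S] (g : C(S, Y)),
      ∃ g' : C(S, X), f.comp g' = g) : IsWeakEquivalence f := by
  refine ⟨⟨?_, ?_⟩, fun n x hn => ⟨?_, ?_⟩⟩
  · rw [pi₀Map_injective_iff]
    rintro x y ⟨p⟩
    obtain ⟨q, hq⟩ := h I p.toContinuousMap
    have hq' : ∀ s, f (q s) = p s := fun s => congrArg (fun k => k s) hq
    refine ⟨⟨q, hf ?_, hf ?_⟩⟩
    · exact (hq' 0).trans p.source
    · exact (hq' 1).trans p.target
  · rw [pi₀Map_surjective_iff]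
    intro y
    obtain ⟨q, hq⟩ := h Unit (ContinuousMap.const _ y)
    refine ⟨q (), ?_⟩
    rw [show f (q ()) = y from congrArg (fun k => k ()) hq]
  · rw [piMap_injective_iff]
    rintro γ γ' ⟨H⟩
    obtain ⟨q, hq⟩ := h (I × (Fin n → I)) H.toContinuousMap
    have hq' : ∀ s, f (q s) = H s := fun s => congrArg (fun k => k s) hq
    refine ⟨{ toContinuousMap := q, map_zero_left := ?_, map_one_left := ?_, prop' := ?_ }⟩
    · intro z
      exact hf ((hq' _).trans (H.apply_zero z))
    · intro z
      exact hf ((hq' _).trans (H.apply_one z))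
    · intro t z hz
      exact hf ((hq' _).trans (H.eq_fst t hz))
  · rw [piMap_surjective_iff]
    intro δ
    obtain ⟨q, hq⟩ := h (Fin n → I) δ.1
    have hq' : ∀ s, f (q s) = δ s := fun s => congrArg (fun k => k s) hq
    refine ⟨⟨q, fun z hz => hf ((hq' z).trans (δ.2 z hz))⟩, ?_⟩
    have : mapGenLoop f ⟨q, fun z hz => hf ((hq' z).trans (δ.2 z hz))⟩ = δ := Subtype.ext hq
    rw [this]

end WeakEquivalenceLemmas

end SegalGamma

namespace SegalGamma

/-! ### Subdivision of points of topological simplices -/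

section Subdivision

/-- The partial sums of a point of a simplex. -/
def partialSum {n : ℕ} (t : stdSimplex ℝ (Fin (n + 1))) (j : Fin (n + 1)) : ℝ :=
  ∑ k with k ≤ j, t k

/-- Partial sums are the cumulative distribution function of the weights, so a pushforward
accumulates the mass of the preimage of an initial segment. In this form points of simplices become
finite sets of breakpoints in `[0, 1]`. -/
theorem partialSum_map {l n : ℕ} (f : Fin (l + 1) → Fin (n + 1))
    (r : stdSimplex ℝ (Fin (l + 1))) (j : Fin (n + 1)) :
    partialSum (stdSimplex.map f r) j = ∑ a with f a ≤ j, r a := by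
  classical
  unfold partialSum
  have : ∀ k, (stdSimplex.map f r) k = ∑ a with f a = k, r a := fun k => by
    rw [stdSimplex.map_coe, FunOnFinite.linearMap_apply_apply]
  simp_rw [this]
  rw [Finset.sum_sigma']
  refine Finset.sum_bij (fun x _ => x.2) ?_ ?_ ?_ ?_
  · rintro ⟨k, a⟩ h
    simp only [Finset.mem_sigma, Finset.mem_filter, Finset.mem_univ, true_and] at h ⊢
    exact h.2 ▸ h.1
  · rintro ⟨k, a⟩ h ⟨k', a'⟩ h' e
    simp only [Finset.mem_sigma, Finset.mem_filter, Finset.mem_univ, true_and] at h h' e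
    subst e
    obtain rfl : k = k' := h.2.symm.trans h'.2
    rfl
  · intro a ha
    simp only [Finset.mem_filter, Finset.mem_univ, true_and] at ha
    exact ⟨⟨f a, a⟩, by simpa using ha, rfl⟩
  · rintro _ _
    rfl

theorem ext_partialSum {n : ℕ} {t t' : stdSimplex ℝ (Fin (n + 1))}
    (h : ∀ j, partialSum t j = partialSum t' j) : t = t' := by
  have key : ∀ j, t j = t' j := by
    intro j
    induction j using Fin.induction with
    | zero =>
      have := h 0
      simpa [partialSum, Finset.filter_eq'] using this
    | succ j _ =>
      have h₁ := h j.succ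
      have h₂ := h j.castSucc
      have e : ∀ s : stdSimplex ℝ (Fin (n + 1)),
          partialSum s j.succ = partialSum s j.castSucc + s j.succ := by
        intro s
        unfold partialSum
        have : (Finset.univ.filter (· ≤ j.succ)) =
            insert j.succ (Finset.univ.filter (· ≤ j.castSucc)) := by
          ext k
          simp only [Finset.mem_filter, Finset.mem_univ, true_and, Finset.mem_insert, Fin.le_def,
            Fin.ext_iff, Fin.val_succ, Fin.val_castSucc]
          omega
        rw [this, Finset.sum_insert (by simp [Fin.le_def]), add_comm]
      rw [e, e] at h₁
      linarith
  exact stdSimplex.ext (funext key)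

theorem partialSum_last {n : ℕ} (t : stdSimplex ℝ (Fin (n + 1))) :
    partialSum t (Fin.last n) = 1 := by
  unfold partialSum
  rw [Finset.filter_true_of_mem fun k _ => Fin.le_last k]
  exact stdSimplex.sum_eq_one t

theorem partialSum_nonneg {n : ℕ} (t : stdSimplex ℝ (Fin (n + 1))) (j : Fin (n + 1)) :
    0 ≤ partialSum t j :=
  Finset.sum_nonneg fun k _ => stdSimplex.zero_le t k

theorem partialSum_mono {n : ℕ} (t : stdSimplex ℝ (Fin (n + 1))) : Monotone (partialSum t) := by
  intro i j h
  refine Finset.sum_le_sum_of_subset_of_nonneg ?_ fun k _ _ => stdSimplex.zero_le t k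
  intro k hk
  simp only [Finset.mem_filter, Finset.mem_univ, true_and] at hk ⊢
  exact hk.trans h

/-- Any finite set of breakpoints in `[0, 1]` containing `1` is the set of partial sums of a
point of a simplex. -/
theorem exists_partialSum_eq {l : ℕ} (s : Fin (l + 1) → ℝ) (hs : Monotone s) (h0 : 0 ≤ s 0)
    (h1 : s (Fin.last l) = 1) :
    ∃ r : stdSimplex ℝ (Fin (l + 1)), ∀ a, partialSum r a = s a := by
  let d : Fin (l + 1) → ℝ := Fin.cases (s 0) fun a => s a.succ - s a.castSucc
  have hd : ∀ b, ∑ k with k ≤ b, d k = s b := by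
    intro b
    induction b using Fin.induction with
    | zero => simp [Finset.filter_eq', d]
    | succ j ih =>
      have : (Finset.univ.filter (· ≤ j.succ)) =
          insert j.succ (Finset.univ.filter (· ≤ j.castSucc)) := by
        ext k
        simp only [Finset.mem_filter, Finset.mem_univ, true_and, Finset.mem_insert, Fin.le_def,
          Fin.ext_iff, Fin.val_succ, Fin.val_castSucc]
        omega
      rw [this, Finset.sum_insert (by simp [Fin.le_def]), ih]
      simp [d]
  refine ⟨⟨d, fun a => ?_, ?_⟩, hd⟩
  · induction a using Fin.cases with
    | zero => exact h0
    | succ a => exact sub_nonneg.2 (hs (Fin.castSucc_le_succ a))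
  · have := hd (Fin.last l)
    rwa [Finset.filter_true_of_mem fun k _ => Fin.le_last k, h1] at this

/-- Finitely many points of simplices are images of one point of a simplex under monotone
maps. -/
theorem exists_common_subdivision {ι : Type} [Fintype ι] (m : ι → ℕ)
    (t : ∀ i, stdSimplex ℝ (Fin (m i + 1))) :
    ∃ (l : ℕ) (r : stdSimplex ℝ (Fin (l + 1))) (θ : ∀ i, Fin (l + 1) →o Fin (m i + 1)),
      l < ∑ i, (m i + 1) + 1 ∧ ∀ i, stdSimplex.map (θ i) r = t i := by
  classical
  -- All breakpoints of all the given points, with `1` added in case `ι` is empty. The gaps between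
  -- consecutive elements are the weights of `r`, and the bound on `l` is the count of `S`; this
  -- bound later makes sets of operators finite.
  let S : Finset ℝ :=
    insert 1 (Finset.univ.image fun x : Σ i, Fin (m i + 1) => partialSum (t x.1) x.2)
  have h1S : (1 : ℝ) ∈ S := Finset.mem_insert_self _ _
  have hS1 : ∀ c ∈ S, c ≤ 1 := by
    intro c hc
    obtain rfl | hc := Finset.mem_insert.1 hc
    · exact le_rfl
    obtain ⟨⟨i, j⟩, -, rfl⟩ := Finset.mem_image.1 hc
    exact (partialSum_mono _ (Fin.le_last j)).trans (partialSum_last _).le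
  have hS0 : ∀ c ∈ S, 0 ≤ c := by
    intro c hc
    obtain rfl | hc := Finset.mem_insert.1 hc
    · exact zero_le_one
    obtain ⟨⟨i, j⟩, -, rfl⟩ := Finset.mem_image.1 hc
    exact partialSum_nonneg _ _
  obtain ⟨l, hl⟩ : ∃ l, S.card = l + 1 :=
    Nat.exists_eq_succ_of_ne_zero (Finset.card_pos.2 ⟨1, h1S⟩).ne'
  let s := S.orderEmbOfFin hl
  have hs : ∀ c ∈ S, ∃ a, s a = c := by
    intro c hc
    have : c ∈ Set.range s := by
      rw [Finset.range_orderEmbOfFin]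
      exact hc
    exact this
  have hsS : ∀ a, s a ∈ S := fun a => Finset.orderEmbOfFin_mem S hl a
  obtain ⟨r, hr⟩ := exists_partialSum_eq s s.monotone (hS0 _ (hsS 0)) (by
    refine le_antisymm (hS1 _ (hsS _)) ?_
    obtain ⟨a, ha⟩ := hs 1 h1S
    exact ha ▸ s.monotone (Fin.le_last a))
  have hex : ∀ i a, ∃ j, s a ≤ partialSum (t i) j := fun i a =>
    ⟨Fin.last _, (hS1 _ (hsS a)).trans (partialSum_last _).ge⟩
  -- `θ i a` is the first vertex whose partial sum reaches the breakpoint `s a`. The adjunction `hθ`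
  -- then gives both monotonicity and the partial sums of the pushforward.
  let θ : ∀ i, Fin (l + 1) → Fin (m i + 1) := fun i a => Fin.find _ (hex i a)
  have hθ : ∀ i a j, θ i a ≤ j ↔ s a ≤ partialSum (t i) j := by
    intro i a j
    constructor
    · intro h
      exact (Fin.find_spec (hex i a)).trans (partialSum_mono _ h)
    · intro h
      exact Fin.find_le_of_pos (hex i a) h
  refine ⟨l, r, fun i => ⟨θ i, fun a b hab => (hθ i a _).2 ((s.monotone hab).trans
    ((hθ i b _).1 le_rfl))⟩, ?_, fun i => ext_partialSum fun j => ?_⟩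
  · have := Finset.card_image_le (s := (Finset.univ : Finset (Σ i, Fin (m i + 1))))
      (f := fun x => partialSum (t x.1) x.2)
    have h2 := Finset.card_insert_le (1 : ℝ)
      (Finset.univ.image fun x : Σ i, Fin (m i + 1) => partialSum (t x.1) x.2)
    have h3 : (Finset.univ.image fun x : Σ i, Fin (m i + 1) => partialSum (t x.1) x.2).card ≤
      ∑ i, (m i + 1) := by simpa using this
    have h4 : S.card ≤ ∑ i, (m i + 1) + 1 := h2.trans (Nat.succ_le_succ h3)
    omega
  · rw [partialSum_map]
    obtain ⟨b, hb⟩ := hs (partialSum (t i) j)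
      (Finset.mem_insert_of_mem (Finset.mem_image.2 ⟨⟨i, j⟩, Finset.mem_univ _, rfl⟩))
    rw [← hb, ← hr b]
    unfold partialSum
    congr 1
    ext a
    simp only [Finset.mem_filter, Finset.mem_univ, true_and]
    change θ i a ≤ j ↔ _
    rw [hθ, ← hb, s.le_iff_le]

/-- Every point of a simplex lies in the interior of a face. -/
theorem exists_interior {l : ℕ} (r : stdSimplex ℝ (Fin (l + 1))) :
    ∃ (l' : ℕ) (r' : stdSimplex ℝ (Fin (l' + 1))) (δ : Fin (l' + 1) →o Fin (l + 1)),
      Function.Injective δ ∧ (∀ b, 0 < r b ↔ b ∈ Set.range δ) ∧ (∀ a, 0 < r' a) ∧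
        stdSimplex.map δ r' = r := by
  classical
  let S : Finset (Fin (l + 1)) := Finset.univ.filter fun b => 0 < r b
  have hne : S.Nonempty := by
    by_contra! h
    have : ∑ b, r b = 0 := Finset.sum_eq_zero fun b _ => by
      have hb : b ∉ S := by
        rw [h]
        exact Finset.notMem_empty b
      simp only [S, Finset.mem_filter, Finset.mem_univ, true_and, not_lt] at hb
      exact le_antisymm hb (stdSimplex.zero_le r b)
    rw [stdSimplex.sum_eq_one] at this
    exact one_ne_zero this
  obtain ⟨l', hl⟩ : ∃ l', S.card = l' + 1 :=
    Nat.exists_eq_succ_of_ne_zero (Finset.card_pos.2 hne).ne'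
  let s := S.orderEmbOfFin hl
  have hr : ∀ b, 0 < r b ↔ b ∈ Set.range s := by
    intro b
    rw [Finset.range_orderEmbOfFin]
    simp [S]
  have hsum : ∀ f : Fin (l + 1) → ℝ, (∀ b, b ∉ Set.range s → f b = 0) → ∑ a, f (s a) = ∑ b, f b := by
    intro f hf
    exact Finset.sum_of_injOn s s.injective.injOn (by simp) (fun b _ hb => hf b (by simpa using hb))
      fun _ _ => rfl
  have hr0 : ∀ b, b ∉ Set.range s → r b = 0 := fun b hb =>
    le_antisymm (not_lt.1 fun h => hb ((hr b).1 h)) (stdSimplex.zero_le r b)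
  refine ⟨l', ⟨fun a => r (s a), fun a => stdSimplex.zero_le r _,
    (hsum r hr0).trans (stdSimplex.sum_eq_one r)⟩, ⟨s, s.monotone⟩, s.injective, hr,
    fun a => (hr _).2 ⟨a, rfl⟩, ?_⟩
  refine stdSimplex.ext (funext fun b => ?_)
  rw [stdSimplex.map_coe, FunOnFinite.linearMap_apply_apply]
  by_cases hb : b ∈ Set.range s
  · obtain ⟨a, rfl⟩ := hb
    rw [Finset.sum_eq_single a]
    · rfl
    · intro a' ha' hne
      simp only [Finset.mem_filter, Finset.mem_univ, true_and] at ha'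
      exact absurd (s.injective ha') hne
    · intro h
      simp at h
  · rw [hr0 b hb]
    refine Finset.sum_eq_zero fun a ha => ?_
    simp only [Finset.mem_filter, Finset.mem_univ, true_and] at ha
    exact absurd ⟨a, ha⟩ hb

/-- A monotone map is determined by its effect on an interior point of a simplex. -/
theorem eq_of_map_eq {l m : ℕ} {r : stdSimplex ℝ (Fin (l + 1))} (hr : ∀ a, 0 < r a)
    {θ φ : Fin (l + 1) →o Fin (m + 1)} (h : stdSimplex.map θ r = stdSimplex.map φ r) : θ = φ := by
  classical
  -- If `θ a ≤ j < φ a`, monotonicity puts the preimage of `[0, j]` under `φ` inside that under `θ`,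
  -- and the inclusion misses `a`. As `r a > 0`, the partial sums at `j` would differ.
  have key : ∀ (θ φ : Fin (l + 1) →o Fin (m + 1)), stdSimplex.map θ r = stdSimplex.map φ r →
      ∀ j a, θ a ≤ j → φ a ≤ j := by
    intro θ φ h j a ha
    by_contra hb
    have h1 := congrArg (fun t => partialSum t j) h
    simp only [partialSum_map] at h1
    refine ne_of_lt ?_ h1.symm
    refine Finset.sum_lt_sum_of_subset (i := a) ?_ (by simpa using ha) (by simpa using hb)
      (hr a) fun b _ _ => (hr b).le
    intro b hb'
    simp only [Finset.mem_filter, Finset.mem_univ, true_and] at hb' ⊢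
    rcases le_total a b with hab | hab
    · exact absurd ((φ.monotone hab).trans hb') hb
    · exact (θ.monotone hab).trans ha
  ext1
  funext a
  exact le_antisymm (key φ θ h.symm _ a le_rfl) (key θ φ h _ a le_rfl)

end Subdivision

end SegalGamma

namespace SegalGamma

/-! ### Points of geometric realizations -/

section Realization

/-- The standard topological simplex. -/
abbrev TopSimplex (n : SimplexCategory) : Type := stdSimplex ℝ (Fin (n.len + 1))

instance (n : SimplexCategory) : CompactSpace (TopSimplex n) :=
  isCompact_iff_compactSpace.1 (isCompact_stdSimplex ℝ _)

/-- The effect of simplicial operators on standard simplices. -/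
noncomputable def push {n m : SimplexCategory} (f : n ⟶ m) : C(TopSimplex n, TopSimplex m) :=
  ⟨stdSimplex.map f, stdSimplex.continuous_map f⟩

theorem push_comp {n m l : SimplexCategory} (f : n ⟶ m) (g : m ⟶ l) (t : TopSimplex n) :
    push (f ≫ g) t = push g (push f t) := by
  have h : ⇑(f ≫ g) = ⇑g ∘ ⇑f := rfl
  change stdSimplex.map ⇑(f ≫ g) t = stdSimplex.map ⇑g (stdSimplex.map ⇑f t)
  rw [h, stdSimplex.map_comp_apply]

theorem push_id {n : SimplexCategory} (t : TopSimplex n) : push (𝟙 n) t = t := by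
  have h : ⇑(𝟙 n : n ⟶ n) = id := rfl
  change stdSimplex.map ⇑(𝟙 n : n ⟶ n) t = t
  rw [h, stdSimplex.map_id_apply]

theorem push_eq_imp {n m : SimplexCategory} {r : TopSimplex n} (hr : ∀ a, 0 < r a)
    {θ φ : n ⟶ m} (h : push θ r = push φ r) : θ = φ :=
  SimplexCategory.Hom.ext _ _ (eq_of_map_eq hr h)

theorem exists_common_push {ι : Type} [Fintype ι] {n : ι → SimplexCategory}
    (t : ∀ i, TopSimplex (n i)) :
    ∃ (l : SimplexCategory) (r : TopSimplex l) (θ : ∀ i, l ⟶ n i),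
      l.len < ∑ i, ((n i).len + 1) + 1 ∧ ∀ i, push (θ i) r = t i := by
  obtain ⟨l, r, θ, hl, h⟩ := exists_common_subdivision (fun i => (n i).len) t
  exact ⟨SimplexCategory.mk l, r, fun i => SimplexCategory.Hom.mk (θ i), hl, h⟩

theorem exists_interior_push {n : SimplexCategory} (r : TopSimplex n) :
    ∃ (l : SimplexCategory) (r' : TopSimplex l) (δ : l ⟶ n), Mono δ ∧
      (∀ b, 0 < r b ↔ b ∈ Set.range δ) ∧ (∀ a, 0 < r' a) ∧ push δ r' = r := by
  obtain ⟨l, r', δ, h₁, h₂, h₃, h₄⟩ := exists_interior r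
  exact ⟨SimplexCategory.mk l, r', SimplexCategory.Hom.mk δ, SimplexCategory.mono_iff_injective.2 h₁, h₂, h₃, h₄⟩

theorem exists_common_push_interior {ι : Type} [Fintype ι]
    {n : ι → SimplexCategory} (t : ∀ i, TopSimplex (n i)) :
    ∃ (l : SimplexCategory) (r : TopSimplex l) (θ : ∀ i, l ⟶ n i),
      l.len < ∑ i, ((n i).len + 1) + 1 ∧ (∀ a, 0 < r a) ∧ ∀ i, push (θ i) r = t i := by
  obtain ⟨l, r, θ, hl, h⟩ := exists_common_push t
  obtain ⟨l', r', δ, h₁, _, h₃, h₄⟩ := exists_interior_push r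
  refine ⟨l', r', fun i => δ ≫ θ i, lt_of_le_of_lt (SimplexCategory.len_le_of_mono δ) hl, h₃,
    fun i => ?_⟩
  rw [push_comp, h₄, h]

theorem exists_common_push_interior₂ {n m : SimplexCategory} (t : TopSimplex n)
    (s : TopSimplex m) :
    ∃ (l : SimplexCategory) (r : TopSimplex l) (θ : l ⟶ n) (φ : l ⟶ m),
      l.len < n.len + m.len + 3 ∧ (∀ a, 0 < r a) ∧ push θ r = t ∧ push φ r = s := by
  obtain ⟨l, r, θ, hl, hr, h⟩ := exists_common_push_interior (ι := Bool)
    (n := fun b => bif b then n else m) (fun b => match b with | true => t | false => s)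
  refine ⟨l, r, θ true, θ false, ?_, hr, h true, h false⟩
  simp at hl
  omega

variable (K : SSet.{u})

/-- Pairs of a simplex and a point of the corresponding standard simplex. -/
abbrev RealPoint : Type u := Σ n : SimplexCategory, K.obj (op n) × TopSimplex n

variable {K}

/-- The relation describing equality in the geometric realization. -/
def RealRel (p q : RealPoint K) : Prop :=
  ∃ (l : SimplexCategory) (r : TopSimplex l) (θ : l ⟶ p.1) (φ : l ⟶ q.1),
    K.map θ.op p.2.1 = K.map φ.op q.2.1 ∧ push θ r = p.2.2 ∧ push φ r = q.2.2

theorem map_op_comp {n m l : SimplexCategory} (f : n ⟶ m) (g : m ⟶ l) (x : K.obj (op l)) :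
    K.map (f ≫ g).op x = K.map f.op (K.map g.op x) := by
  rw [op_comp]
  exact K.map_comp_apply _ _ x

theorem map_op_id {n : SimplexCategory} (x : K.obj (op n)) : K.map (𝟙 n).op x = x :=
  K.map_id_apply _ x

/-- The two witnesses have a common refinement at an interior point `v`. Both composites to the
middle simplex send `v` to the same point, so they are the same operator, and the two equations of
simplices can be chained. -/
theorem RealRel.trans {p q s : RealPoint K} (h : RealRel p q) (h' : RealRel q s) :
    RealRel p s := by
  obtain ⟨l, r, θ, φ, h₁, h₂, h₃⟩ := h
  obtain ⟨l', r', θ', φ', h₁', h₂', h₃'⟩ := h'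
  obtain ⟨k, v, α, β, -, hv, hα, hβ⟩ := exists_common_push_interior₂ r r'
  have e : α ≫ φ = β ≫ θ' := push_eq_imp hv (by
    rw [push_comp, push_comp, hα, hβ, h₃, h₂'])
  refine ⟨k, v, α ≫ θ, β ≫ φ', ?_, ?_, ?_⟩
  · rw [map_op_comp, h₁, ← map_op_comp, e, map_op_comp, h₁', ← map_op_comp]
  · rw [push_comp, hα, h₂]
  · rw [push_comp, hβ, h₃']

variable (K)

/-- The setoid describing the geometric realization. -/
def realSetoid : Setoid (RealPoint K) where
  r := RealRel
  iseqv :=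
    { refl := fun p => ⟨p.1, p.2.2, 𝟙 _, 𝟙 _, rfl, push_id _, push_id _⟩
      symm := fun ⟨l, r, θ, φ, h₁, h₂, h₃⟩ => ⟨l, r, φ, θ, h₁.symm, h₃, h₂⟩
      trans := RealRel.trans }

variable {K}

/-- The characteristic map of a simplex of a geometric realization. -/
noncomputable def charMap {n : SimplexCategory} (x : K.obj (op n)) :
    C(TopSimplex n, SSet.toTop.obj K) :=
  (SSet.toTop.map (SSet.yonedaEquiv.symm x)).hom.comp
    (⟨n.toTopHomeo.symm, n.toTopHomeo.symm.continuous⟩ :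
      C(TopSimplex n, SSet.toTop.obj (SSet.stdSimplex.obj n)))

theorem toTop_map_charMap {L : SSet.{u}} (f : K ⟶ L) {n : SimplexCategory} (x : K.obj (op n))
    (t : TopSimplex n) : SSet.toTop.map f (charMap x t) = charMap (f.app _ x) t := by
  have : SSet.yonedaEquiv.symm x ≫ f = SSet.yonedaEquiv.symm (f.app _ x) := by
    apply SSet.yonedaEquiv.injective
    rw [SSet.yonedaEquiv_comp]
    simp
  change _ = SSet.toTop.map (SSet.yonedaEquiv.symm (f.app _ x)) _
  rw [← this, Functor.map_comp]
  rfl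

theorem charMap_map {n m : SimplexCategory} (f : n ⟶ m) (x : K.obj (op m)) (t : TopSimplex n) :
    charMap (K.map f.op x) t = charMap x (push f t) := by
  have : SSet.yonedaEquiv.symm (K.map f.op x) =
      SSet.stdSimplex.map f ≫ SSet.yonedaEquiv.symm x := by
    apply SSet.yonedaEquiv.injective
    rw [SSet.yonedaEquiv_comp]
    simp [SSet.yonedaEquiv_map]
    exact (SSet.yonedaEquiv_symm_app_objEquiv_symm x f).symm
  change SSet.toTop.map (SSet.yonedaEquiv.symm (K.map f.op x)) _ = _
  rw [this, Functor.map_comp]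
  exact congrArg (SSet.toTop.map (SSet.yonedaEquiv.symm x))
    (SimplexCategory.toTopHomeo_symm_naturality_apply f t).symm

/-- Under the adjunction with singular simplicial sets, the adjunct of `g` consists of the
restrictions of `g` to characteristic maps. This yields both uniqueness and existence of maps given
simplex by simplex. -/
theorem homEquiv_apply {Z : TopCat.{u}} (g : SSet.toTop.obj K ⟶ Z) {n : SimplexCategory}
    (x : K.obj (op n)) (t : TopSimplex n) :
    (TopCat.toSSetObjEquiv Z (op n)) ((sSetTopAdj.homEquiv K Z g).app (op n) x) t =
      g (charMap x t) := by
  rw [Adjunction.homEquiv_unit]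
  have := sSetTopAdj_unit_app_app_down K (op n) x
  change (((sSetTopAdj.unit.app K).app (op n) x).down ≫ g) _ = _
  rw [this]
  rfl

theorem toTop_hom_ext {Z : TopCat.{u}} {g g' : SSet.toTop.obj K ⟶ Z}
    (h : ∀ {n : SimplexCategory} (x : K.obj (op n)) (t : TopSimplex n),
      g (charMap x t) = g' (charMap x t)) : g = g' := by
  apply (sSetTopAdj.homEquiv K Z).injective
  ext n x
  obtain ⟨n⟩ := n
  apply (TopCat.toSSetObjEquiv Z (op n)).injective
  ext t
  exact (homEquiv_apply g x t).trans ((h x t).trans (homEquiv_apply g' x t).symm)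

theorem exists_toTop_desc {Z : TopCat.{u}}
    (c : ∀ {n : SimplexCategory}, K.obj (op n) → C(TopSimplex n, Z))
    (hc : ∀ {n m : SimplexCategory} (f : n ⟶ m) (x : K.obj (op m)) (t : TopSimplex n),
      c (K.map f.op x) t = c x (push f t)) :
    ∃ g : SSet.toTop.obj K ⟶ Z, ∀ {n : SimplexCategory} (x : K.obj (op n)) (t : TopSimplex n),
      g (charMap x t) = c x t := by
  let s : K ⟶ TopCat.toSSet.obj Z :=
    { app := fun n => TypeCat.ofHom fun x => (TopCat.toSSetObjEquiv Z n).symm (c x)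
      naturality := fun m n f => by
        ext x
        obtain ⟨m⟩ := m
        obtain ⟨n⟩ := n
        obtain ⟨f, rfl⟩ : ∃ f' : n ⟶ m, f = f'.op := ⟨f.unop, rfl⟩
        apply (TopCat.toSSetObjEquiv Z (op n)).injective
        ext t
        exact hc f x t }
  refine ⟨(sSetTopAdj.homEquiv K Z).symm s, fun {n} x t => ?_⟩
  rw [← homEquiv_apply, Equiv.apply_symm_apply]
  rfl

/-- Quotient topology of a disjoint union of standard simplices: each set of simplices of `K` is
taken discrete. -/
instance : TopologicalSpace (Quotient (realSetoid K)) :=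
  letI (n : SimplexCategory) : TopologicalSpace (K.obj (op n)) := ⊥
  inferInstanceAs (TopologicalSpace (Quotient (realSetoid K)))

theorem quotient_continuous_mk {n : SimplexCategory} (x : K.obj (op n)) :
    Continuous fun t : TopSimplex n => (Quotient.mk (realSetoid K) ⟨n, x, t⟩) := by
  let (n : SimplexCategory) : TopologicalSpace (K.obj (op n)) := ⊥
  exact continuous_quotient_mk'.comp (continuous_sigmaMk.comp (Continuous.prodMk_right x))

theorem quotient_continuous_iff {Z : Type*} [TopologicalSpace Z]
    {f : Quotient (realSetoid K) → Z} :
    Continuous f ↔ ∀ {n : SimplexCategory} (x : K.obj (op n)),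
      Continuous fun t : TopSimplex n => f (Quotient.mk (realSetoid K) ⟨n, x, t⟩) := by
  let (n : SimplexCategory) : TopologicalSpace (K.obj (op n)) := ⊥
  have (n : SimplexCategory) : DiscreteTopology (K.obj (op n)) := ⟨rfl⟩
  constructor
  · intro h n x
    exact h.comp (quotient_continuous_mk x)
  · intro h
    refine isQuotientMap_quotient_mk'.continuous_iff.2 ?_
    exact continuous_sigma fun n => continuous_prod_of_discrete_left.2 fun x => h x

/-- The geometric realization is the space of equivalence classes of pairs of a simplex and a
point of the corresponding standard simplex. -/
theorem exists_realization_homeo (K : SSet.{u}) :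
    ∃ e : SSet.toTop.obj K ≃ₜ Quotient (realSetoid K),
      ∀ {n : SimplexCategory} (x : K.obj (op n)) (t : TopSimplex n),
        e (charMap x t) = Quotient.mk (realSetoid K) ⟨n, x, t⟩ := by
  obtain ⟨g, hg⟩ := exists_toTop_desc (K := K) (Z := TopCat.of (Quotient (realSetoid K)))
    (fun {n} x => ⟨fun t => Quotient.mk (realSetoid K) ⟨n, x, t⟩, quotient_continuous_mk x⟩)
    (fun {n m} f x t => Quotient.sound ⟨n, t, 𝟙 n, f, by rw [map_op_id], push_id _, rfl⟩)
  let b : Quotient (realSetoid K) → SSet.toTop.obj K :=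
    Quotient.lift (fun p => charMap p.2.1 p.2.2) (by
      rintro ⟨n, x, t⟩ ⟨m, y, s⟩ ⟨l, r, θ, φ, h₁, h₂, h₃⟩
      dsimp at h₁ h₂ h₃ ⊢
      rw [← h₂, ← h₃, ← charMap_map, ← charMap_map, h₁])
  have hb : Continuous b := quotient_continuous_iff.2 fun x => (charMap x).continuous
  have hbg : g ≫ TopCat.ofHom ⟨b, hb⟩ = 𝟙 _ := toTop_hom_ext fun x t => by
    change b (g (charMap x t)) = _
    rw [hg]
    rfl
  refine ⟨{ toFun := g, invFun := b, left_inv := fun z => congrArg (fun k => k z) hbg,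
            right_inv := ?_, continuous_toFun := g.hom.continuous, continuous_invFun := hb },
    fun x t => hg x t⟩
  rintro ⟨n, x, t⟩
  exact hg x t

/-- Since `RealRel` is already an equivalence relation, equality in the realization has a one-step
witness rather than a zigzag. -/
theorem charMap_eq_iff {n m : SimplexCategory} {x : K.obj (op n)} {y : K.obj (op m)}
    {t : TopSimplex n} {s : TopSimplex m} :
    charMap x t = charMap y s ↔ RealRel (⟨n, x, t⟩ : RealPoint K) ⟨m, y, s⟩ := by
  obtain ⟨e, he⟩ := exists_realization_homeo K
  rw [← e.injective.eq_iff, he, he]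
  exact Quotient.eq (r := realSetoid K)

theorem charMap_surjective (z : SSet.toTop.obj K) :
    ∃ (n : SimplexCategory) (x : K.obj (op n)) (t : TopSimplex n), charMap x t = z := by
  obtain ⟨e, he⟩ := exists_realization_homeo K
  obtain ⟨⟨n, x, t⟩, h⟩ := Quotient.exists_rep (e z)
  exact ⟨n, x, t, e.injective ((he x t).trans h)⟩

theorem continuous_realization_iff {Z : Type*} [TopologicalSpace Z]
    {f : SSet.toTop.obj K → Z} :
    Continuous f ↔ ∀ {n : SimplexCategory} (x : K.obj (op n)), Continuous (f ∘ charMap x) := by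
  obtain ⟨e, he⟩ := exists_realization_homeo K
  refine ⟨fun h n x => h.comp (charMap x).continuous, fun h => ?_⟩
  have : Continuous (f ∘ e.symm) := quotient_continuous_iff.2 fun {n} x => by
    refine (h x).congr fun t => ?_
    change f (charMap x t) = f (e.symm _)
    rw [← he, e.symm_apply_apply]
  refine (this.comp e.continuous).congr fun z => ?_
  simp

theorem isClosed_realization_iff {C : Set (SSet.toTop.obj K)} :
    IsClosed C ↔ ∀ {n : SimplexCategory} (x : K.obj (op n)), IsClosed (charMap x ⁻¹' C) := by
  refine ⟨fun h n x => h.preimage (charMap x).continuous, fun h => ?_⟩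
  rw [← isOpen_compl_iff]
  -- Openness is continuity of a predicate into the Sierpiński space `Prop`, so the universal
  -- property for maps out of the realization applies.
  change IsOpen {z | z ∉ C}
  rw [← continuous_Prop]
  refine continuous_realization_iff.2 fun x => ?_
  exact continuous_Prop.2 (h x).isOpen_compl

end Realization

end SegalGamma

namespace SegalGamma

/-! ### The topology of geometric realizations -/

section RealizationTopology

/-- A pushforward with full support forces `β` to be surjective, and any set-theoretic section of a
monotone surjection of linear orders is monotone. -/
theorem exists_section_of_push {j k : SimplexCategory} {w : TopSimplex j} {v : TopSimplex k}
    (hv : ∀ a, 0 < v a) {β : j ⟶ k} (h : push β w = v) : ∃ σ : k ⟶ j, σ ≫ β = 𝟙 k := by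
  classical
  have hsurj : ∀ b, ∃ a, β a = b := by
    intro b
    by_contra! hne
    have h1 : v b = ∑ a with β a = b, w a := by
      rw [← h]
      exact FunOnFinite.linearMap_apply_apply ..
    rw [Finset.sum_eq_zero] at h1
    · exact absurd (hv b) (by rw [h1]; exact lt_irrefl 0)
    · intro a ha
      simp only [Finset.mem_filter, Finset.mem_univ, true_and] at ha
      exact absurd ha (hne a)
  choose s hs using hsurj
  refine ⟨SimplexCategory.Hom.mk ⟨s, fun a b hab => ?_⟩, ?_⟩
  · by_contra! hlt
    have := β.toOrderHom.monotone hlt.le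
    have h2 : b ≤ a := by
      rw [← hs a, ← hs b]
      exact this
    obtain rfl := le_antisymm hab h2
    exact lt_irrefl _ hlt
  · ext a : 3
    exact hs a

variable {K : SSet.{u}}

/-- Over an interior point, equality in the realization is an equality of simplices. A refinement
`w` of the witness and of `v` identifies the operators through `β`, and `β` is then cancelled by its
section. This replaces the use of nondegenerate representatives. -/
theorem map_eq_of_charMap_eq {n m k : SimplexCategory} {x : K.obj (op n)} {y : K.obj (op m)}
    {v : TopSimplex k} (hv : ∀ a, 0 < v a) {θ : k ⟶ n} {φ : k ⟶ m}
    (h : charMap x (push θ v) = charMap y (push φ v)) : K.map θ.op x = K.map φ.op y := by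
  obtain ⟨l, r, θ', φ', h₁, h₂, h₃⟩ := charMap_eq_iff.1 h
  obtain ⟨j, w, α, β, -, hw, hα, hβ⟩ := exists_common_push_interior₂ r v
  dsimp at h₁ h₂ h₃ θ' φ'
  obtain ⟨σ, hσ⟩ := exists_section_of_push hv hβ
  have e₁ : β ≫ θ = α ≫ θ' := push_eq_imp hw (by rw [push_comp, push_comp, hα, hβ, h₂])
  have e₂ : β ≫ φ = α ≫ φ' := push_eq_imp hw (by rw [push_comp, push_comp, hα, hβ, h₃])
  calc K.map θ.op x = K.map σ.op (K.map (β ≫ θ).op x) := by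
        rw [← map_op_comp, ← Category.assoc, hσ, Category.id_comp]
    _ = K.map σ.op (K.map (β ≫ φ).op y) := by
        rw [e₁, e₂, map_op_comp, map_op_comp, h₁]
    _ = K.map φ.op y := by
        rw [← map_op_comp, ← Category.assoc, hσ, Category.id_comp]

/-- Closedness is tested on each simplex `y`. There the image of `C` becomes a finite union of
compact sets, one for each pair of operators from a simplex of bounded dimension that identifies
faces of `x` and `y`; boundedness comes from the common subdivision. -/
theorem isClosedMap_charMap {n : SimplexCategory} (x : K.obj (op n)) :
    IsClosedMap (charMap x) := by
  intro C hC
  refine isClosed_realization_iff.2 fun {m} y => ?_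
  let ι := Σ l : Fin (n.len + m.len + 3), (SimplexCategory.mk l ⟶ n) × (SimplexCategory.mk l ⟶ m)
  have key : charMap y ⁻¹' (charMap x '' C) =
      ⋃ i : {i : ι // K.map i.2.1.op x = K.map i.2.2.op y},
        push i.1.2.2 '' (push i.1.2.1 ⁻¹' C) := by
    ext s
    simp only [Set.mem_preimage, Set.mem_image, Set.mem_iUnion]
    constructor
    · rintro ⟨t, ht, hts⟩
      obtain ⟨l, v, θ, φ, hl, hv, rfl, rfl⟩ := exists_common_push_interior₂ t s
      exact ⟨⟨⟨⟨l.len, hl⟩, θ, φ⟩, map_eq_of_charMap_eq hv hts⟩, v, ht, rfl⟩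
    · rintro ⟨⟨⟨l, θ, φ⟩, h⟩, v, hv, rfl⟩
      refine ⟨push θ v, hv, ?_⟩
      dsimp at h ⊢
      rw [← charMap_map, ← charMap_map, h]
  rw [key]
  exact isClosed_iUnion_of_finite fun i =>
    ((hC.preimage (push i.1.2.1).continuous).isCompact.image (push i.1.2.2).continuous).isClosed

instance (K : SSet.{u}) : T1Space (SSet.toTop.obj K) where
  t1 z := by
    obtain ⟨n, x, t, rfl⟩ := charMap_surjective z
    rw [← Set.image_singleton]
    exact isClosedMap_charMap x _ isClosed_singleton

theorem isProperMap_charMap {n : SimplexCategory} (x : K.obj (op n)) :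
    IsProperMap (charMap x) :=
  isProperMap_iff_isClosedMap_and_compact_fibers.2 ⟨(charMap x).continuous,
    isClosedMap_charMap x, fun _ => (isClosed_singleton.preimage (charMap x).continuous).isCompact⟩

theorem exists_interior_charMap (z : SSet.toTop.obj K) :
    ∃ (n : SimplexCategory) (x : K.obj (op n)) (t : TopSimplex n),
      (∀ a, 0 < t a) ∧ charMap x t = z := by
  obtain ⟨n, x, t, rfl⟩ := charMap_surjective z
  obtain ⟨l, r, δ, -, -, hr, rfl⟩ := exists_interior_push t
  exact ⟨l, K.map δ.op x, r, hr, charMap_map δ x r⟩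

/-- The simplices which can be obtained from a given one by simplicial operators. -/
def simplexClosure {n : SimplexCategory} (x : K.obj (op n)) :
    Set (Σ m : SimplexCategory, K.obj (op m)) :=
  {y | ∃ f : y.1 ⟶ n, K.map f.op x = y.2}

theorem simplexClosure_le {n m : SimplexCategory} {x : K.obj (op n)} {y : K.obj (op m)}
    {f : n ⟶ m} (h : K.map f.op y = x) : simplexClosure x ⊆ simplexClosure y := by
  rintro ⟨l, z⟩ ⟨g, hg⟩
  refine ⟨g ≫ f, ?_⟩
  rw [map_op_comp, h]
  exact hg

/-- Two simplices having the same point in their interiors are obtained from each other by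
operators, through a common refinement and sections. Hence `carrierClosure` does not depend on the
choices in its definition. -/
theorem simplexClosure_eq {n m : SimplexCategory} {x : K.obj (op n)} {y : K.obj (op m)}
    {t : TopSimplex n} {s : TopSimplex m} (ht : ∀ a, 0 < t a) (hs : ∀ a, 0 < s a)
    (h : charMap x t = charMap y s) : simplexClosure x = simplexClosure y := by
  obtain ⟨l, v, θ, φ, -, hv, hθ, hφ⟩ := exists_common_push_interior₂ t s
  have e : K.map θ.op x = K.map φ.op y := map_eq_of_charMap_eq hv (by rw [hθ, hφ, h])
  obtain ⟨σ, hσ⟩ := exists_section_of_push ht hθ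
  obtain ⟨τ, hτ⟩ := exists_section_of_push hs hφ
  refine Set.Subset.antisymm (simplexClosure_le (f := σ ≫ φ) ?_)
    (simplexClosure_le (f := τ ≫ θ) ?_)
  · rw [map_op_comp, ← e, ← map_op_comp, hσ, map_op_id]
  · rw [map_op_comp, e, ← map_op_comp, hτ, map_op_id]

/-- The closure of the simplex carrying a point of a geometric realization. -/
noncomputable def carrierClosure (z : SSet.toTop.obj K) :
    Set (Σ m : SimplexCategory, K.obj (op m)) :=
  simplexClosure (exists_interior_charMap z).choose_spec.choose

theorem carrierClosure_charMap {n : SimplexCategory} (x : K.obj (op n)) {t : TopSimplex n}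
    (ht : ∀ a, 0 < t a) : carrierClosure (charMap x t) = simplexClosure x := by
  obtain ⟨h₁, h₂⟩ := (exists_interior_charMap (charMap x t)).choose_spec.choose_spec.choose_spec
  exact simplexClosure_eq h₁ ht h₂

theorem finite_carrierClosure {n : SimplexCategory} (x : K.obj (op n)) :
    (carrierClosure '' Set.range (charMap x)).Finite := by
  let ι := Σ l : Fin (n.len + 1), (SimplexCategory.mk l ⟶ n)
  refine (Set.finite_range fun i : ι => simplexClosure (K.map i.2.op x)).subset ?_
  rintro _ ⟨_, ⟨t, rfl⟩, rfl⟩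
  obtain ⟨l, r, δ, hδ, -, hr, rfl⟩ := exists_interior_push t
  refine ⟨⟨⟨l.len, Nat.lt_succ_of_le (SimplexCategory.len_le_of_mono δ)⟩, δ⟩, ?_⟩
  rw [← charMap_map, carrierClosure_charMap _ hr]

/-- One point of `C` is chosen for each carrier. The resulting set `T` meets every simplex in a
finite set, so `T` without any one of its points or limit points is closed; an infinite `T` would
contradict compactness. -/
theorem exists_finite_cover {C : Set (SSet.toTop.obj K)} (hC : IsCompact C) :
    ∃ F : Set (Σ n : SimplexCategory, K.obj (op n)), F.Finite ∧
      ∀ z ∈ C, ∃ p ∈ F, z ∈ Set.range (charMap p.2) := by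
  have hfin : (carrierClosure '' C).Finite := by
    by_contra hinf
    obtain ⟨T, hTC, hT⟩ := Set.SurjOn.exists_bijOn_subset (Set.surjOn_image carrierClosure C)
    have hTinf : T.Infinite := fun h => hinf (hT.image_eq ▸ h.image carrierClosure)
    obtain ⟨a, -, ha⟩ := hTinf.exists_accPt_of_subset_isCompact hC hTC
    have hclosed : IsClosed (T \ {a}) := by
      refine isClosed_realization_iff.2 fun {n} x => ?_
      have : charMap x ⁻¹' (T \ {a}) =
          charMap x ⁻¹' ((T \ {a}) ∩ Set.range (charMap x)) := by
        ext t
        simp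
      rw [this]
      refine IsClosed.preimage (charMap x).continuous (Set.Finite.isClosed ?_)
      refine Set.Finite.of_finite_image ((finite_carrierClosure x).subset
        (Set.image_mono Set.inter_subset_right)) (hT.injOn.mono ?_)
      exact fun z hz => hz.1.1
    have := (accPt_principal_iff_clusterPt.1 ha)
    rw [← mem_closure_iff_clusterPt, hclosed.closure_eq] at this
    exact this.2 rfl
  have hrep : ∀ A ∈ carrierClosure '' C, ∃ p : Σ n : SimplexCategory, K.obj (op n),
      simplexClosure p.2 = A := by
    rintro _ ⟨z, -, rfl⟩
    exact ⟨⟨_, (exists_interior_charMap z).choose_spec.choose⟩, rfl⟩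
  choose p hp using hrep
  have := hfin.to_subtype
  refine ⟨Set.range fun A : carrierClosure '' C => p A.1 A.2, Set.finite_range _,
    fun z hz => ⟨_, ⟨⟨_, z, hz, rfl⟩, rfl⟩, ?_⟩⟩
  have h := hp _ ⟨z, hz, rfl⟩
  change z ∈ Set.range (charMap (p (carrierClosure z) ⟨z, hz, rfl⟩).2)
  generalize p (carrierClosure z) ⟨z, hz, rfl⟩ = p₀ at h ⊢
  obtain ⟨n, x, t, ht, rfl⟩ := exists_interior_charMap z
  rw [carrierClosure_charMap x ht] at h
  -- As `x` belongs to its own closure, it is the image under some operator `f` of the chosen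
  -- representative, which therefore covers `z`.
  have hx : (⟨n, x⟩ : Σ m : SimplexCategory, K.obj (op m)) ∈ simplexClosure x :=
    ⟨𝟙 n, map_op_id x⟩
  rw [← h] at hx
  obtain ⟨f, hf⟩ := hx
  dsimp at f hf
  exact ⟨push f t, by rw [← charMap_map, hf]⟩

end RealizationTopology

/-! ### Realizations of finite products. -/

section RealizationProduct

variable {ι : Type} {K : SSet.{u}} {L : ι → SSet.{u}} (π : ∀ i, K ⟶ L i)

/-- The comparison map from the realization of a product to the product of the realizations. -/
noncomputable def realizationPi : C(SSet.toTop.obj K, ∀ i, SSet.toTop.obj (L i)) :=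
  ContinuousMap.pi fun i => (SSet.toTop.map (π i)).hom

/-- The morphisms `π i` exhibit `K` as a product. -/
def IsLevelwiseProduct : Prop :=
  ∀ n : SimplexCategory, Function.Bijective fun (x : K.obj (op n)) i => (π i).app (op n) x

variable {π}

theorem realizationPi_charMap {n : SimplexCategory} (x : K.obj (op n)) (t : TopSimplex n) (i : ι) :
    realizationPi π (charMap x t) i = charMap ((π i).app _ x) t :=
  toTop_map_charMap (π i) x t

/-- Two points are written over one interior point `v`. Then each coordinate of the two simplices
agrees by `map_eq_of_charMap_eq`, so the simplices agree. -/
theorem realizationPi_injective (hπ : IsLevelwiseProduct π) :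
    Function.Injective (realizationPi π) := by
  intro z z' h
  obtain ⟨n, x, t, rfl⟩ := charMap_surjective z
  obtain ⟨n', x', t', rfl⟩ := charMap_surjective z'
  obtain ⟨l, v, θ, φ, -, hv, rfl, rfl⟩ := exists_common_push_interior₂ t t'
  have : K.map θ.op x = K.map φ.op x' := by
    refine (hπ l).1 (funext fun i => ?_)
    have hi := congrFun h i
    rw [realizationPi_charMap, realizationPi_charMap] at hi
    have := map_eq_of_charMap_eq hv hi
    exact (NatTrans.naturality_apply (π i) θ.op x).trans
      (this.trans (NatTrans.naturality_apply (π i) φ.op x').symm)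
  rw [← charMap_map, ← charMap_map, this]

variable [Fintype ι]

/-- A common subdivision writes all coordinates over the same point `r`; the simplices obtained over
it are the components of one simplex of the product. -/
theorem realizationPi_surjective (hπ : IsLevelwiseProduct π) :
    Function.Surjective (realizationPi π) := by
  intro z
  choose n x t h using fun i => charMap_surjective (z i)
  obtain ⟨l, r, θ, -, hr⟩ := exists_common_push t
  obtain ⟨y, hy⟩ := (hπ l).2 fun i => (L i).map (θ i).op (x i)
  refine ⟨charMap y r, funext fun i => ?_⟩
  rw [realizationPi_charMap, show (π i).app _ y = (L i).map (θ i).op (x i) from congrFun hy i,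
    charMap_map, hr, h]

/-- Maps from compact spaces to a product of geometric realizations lift to the geometric
realization of the product. -/
theorem continuous_lift_realizationPi (hπ : IsLevelwiseProduct π) {S : Type*} [TopologicalSpace S]
    [CompactSpace S] (g : C(S, ∀ i, SSet.toTop.obj (L i))) (g' : S → SSet.toTop.obj K)
    (hg' : ∀ s, realizationPi π (g' s) = g s) : Continuous g' := by
  -- Each coordinate of `g` has compact image and so meets only finitely many simplices; together
  -- with the dimension bound for subdivisions this makes the union in `key` finite.
  have hcomp : ∀ i, IsCompact (Set.range fun s => g s i) := fun i =>
    isCompact_range ((continuous_apply i).comp g.continuous)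
  choose F hF hcov using fun i => exists_finite_cover (hcomp i)
  have hFf : ∀ i, Finite (F i) := fun i => (hF i).to_subtype
  refine continuous_iff_isClosed.2 fun C hC => ?_
  let ops (p : ∀ i, F i) := Σ l : Fin (∑ i, ((p i).1.1.len + 1) + 1),
    ∀ i, SimplexCategory.mk l ⟶ (p i).1.1
  have hopsf : ∀ p, Finite (ops p) := fun p => inferInstance
  have hex : ∀ (p : ∀ i, F i) (o : ops p), ∃ y : K.obj (op (SimplexCategory.mk o.1)),
      ∀ i, (π i).app _ y = (L i).map (o.2 i).op (p i).1.2 := fun p o => by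
    obtain ⟨y, hy⟩ := (hπ (SimplexCategory.mk o.1)).2
      fun i => (L i).map (o.2 i).op (p i).1.2
    exact ⟨y, fun i => congrFun hy i⟩
  choose y hy using hex
  have key : g' ⁻¹' C = ⋃ q : Σ p : ∀ i, F i, ops p,
      g ⁻¹' ((fun (t : ∀ i, TopSimplex (q.1 i).1.1) i => charMap (q.1 i).1.2 (t i)) ''
        ((fun (r : TopSimplex (SimplexCategory.mk q.2.1)) i => push (q.2.2 i) r) ''
          (charMap (y q.1 q.2) ⁻¹' C))) := by
    ext s
    simp only [Set.mem_preimage, Set.mem_iUnion, Set.mem_image, exists_exists_and_eq_and]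
    constructor
    · intro hs
      have hp : ∀ i, ∃ p : F i, ∃ t, charMap p.1.2 t = g s i := fun i => by
        obtain ⟨p, hp, t, ht⟩ := hcov i _ ⟨s, rfl⟩
        exact ⟨⟨p, hp⟩, t, ht⟩
      choose p t ht using hp
      obtain ⟨l, r, θ, hl, hr⟩ := exists_common_push t
      have he : ∀ i, charMap (p i).1.2 (push (θ i) r) = g s i := fun i => by rw [hr, ht]
      refine ⟨⟨p, ⟨l.len, hl⟩, θ⟩, r, ?_, funext he⟩
      have : charMap (y p ⟨⟨l.len, hl⟩, θ⟩) r = g' s := by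
        refine realizationPi_injective hπ (funext fun i => ?_)
        rw [realizationPi_charMap, hy, hg', charMap_map]
        exact he i
      exact this ▸ hs
    · rintro ⟨⟨p, l, θ⟩, r, hr, he⟩
      have : g' s = charMap (y p ⟨l, θ⟩) r := by
        refine realizationPi_injective hπ (funext fun i => ?_)
        rw [realizationPi_charMap, hy, hg', charMap_map, ← he]
      exact this ▸ hr
  rw [key]
  refine isClosed_iUnion_of_finite fun q => IsClosed.preimage g.continuous ?_
  -- Characteristic maps are proper, so their product is a closed map; the set it is applied to is a
  -- compact image in a product of standard simplices.
  refine (IsProperMap.pi_map fun i => isProperMap_charMap (q.1 i).1.2).isClosedMap _ ?_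
  refine IsCompact.isClosed (IsCompact.image ?_ ?_)
  · exact (hC.preimage (charMap _).continuous).isCompact
  · exact continuous_pi fun i => (push (q.2.2 i)).continuous

theorem isWeakEquivalence_realizationPi (hπ : IsLevelwiseProduct π) :
    IsWeakEquivalence (realizationPi π) := by
  refine isWeakEquivalence_of_lift (realizationPi_injective hπ) ?_
  intro S _ _ g
  choose g' hg' using fun s => realizationPi_surjective hπ (g s)
  exact ⟨⟨g', continuous_lift_realizationPi hπ g g' hg'⟩, ContinuousMap.ext hg'⟩

end RealizationProduct

/-! ### The cylinder of a simplicial set as a product indexed by `Bool`. -/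

section Cylinder

open MonoidalCategory

/-- The factors of the cylinder of a simplicial set. -/
noncomputable abbrev cylinderFactor (X : SSet.{u}) (b : Bool) : SSet.{u} :=
  bif b then X else SSet.stdSimplex.obj (SimplexCategory.mk 1)

/-- The projections of the cylinder of a simplicial set. -/
noncomputable def cylinderProj (X : SSet.{u}) : ∀ b, X ⊗ SSet.stdSimplex.obj (SimplexCategory.mk 1) ⟶ cylinderFactor X b
  | true => SemiCartesianMonoidalCategory.fst _ _
  | false => SemiCartesianMonoidalCategory.snd _ _

theorem isLevelwiseProduct_cylinderProj (X : SSet.{u}) :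
    IsLevelwiseProduct (cylinderProj X) := by
  refine fun n => ⟨fun x y h => Prod.ext (congrFun h true) (congrFun h false), fun y => ?_⟩
  refine ⟨(y true, y false), funext fun b => ?_⟩
  cases b <;> rfl

/-- A pair of points as a point of the product of the realizations of the factors. -/
def cylinderPair {X : SSet.{u}} (z : SSet.toTop.obj X) (w : SSet.toTop.obj (SSet.stdSimplex.{u}.obj (SimplexCategory.mk 1))) :
    ∀ b, SSet.toTop.obj (cylinderFactor X b)
  | true => z
  | false => w

end Cylinder

/-! ### From simplicial homotopies to homotopies. -/

section RealizationHomotopy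

open MonoidalCategory Simplicial

theorem joined_vertices (i j : Fin 2) :
    Joined (charMap (K := (Δ[1] : SSet.{u})) (n := ⦋0⦌) (SSet.stdSimplex.obj₀Equiv.symm i) default)
      (charMap (K := (Δ[1] : SSet.{u})) (n := ⦋0⦌) (SSet.stdSimplex.obj₀Equiv.symm j) default) := by
  have key : ∀ i : Fin 2,
      charMap (K := (Δ[1] : SSet.{u})) (n := ⦋0⦌) (SSet.stdSimplex.obj₀Equiv.symm i) default =
        charMap (K := (Δ[1] : SSet.{u})) (n := ⦋1⦌) (SSet.stdSimplex.objEquiv.symm (𝟙 _))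
          (push (SimplexCategory.const ⦋0⦌ ⦋1⦌ i) default) := fun i => by
    rw [← charMap_map]
    congr 1
  rw [key, key]
  have : PathConnectedSpace (TopSimplex ⦋1⦌) :=
    inferInstanceAs (PathConnectedSpace (stdSimplex ℝ (Fin 2)))
  exact (PathConnectedSpace.joined _ _).map (charMap _).continuous

theorem toTop_map_const {X Y : SSet.{u}} (y : Y.obj (op ⦋0⦌)) (z : SSet.toTop.obj X) :
    SSet.toTop.map (SSet.const y : X ⟶ Y) z = charMap y default := by
  obtain ⟨n, x, t, rfl⟩ := charMap_surjective z
  rw [toTop_map_charMap]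
  change charMap (Y.map (SimplexCategory.const n ⦋0⦌ 0).op y) t = _
  rw [charMap_map]
  congr 1
  exact Subsingleton.elim (α := stdSimplex ℝ (Fin 1)) _ _

/-- A simplicial homotopy induces a homotopy of geometric realizations. -/
theorem homotopic_of_simplicialHomotopy {X Y : SSet.{u}} (h : X ⊗ Δ[1] ⟶ Y) :
    ContinuousMap.Homotopic (SSet.toTop.map (SSet.ι₀ ≫ h)).hom
      (SSet.toTop.map (SSet.ι₁ ≫ h)).hom := by
  have hπ := isLevelwiseProduct_cylinderProj X
  obtain ⟨p⟩ := joined_vertices.{u} 0 1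
  -- `c z s` is the point of the realized cylinder over `(z, p s)`. Its continuity is known only
  -- after pulling `z` back along a map from a compact space.
  choose c hc using fun (z : SSet.toTop.obj X) (s : unitInterval) =>
    realizationPi_surjective hπ (cylinderPair z (p s))
  have hcont : ∀ {S : Type} [TopologicalSpace S] [CompactSpace S] (a : C(S, SSet.toTop.obj X)),
      Continuous fun w : S × unitInterval => c (a w.1) w.2 := by
    intro S _ _ a
    refine continuous_lift_realizationPi hπ
      ⟨fun w : S × unitInterval => cylinderPair (a w.1) (p w.2), continuous_pi fun b => ?_⟩ _
      fun w => hc _ _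
    cases b
    · exact p.continuous.comp continuous_snd
    · exact a.continuous.comp continuous_fst
  let f (z : SSet.toTop.obj X) : C(unitInterval, SSet.toTop.obj Y) :=
    ⟨fun s => SSet.toTop.map h (c z s), (SSet.toTop.map h).hom.continuous.comp
      ((hcont (ContinuousMap.const Unit z)).comp (Continuous.prodMk_right ()))⟩
  -- Currying to maps into the path space allows continuity in `z` to be tested on simplices, which
  -- are compact; it is uncurried at the end since the interval is locally compact.
  have hf : Continuous f := continuous_realization_iff.2 fun x =>
    (ContinuousMap.curry ⟨fun w => SSet.toTop.map h (c (charMap x w.1) w.2),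
      (SSet.toTop.map h).hom.continuous.comp (hcont (charMap x))⟩).continuous
  -- Where the path sits at a vertex, the lift is the end inclusion `j`, because both have the same
  -- two coordinates.
  have hend : ∀ (i : Fin 2) (j : X ⟶ X ⊗ Δ[1]),
      j ≫ SemiCartesianMonoidalCategory.fst _ _ = 𝟙 X →
      j ≫ SemiCartesianMonoidalCategory.snd _ _ =
        SSet.const (SSet.stdSimplex.obj₀Equiv.symm i) → ∀ (z : SSet.toTop.obj X) (s : unitInterval),
      p s = charMap (K := (Δ[1] : SSet.{u})) (n := ⦋0⦌) (SSet.stdSimplex.obj₀Equiv.symm i)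
        default → c z s = SSet.toTop.map j z := by
    intro i j h₁ h₂ z s hs
    refine realizationPi_injective hπ ?_
    rw [hc, hs]
    funext b
    cases b
    · refine (toTop_map_const _ z).symm.trans ?_
      rw [← h₂, Functor.map_comp]
      rfl
    · change z = (SSet.toTop.map j ≫ SSet.toTop.map (SemiCartesianMonoidalCategory.fst _ _)) z
      rw [← Functor.map_comp, h₁, CategoryTheory.Functor.map_id]
      rfl
  refine ⟨{ toFun := fun w => f w.2 w.1, continuous_toFun := by fun_prop,
            map_zero_left := fun z => ?_, map_one_left := fun z => ?_ }⟩
  · refine (congrArg (SSet.toTop.map h) (hend 0 SSet.ι₀ (by simp) (by simp) z 0 p.source)).trans ?_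
    rw [Functor.map_comp]
    rfl
  · refine (congrArg (SSet.toTop.map h) (hend 1 SSet.ι₁ (by simp) (by simp) z 1 p.target)).trans ?_
    rw [Functor.map_comp]
    rfl

end RealizationHomotopy

end SegalGamma

namespace SegalGamma

open SimplicialCells

/-! ### Transport of pseudofunctors along invertible 2-morphisms -/

/-! ### Rewriting rules for simplices of 2-cells. -/

section CellLemmas

variable {C : Type u} [Bicategory.{u, u} C] [SimplicialBicategory C]

/-- The reassociated form of an equation of composites, for rewriting at the head of a right-nested
composite. -/
theorem comp_comp_eq {a b : C} {f g h i g' : a ⟶ b} {k : SimplexCategoryᵒᵖ}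
    {x : (cell f g).obj k} {y : (cell g h).obj k} {x' : (cell f g').obj k}
    {y' : (cell g' h).obj k} (e : comp x y = comp x' y') (z : (cell h i).obj k) :
    comp x (comp y z) = comp x' (comp y' z) := by
  rw [← SimplicialBicategory.assoc, e, SimplicialBicategory.assoc]

theorem deg_inv_comp_deg (k : SimplexCategoryᵒᵖ) {a b : C} {f g : a ⟶ b} (e : f ≅ g)
    {h : a ⟶ b} (x : (cell g h).obj k) : comp (deg k e.inv) (comp (deg k e.hom) x) = x := by
  rw [← SimplicialBicategory.assoc, ← deg_comp, e.inv_hom_id, SimplicialBicategory.id_comp]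

theorem deg_inv_comp_deg' (k : SimplexCategoryᵒᵖ) {a b : C} {f g : a ⟶ b} (e : f ≅ g) :
    comp (deg k e.inv) (deg k e.hom) = deg k (𝟙 g) := by
  rw [← deg_comp, e.inv_hom_id]

theorem comp_deg_iso_cancel {k : SimplexCategoryᵒᵖ} {a b : C} {f g h : a ⟶ b} (e : g ≅ h)
    {x y : (cell f g).obj k} (hxy : comp x (deg k e.hom) = comp y (deg k e.hom)) : x = y := by
  have := congrArg (fun z => comp z (deg k e.inv)) hxy
  simpa only [SimplicialBicategory.assoc, ← deg_comp, e.hom_inv_id,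
    SimplicialBicategory.comp_id] using this

theorem deg_whiskerLeft_id_comp (k : SimplexCategoryᵒᵖ) {a b c : C} (f : a ⟶ b) (g : b ⟶ c)
    {h : a ⟶ c} (x : (cell (f ≫ g) h).obj k) : comp (whiskerLeft f (deg k (𝟙 g))) x = x := by
  rw [← deg_whiskerLeft, Bicategory.whiskerLeft_id, SimplicialBicategory.id_comp]

theorem deg_whiskerRight_id_comp (k : SimplexCategoryᵒᵖ) {a b c : C} (f : a ⟶ b) (g : b ⟶ c)
    {h : a ⟶ c} (x : (cell (f ≫ g) h).obj k) : comp (whiskerRight (deg k (𝟙 f)) g) x = x := by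
  rw [← deg_whiskerRight, Bicategory.id_whiskerRight, SimplicialBicategory.id_comp]

theorem comp_deg_leftUnitor_inv {k : SimplexCategoryᵒᵖ} {a b : C} {f g : a ⟶ b}
    (x : (cell f g).obj k) : comp x (deg k (Bicategory.leftUnitor g).inv) =
      comp (deg k (Bicategory.leftUnitor f).inv) (whiskerLeft (𝟙 a) x) := by
  refine comp_deg_iso_cancel (Bicategory.leftUnitor g) ?_
  rw [SimplicialBicategory.assoc, SimplicialBicategory.assoc, deg_inv_comp_deg',
    SimplicialBicategory.comp_id, SimplicialBicategory.leftUnitor_naturality, deg_inv_comp_deg]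

end CellLemmas

section Transport

variable {B C : Type u} [Bicategory.{u, u} B] [SimplicialBicategory B]
  [Bicategory.{u, u} C] [SimplicialBicategory C]

open Bicategory

/-- Transport of a pseudofunctor along a change of its action on 1-morphisms (without
enrichment). -/
def transport₀ (F : Pseudofunctor B C) (M : ∀ {a b : B}, (a ⟶ b) → (F.obj a ⟶ F.obj b))
    (θ : ∀ {a b : B} (f : a ⟶ b), M f ≅ F.map f) : Pseudofunctor B C where
  obj := F.obj
  map f := M f
  map₂ {a b f g} η := (θ f).hom ≫ F.map₂ η ≫ (θ g).inv
  mapId a := θ (𝟙 a) ≪≫ F.mapId a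
  mapComp f g := θ (f ≫ g) ≪≫ F.mapComp f g ≪≫ whiskerRightIso (θ f).symm (F.map g) ≪≫
    whiskerLeftIso (M f) (θ g).symm
  map₂_whisker_left f g h η := by
    simp
    rw [← whisker_exchange_assoc]
    simp
  map₂_whisker_right η h := by
    simp
    rw [whisker_exchange_assoc, whisker_exchange_assoc, whisker_exchange_assoc]
    simp
  map₂_associator f g h := by
    simp
    rw [whisker_exchange_assoc, whisker_exchange_assoc, whisker_exchange_assoc,
      associator_naturality_right_assoc, ← whiskerLeft_comp_assoc (M f) (F.map g ◁ _),
      whisker_exchange, whiskerLeft_comp_assoc, whisker_exchange_assoc]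
    simp
  map₂_left_unitor f := by
    simp
    rw [whisker_exchange_assoc, whisker_exchange_assoc]
    simp
  map₂_right_unitor f := by
    simp
    rw [← whisker_exchange_assoc]
    simp

variable (F : SPseudofunctor B C) (M : ∀ {a b : B}, (a ⟶ b) → (F.obj a ⟶ F.obj b))
    (θ : ∀ {a b : B} (f : a ⟶ b), M f ≅ F.map f)


theorem vertex_eq_deg {a b : C} {f g : a ⟶ b} (ζ : f ⟶ g) :
    vertex ζ = deg (op (SimplexCategory.mk 0)) ζ := by
  unfold deg
  rw [Subsingleton.elim (SimplexCategory.const _ (SimplexCategory.mk 0) 0) (𝟙 _)]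
  exact ((cell f g).map_id_apply _ _).symm

/-- The action on 2-cells of a transported pseudofunctor. -/
def transportCell {a b : B} (f g : a ⟶ b) : cell f g ⟶ cell (M f) (M g) where
  app k := TypeCat.ofHom fun x =>
    comp (deg k (θ f).hom) (comp ((F.mapCell f g).app k x) (deg k (θ g).inv))
  naturality k l φ := by
    ext x
    change comp _ (comp ((F.mapCell f g).app l ((cell f g).map φ x)) _) =
      (cell _ _).map φ (comp _ (comp ((F.mapCell f g).app k x) _))
    rw [SimplicialBicategory.map_comp, SimplicialBicategory.map_comp, map_deg, map_deg,
      F.mapCell_map]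

theorem transportCell_apply {a b : B} (f g : a ⟶ b) {k : SimplexCategoryᵒᵖ}
    (x : (cell f g).obj k) : (transportCell F M θ f g).app k x =
      comp (deg k (θ f).hom) (comp ((F.mapCell f g).app k x) (deg k (θ g).inv)) := rfl

theorem transportCell_vertex {a b : B} {f g : a ⟶ b} (η : f ⟶ g) :
    (transportCell F M θ f g).app _ (vertex η) = vertex ((θ f).hom ≫ F.map₂ η ≫ (θ g).inv) := by
  rw [transportCell_apply, F.mapCell_vertex, vertex_eq_deg, vertex_eq_deg, deg_comp, deg_comp]

theorem transportCell_comp {a b : B} {f g h : a ⟶ b} {k : SimplexCategoryᵒᵖ}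
    (x : (cell f g).obj k) (y : (cell g h).obj k) :
    (transportCell F M θ f h).app k (comp x y) =
      comp ((transportCell F M θ f g).app k x) ((transportCell F M θ g h).app k y) := by
  simp only [transportCell_apply, F.mapCell_comp, SimplicialBicategory.assoc, deg_inv_comp_deg]

theorem transportCell_whiskerLeft {a b c : B} (f : a ⟶ b) {g h : b ⟶ c} {k : SimplexCategoryᵒᵖ}
    (x : (cell g h).obj k) :
    comp ((transportCell F M θ (f ≫ g) (f ≫ h)).app k (whiskerLeft f x))
        (deg k ((θ (f ≫ h)).hom ≫ (F.mapComp f h).hom ≫ (θ f).inv ▷ (F.map h) ≫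
          (M f) ◁ (θ h).inv)) =
      comp (deg k ((θ (f ≫ g)).hom ≫ (F.mapComp f g).hom ≫ (θ f).inv ▷ (F.map g) ≫
          (M f) ◁ (θ g).inv)) (whiskerLeft (M f) ((transportCell F M θ g h).app k x)) := by
  simp only [transportCell_apply, deg_comp, SimplicialBicategory.assoc,
    SimplicialBicategory.whiskerLeft_comp, deg_inv_comp_deg, deg_whiskerLeft, deg_whiskerRight]
  rw [comp_comp_eq (F.mapCell_whiskerLeft f x),
    comp_comp_eq (SimplicialBicategory.whisker_exchange (deg k (θ f).inv) _),
    ← SimplicialBicategory.assoc (whiskerLeft (M f) (deg k (θ g).inv)),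
    ← SimplicialBicategory.whiskerLeft_comp (M f) (deg k (θ g).inv), deg_inv_comp_deg',
    deg_whiskerLeft_id_comp]

theorem transportCell_whiskerRight {a b c : B} {f g : a ⟶ b} {k : SimplexCategoryᵒᵖ}
    (x : (cell f g).obj k) (h : b ⟶ c) :
    comp ((transportCell F M θ (f ≫ h) (g ≫ h)).app k (whiskerRight x h))
        (deg k ((θ (g ≫ h)).hom ≫ (F.mapComp g h).hom ≫ (θ g).inv ▷ (F.map h) ≫
          (M g) ◁ (θ h).inv)) =
      comp (deg k ((θ (f ≫ h)).hom ≫ (F.mapComp f h).hom ≫ (θ f).inv ▷ (F.map h) ≫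
          (M f) ◁ (θ h).inv)) (whiskerRight ((transportCell F M θ f g).app k x) (M h)) := by
  simp only [transportCell_apply, deg_comp, SimplicialBicategory.assoc,
    SimplicialBicategory.whiskerRight_comp, deg_inv_comp_deg, deg_whiskerLeft, deg_whiskerRight]
  rw [comp_comp_eq (F.mapCell_whiskerRight x h)]
  rw [comp_comp_eq (SimplicialBicategory.whisker_exchange (deg k (θ f).hom) (deg k (θ h).inv)),
    comp_comp_eq (SimplicialBicategory.whisker_exchange ((F.mapCell f g).app k x)
      (deg k (θ h).inv)),
    SimplicialBicategory.whisker_exchange (deg k (θ g).inv) (deg k (θ h).inv),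
    ← SimplicialBicategory.assoc (whiskerRight (deg k (θ f).inv) (F.map h)),
    ← SimplicialBicategory.whiskerRight_comp, deg_inv_comp_deg', deg_whiskerRight_id_comp]

/-- Transport of a pseudofunctor along a change of its action on 1-morphisms. -/
def transport : SPseudofunctor B C where
  toPseudofunctor := transport₀ F.toPseudofunctor M θ
  mapCell := transportCell F M θ
  mapCell_vertex := transportCell_vertex F M θ
  mapCell_comp := transportCell_comp F M θ
  mapCell_whiskerLeft := transportCell_whiskerLeft F M θ
  mapCell_whiskerRight := transportCell_whiskerRight F M θ

/-- The comparison of a transported pseudofunctor with the original one. -/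
def ofTransport : STrans (transport F M θ) F where
  app a := 𝟙 (F.obj a)
  naturality f := ρ_ (M f) ≪≫ θ f ≪≫ (λ_ (F.map f)).symm
  naturality_naturality {a b f g} η := by
    change ((θ f).hom ≫ F.map₂ η ≫ (θ g).inv) ▷ 𝟙 (F.obj b) ≫ (ρ_ (M g)).hom ≫ (θ g).hom ≫
        (λ_ (F.map g)).inv =
      ((ρ_ (M f)).hom ≫ (θ f).hom ≫ (λ_ (F.map f)).inv) ≫ 𝟙 (F.obj a) ◁ F.map₂ η
    simp
  naturality_id a := by
    change ((ρ_ (M (𝟙 a))).hom ≫ (θ (𝟙 a)).hom ≫ (λ_ (F.map (𝟙 a))).inv) ≫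
      𝟙 (F.obj a) ◁ (F.mapId a).hom = ((θ (𝟙 a)).hom ≫ (F.mapId a).hom) ▷ 𝟙 (F.obj a) ≫
        (λ_ (𝟙 (F.obj a))).hom ≫ (ρ_ (𝟙 (F.obj a))).inv
    simp [unitors_equal]
  naturality_comp {a b c} f g := by
    change ((ρ_ (M (f ≫ g))).hom ≫ (θ (f ≫ g)).hom ≫ (λ_ (F.map (f ≫ g))).inv) ≫
      𝟙 (F.obj a) ◁ (F.mapComp f g).hom = ((θ (f ≫ g)).hom ≫ (F.mapComp f g).hom ≫
        (θ f).inv ▷ (F.map g) ≫ (M f) ◁ (θ g).inv) ▷ 𝟙 (F.obj c) ≫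
        (α_ (M f) (M g) (𝟙 (F.obj c))).hom ≫
        M f ◁ ((ρ_ (M g)).hom ≫ (θ g).hom ≫ (λ_ (F.map g)).inv) ≫
        (α_ (M f) (𝟙 (F.obj b)) (F.map g)).inv ≫
        ((ρ_ (M f)).hom ≫ (θ f).hom ≫ (λ_ (F.map f)).inv) ▷ F.map g ≫
        (α_ (𝟙 (F.obj a)) (F.map f) (F.map g)).hom
    simp
  naturality_cell {a b f g k} x := by
    change comp (SimplicialCells.whiskerRight (comp (deg k (θ f).hom)
        (comp ((F.mapCell f g).app k x) (deg k (θ g).inv))) (𝟙 (F.obj b)))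
        (deg k ((ρ_ (M g)).hom ≫ (θ g).hom ≫ (λ_ (F.map g)).inv)) =
      comp (deg k ((ρ_ (M f)).hom ≫ (θ f).hom ≫ (λ_ (F.map f)).inv))
        (SimplicialCells.whiskerLeft (𝟙 (F.obj a)) ((F.mapCell f g).app k x))
    simp only [deg_comp, SimplicialBicategory.assoc]
    rw [comp_comp_eq (SimplicialBicategory.rightUnitor_naturality _)]
    simp only [SimplicialBicategory.assoc, deg_inv_comp_deg]
    rw [comp_deg_leftUnitor_inv]

/-- The comparison of a pseudofunctor with a transported one. -/
def toTransport : STrans F (transport F M θ) where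
  app a := 𝟙 (F.obj a)
  naturality f := ρ_ (F.map f) ≪≫ (θ f).symm ≪≫ (λ_ (M f)).symm
  naturality_naturality {a b f g} η := by
    change F.map₂ η ▷ _ ≫ (ρ_ (F.map g)).hom ≫ (θ g).inv ≫ (λ_ (M g)).inv =
      ((ρ_ (F.map f)).hom ≫ (θ f).inv ≫ (λ_ (M f)).inv) ≫
        _ ◁ ((θ f).hom ≫ F.map₂ η ≫ (θ g).inv)
    simp
  naturality_id a := by
    change ((ρ_ (F.map (𝟙 a))).hom ≫ (θ (𝟙 a)).inv ≫ (λ_ (M (𝟙 a))).inv) ≫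
      𝟙 (F.obj a) ◁ ((θ (𝟙 a)).hom ≫ (F.mapId a).hom) = (F.mapId a).hom ▷ 𝟙 (F.obj a) ≫
        (λ_ (𝟙 (F.obj a))).hom ≫ (ρ_ (𝟙 (F.obj a))).inv
    simp [unitors_equal]
  naturality_comp {a b c} f g := by
    change ((ρ_ (F.map (f ≫ g))).hom ≫ (θ (f ≫ g)).inv ≫ (λ_ (M (f ≫ g))).inv) ≫
      𝟙 (F.obj a) ◁ ((θ (f ≫ g)).hom ≫ (F.mapComp f g).hom ≫
        (θ f).inv ▷ (F.map g) ≫ (M f) ◁ (θ g).inv) = (F.mapComp f g).hom ▷ 𝟙 (F.obj c) ≫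
        (α_ (F.map f) (F.map g) (𝟙 (F.obj c))).hom ≫
        F.map f ◁ ((ρ_ (F.map g)).hom ≫ (θ g).inv ≫ (λ_ (M g)).inv) ≫
        (α_ (F.map f) (𝟙 (F.obj b)) (M g)).inv ≫
        ((ρ_ (F.map f)).hom ≫ (θ f).inv ≫ (λ_ (M f)).inv) ▷ M g ≫
        (α_ (𝟙 (F.obj a)) (M f) (M g)).hom
    simp [whisker_exchange]
  naturality_cell {a b f g k} x := by
    change comp (SimplicialCells.whiskerRight ((F.mapCell f g).app k x) (𝟙 (F.obj b)))
        (deg k ((ρ_ (F.map g)).hom ≫ (θ g).inv ≫ (λ_ (M g)).inv)) =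
      comp (deg k ((ρ_ (F.map f)).hom ≫ (θ f).inv ≫ (λ_ (M f)).inv))
        (SimplicialCells.whiskerLeft (𝟙 (F.obj a)) (comp (deg k (θ f).hom)
        (comp ((F.mapCell f g).app k x) (deg k (θ g).inv))))
    simp only [deg_comp, SimplicialBicategory.assoc]
    rw [comp_comp_eq (SimplicialBicategory.rightUnitor_naturality _), ← comp_deg_leftUnitor_inv]
    simp only [SimplicialBicategory.assoc, deg_inv_comp_deg]

end Transport

end SegalGamma

namespace SegalGamma

open SimplicialCells

/-! ### Adjoining new identities to a bicategory -/

section Aug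

variable {C : Type u} [Bicategory.{u, u} C]

/-- The 1-morphisms of a bicategory together with new identities. -/
inductive Aug : C → C → Type u
  | old {a b : C} (f : a ⟶ b) : Aug a b
  | new (a : C) : Aug a a

/-- The underlying 1-morphism. -/
def Aug.real : ∀ {a b : C}, Aug a b → (a ⟶ b)
  | _, _, .old f => f
  | _, _, .new a => 𝟙 a

/-- The 2-morphisms between augmented 1-morphisms are those of the underlying 1-morphisms. -/
instance augCategory (a b : C) : Category.{u} (Aug a b) where
  Hom m n := m.real ⟶ n.real
  id m := 𝟙 m.real
  comp η θ := CategoryStruct.comp (obj := a ⟶ b) η θ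
  id_comp _ := Category.id_comp (obj := a ⟶ b) _
  comp_id _ := Category.comp_id (obj := a ⟶ b) _
  assoc _ _ _ := Category.assoc (obj := a ⟶ b) _ _ _

/-- Invertible 2-morphisms between augmented 1-morphisms. -/
def augIso {a b : C} {m n : Aug a b} (e : m.real ≅ n.real) : m ≅ n :=
  ⟨e.hom, e.inv, e.hom_inv_id, e.inv_hom_id⟩

/-- The composition constraint of the projection to the underlying 1-morphisms. -/
abbrev Aug.compIso {a b c : C} (m : Aug a b) (n : Aug b c) :
    m.real ≫ n.real ≅ m.real ≫ n.real :=
  Iso.refl _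

/-- The bicategory obtained by adjoining new identity 1-morphisms. -/
def AugCat (C : Type u) : Type u := C

instance augBicategory : Bicategory.{u, u} (AugCat C) where
  Hom a b := Aug (C := C) a b
  id a := .new (C := C) a
  -- Every composite is old, even with a new identity. New identities are thus units only up to the
  -- original unitors, and all axioms hold because 2-morphisms see only underlying 1-morphisms.
  comp m n := .old (m.real ≫ n.real)
  homCategory a b := augCategory (C := C) a b
  whiskerLeft m _ _ η := Bicategory.whiskerLeft (B := C) m.real η
  whiskerRight η n := Bicategory.whiskerRight (B := C) η n.real
  associator m n p := augIso (Bicategory.associator m.real n.real p.real)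
  leftUnitor m := augIso (Bicategory.leftUnitor m.real)
  rightUnitor m := augIso (Bicategory.rightUnitor m.real)
  whiskerLeft_id _ _ := Bicategory.whiskerLeft_id (B := C) _ _
  whiskerLeft_comp _ _ _ _ _ _ := Bicategory.whiskerLeft_comp (B := C) _ _ _
  id_whiskerLeft _ := Bicategory.id_whiskerLeft (B := C) _
  comp_whiskerLeft _ _ _ _ _ := Bicategory.comp_whiskerLeft (B := C) _ _ _
  id_whiskerRight _ _ := Bicategory.id_whiskerRight (B := C) _ _
  comp_whiskerRight _ _ _ := Bicategory.comp_whiskerRight (B := C) _ _ _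
  whiskerRight_id _ := Bicategory.whiskerRight_id (B := C) _
  whiskerRight_comp _ _ _ := Bicategory.whiskerRight_comp (B := C) _ _ _
  whisker_assoc _ _ _ _ _ := Bicategory.whisker_assoc (B := C) _ _ _
  whisker_exchange _ _ := Bicategory.whisker_exchange (B := C) _ _
  pentagon _ _ _ _ := Bicategory.pentagon (B := C) _ _ _ _
  triangle _ _ := Bicategory.triangle (B := C) _ _

section Simplicial

variable [SimplicialBicategory C]

instance augSimplicialCells : SimplicialCells (AugCat C) where
  cell m n := cell (B := C) m.real n.real
  vertex := vertex (B := C)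
  comp x y := comp (B := C) x y
  whiskerLeft m _ _ _ x := whiskerLeft (B := C) m.real x
  whiskerRight x n := whiskerRight (B := C) x n.real

instance augSimplicialBicategory : SimplicialBicategory (AugCat C) where
  map_comp _ _ _ := SimplicialBicategory.map_comp (B := C) _ _ _
  vertex_comp _ _ := SimplicialBicategory.vertex_comp (B := C) _ _
  id_comp _ := SimplicialBicategory.id_comp (B := C) _
  comp_id _ := SimplicialBicategory.comp_id (B := C) _
  assoc _ _ _ := SimplicialBicategory.assoc (B := C) _ _ _
  map_whiskerLeft _ _ _ _ _ _ _ := SimplicialBicategory.map_whiskerLeft (B := C) _ _ _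
  vertex_whiskerLeft _ _ _ _ := SimplicialBicategory.vertex_whiskerLeft (B := C) _ _
  whiskerLeft_comp _ _ _ _ _ _ _ := SimplicialBicategory.whiskerLeft_comp (B := C) _ _ _
  map_whiskerRight _ _ _ := SimplicialBicategory.map_whiskerRight (B := C) _ _ _
  vertex_whiskerRight _ _ := SimplicialBicategory.vertex_whiskerRight (B := C) _ _
  whiskerRight_comp _ _ _ := SimplicialBicategory.whiskerRight_comp (B := C) _ _ _
  whisker_exchange _ _ := SimplicialBicategory.whisker_exchange (B := C) _ _
  leftUnitor_naturality _ := SimplicialBicategory.leftUnitor_naturality (B := C) _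
  rightUnitor_naturality _ := SimplicialBicategory.rightUnitor_naturality (B := C) _
  associator_naturality_left _ _ _ :=
    SimplicialBicategory.associator_naturality_left (B := C) _ _ _
  associator_naturality_middle _ _ _ _ _ _ :=
    SimplicialBicategory.associator_naturality_middle (B := C) _ _ _
  associator_naturality_right _ _ _ _ _ _ :=
    SimplicialBicategory.associator_naturality_right (B := C) _ _ _

end Simplicial

section Strict

open Bicategory

/-- This and the next lemmas are the coherence axioms of a pseudofunctor whose constraints are
identities, as needed for the projections `augProj₀` and `piProj₀`. -/
theorem eq_id_comp_comp_id {a b : C} {f g : a ⟶ b} (η : f ⟶ g) : η = 𝟙 f ≫ η ≫ 𝟙 g := by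
  rw [Category.id_comp, Category.comp_id]

theorem associator_eq_of_strict {a b c d : C} (f : a ⟶ b) (g : b ⟶ c) (h : c ⟶ d) :
    (α_ f g h).hom = 𝟙 _ ≫ 𝟙 (f ≫ g) ▷ h ≫ (α_ f g h).hom ≫ f ◁ 𝟙 (g ≫ h) ≫ 𝟙 _ := by
  simp

theorem leftUnitor_eq_of_strict {a b : C} (f : a ⟶ b) :
    (λ_ f).hom = 𝟙 _ ≫ 𝟙 _ ▷ f ≫ (λ_ f).hom := by
  simp

theorem rightUnitor_eq_of_strict {a b : C} (f : a ⟶ b) :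
    (ρ_ f).hom = 𝟙 _ ≫ f ◁ 𝟙 _ ≫ (ρ_ f).hom := by
  simp

theorem comp_deg_id_eq {k : SimplexCategoryᵒᵖ} [SimplicialBicategory C] {a b : C} {f g : a ⟶ b}
    (x : (cell f g).obj k) : comp x (deg k (𝟙 g)) = comp (deg k (𝟙 f)) x :=
  (SimplicialBicategory.comp_id x).trans (SimplicialBicategory.id_comp x).symm

end Strict

/-- The projection forgetting the distinction between new and old identities (without
enrichment). -/
def augProj₀ (C : Type u) [Bicategory.{u, u} C] : Pseudofunctor (AugCat C) C where
  obj a := a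
  map m := Aug.real m
  map₂ η := η
  mapId a := Iso.refl (𝟙 (show C from a))
  mapComp m n := Aug.compIso (C := C) m n
  map₂_id _ := rfl
  map₂_comp _ _ := rfl
  map₂_whisker_left m _ _ η := eq_id_comp_comp_id (C := C) (Bicategory.whiskerLeft m.real η)
  map₂_whisker_right {_ _ _ m m'} η n :=
    eq_id_comp_comp_id (C := C) (Bicategory.whiskerRight (f := m.real) (g := m'.real) η n.real)
  map₂_associator m n p := associator_eq_of_strict (C := C) m.real n.real p.real
  map₂_left_unitor m := leftUnitor_eq_of_strict (C := C) m.real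
  map₂_right_unitor m := rightUnitor_eq_of_strict (C := C) m.real

/-- The projection forgetting the distinction between new and old identities. -/
def augProj (C : Type u) [Bicategory.{u, u} C] [SimplicialBicategory C] :
    SPseudofunctor (AugCat C) C where
  toPseudofunctor := augProj₀ C
  mapCell m n := 𝟙 (cell (Aug.real m) (Aug.real n))
  mapCell_vertex _ := rfl
  mapCell_comp _ _ := rfl
  mapCell_whiskerLeft m _ _ _ x := comp_deg_id_eq (C := C) (whiskerLeft m.real x)
  mapCell_whiskerRight {_ _ _ m m' _} x n :=
    comp_deg_id_eq (C := C) (whiskerRight (f := m.real) (g := m'.real) x n.real)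

variable [SimplicialBicategory C]

theorem augProj_isNormal : (augProj C).IsNormal :=
  ⟨fun a => rfl, fun a => by ext; rfl⟩

variable {B : Type u} [Bicategory.{u, u} B] [SimplicialBicategory B]

/-! ### Lifting pseudofunctors to augmented 1-morphisms. -/

section Lift

variable (F : SPseudofunctor B C) (m : ∀ {a b : B}, (a ⟶ b) → Aug (F.obj a) (F.obj b))
    (θ : ∀ {a b : B} (f : a ⟶ b), (m f).real ≅ F.map f)

/-- The lift of a pseudofunctor to augmented 1-morphisms (without enrichment). -/
def augLift₀ : Pseudofunctor B (AugCat C) where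
  obj := F.obj
  map f := m f
  map₂ η := (transport F (fun f => (m f).real) θ).map₂ η
  mapId a := augIso ((transport F (fun f => (m f).real) θ).mapId a)
  mapComp f g := augIso ((transport F (fun f => (m f).real) θ).mapComp f g)
  map₂_id f := (transport F (fun f => (m f).real) θ).map₂_id f
  map₂_comp η ζ := (transport F (fun f => (m f).real) θ).map₂_comp η ζ
  map₂_whisker_left f _ _ η := (transport F (fun f => (m f).real) θ).map₂_whisker_left f η
  map₂_whisker_right η h := (transport F (fun f => (m f).real) θ).map₂_whisker_right η h
  map₂_associator f g h := (transport F (fun f => (m f).real) θ).map₂_associator f g h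
  map₂_left_unitor f := (transport F (fun f => (m f).real) θ).map₂_left_unitor f
  map₂_right_unitor f := (transport F (fun f => (m f).real) θ).map₂_right_unitor f

/-- The lift of a pseudofunctor to augmented 1-morphisms. -/
def augLift : SPseudofunctor B (AugCat C) where
  toPseudofunctor := augLift₀ F m θ
  mapCell f g := (transport F (fun f => (m f).real) θ).mapCell f g
  mapCell_vertex η := (transport F (fun f => (m f).real) θ).mapCell_vertex η
  mapCell_comp x y := (transport F (fun f => (m f).real) θ).mapCell_comp x y
  mapCell_whiskerLeft f _ _ _ x :=
    (transport F (fun f => (m f).real) θ).mapCell_whiskerLeft f x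
  mapCell_whiskerRight x h := (transport F (fun f => (m f).real) θ).mapCell_whiskerRight x h

theorem augLift_comp_augProj :
    (augLift F m θ).comp (augProj C) = transport F (fun f => (m f).real) θ := by
  refine SPseudofunctor.ext' (SPseudofunctor.pseudo_ext rfl (fun a => heq_of_eq ?_)
    (fun f g => heq_of_eq ?_)) (fun f g => HEq.rfl)
  · ext
    exact Category.comp_id _
  · ext
    exact Category.comp_id _

end Lift

end Aug

end SegalGamma

namespace SegalGamma

open SimplicialCells

/-! ### Operations on transformations -/

section Operations

open Bicategory

variable {A B C : Type u} [Bicategory.{u, u} A] [SimplicialBicategory A] [Bicategory.{u, u} B]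
  [SimplicialBicategory B] [Bicategory.{u, u} C] [SimplicialBicategory C]

theorem whiskerRight_comp_deg_associator_inv {a b c d : C} {f f' : a ⟶ b}
    {k : SimplexCategoryᵒᵖ} (x : (cell f f').obj k) (g : b ⟶ c) (h : c ⟶ d) :
    comp (SimplicialCells.whiskerRight x (g ≫ h)) (deg k (α_ f' g h).inv) =
      comp (deg k (α_ f g h).inv)
        (SimplicialCells.whiskerRight (SimplicialCells.whiskerRight x g) h) := by
  refine comp_deg_iso_cancel (α_ f' g h) ?_
  rw [SimplicialBicategory.assoc, SimplicialBicategory.assoc, deg_inv_comp_deg',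
    SimplicialBicategory.comp_id, SimplicialBicategory.associator_naturality_left,
    deg_inv_comp_deg]

theorem whiskerLeft_comp_deg_associator_inv {a b c d : C} (f : a ⟶ b) (g : b ⟶ c)
    {h h' : c ⟶ d} {k : SimplexCategoryᵒᵖ} (x : (cell h h').obj k) :
    comp (SimplicialCells.whiskerLeft f (SimplicialCells.whiskerLeft g x))
        (deg k (α_ f g h').inv) =
      comp (deg k (α_ f g h).inv) (SimplicialCells.whiskerLeft (f ≫ g) x) := by
  refine comp_deg_iso_cancel (α_ f g h') ?_
  rw [SimplicialBicategory.assoc, SimplicialBicategory.assoc, deg_inv_comp_deg',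
    SimplicialBicategory.comp_id, SimplicialBicategory.associator_naturality_right,
    deg_inv_comp_deg]

/-- Pasting of naturality squares of simplices of 2-cells. -/
theorem naturality_cell_paste {a a' a'' b b' b'' : C} {k : SimplexCategoryᵒᵖ} {f g : a ⟶ b}
    {f' g' : a' ⟶ b'} {f'' g'' : a'' ⟶ b''} {p : a ⟶ a'} {p' : a' ⟶ a''} {q : b ⟶ b'}
    {q' : b' ⟶ b''} {x : (cell f g).obj k} {y : (cell f' g').obj k} {z : (cell f'' g'').obj k}
    {σ : f ≫ q ⟶ p ≫ f'} {τ : g ≫ q ⟶ p ≫ g'} {σ' : f' ≫ q' ⟶ p' ≫ f''}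
    {τ' : g' ≫ q' ⟶ p' ≫ g''}
    (h : comp (SimplicialCells.whiskerRight x q) (deg k τ) =
      comp (deg k σ) (SimplicialCells.whiskerLeft p y))
    (h' : comp (SimplicialCells.whiskerRight y q') (deg k τ') =
      comp (deg k σ') (SimplicialCells.whiskerLeft p' z)) :
    comp (SimplicialCells.whiskerRight x (q ≫ q')) (deg k ((α_ _ _ _).inv ≫ τ ▷ q' ≫
        (α_ _ _ _).hom ≫ p ◁ τ' ≫ (α_ _ _ _).inv)) =
      comp (deg k ((α_ _ _ _).inv ≫ σ ▷ q' ≫ (α_ _ _ _).hom ≫ p ◁ σ' ≫ (α_ _ _ _).inv))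
        (SimplicialCells.whiskerLeft (p ≫ p') z) := by
  simp only [deg_comp, deg_whiskerLeft, deg_whiskerRight, SimplicialBicategory.assoc]
  rw [comp_comp_eq (whiskerRight_comp_deg_associator_inv x q q'),
    ← SimplicialBicategory.assoc (SimplicialCells.whiskerRight (SimplicialCells.whiskerRight x q)
      q'), ← SimplicialBicategory.whiskerRight_comp, h, SimplicialBicategory.whiskerRight_comp,
    SimplicialBicategory.assoc,
    comp_comp_eq (SimplicialBicategory.associator_naturality_middle p y q'),
    ← SimplicialBicategory.assoc (SimplicialCells.whiskerLeft p _),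
    ← SimplicialBicategory.whiskerLeft_comp, h', SimplicialBicategory.whiskerLeft_comp,
    SimplicialBicategory.assoc, whiskerLeft_comp_deg_associator_inv]

/-- The unit axiom of `η` with a 2-morphism `ζ` inserted. With `ζ` an identity constraint it serves
both precomposition with a pseudofunctor and restriction to normal pseudofunctors on `[n]`; the next
lemma does the same for composition. -/
theorem naturality_hom_comp_mapId {F G : SPseudofunctor B C} (η : STrans F G) {b : B} {f : b ⟶ b}
    (ζ : f ⟶ 𝟙 b) : (η.naturality f).hom ≫ η.app b ◁ (G.map₂ ζ ≫ (G.mapId b).hom) =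
      (F.map₂ ζ ≫ (F.mapId b).hom) ▷ η.app b ≫ (λ_ (η.app b)).hom ≫ (ρ_ (η.app b)).inv := by
  rw [Bicategory.whiskerLeft_comp, comp_whiskerRight, Category.assoc, ← η.naturality_id,
    ← Category.assoc, ← η.naturality_naturality, Category.assoc]

theorem naturality_hom_comp_mapComp {F G : SPseudofunctor B C} (η : STrans F G) {a b c : B}
    {h : a ⟶ c} {f : a ⟶ b} {g : b ⟶ c} (ζ : h ⟶ f ≫ g) :
    (η.naturality h).hom ≫ η.app a ◁ (G.map₂ ζ ≫ (G.mapComp f g).hom) =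
      (F.map₂ ζ ≫ (F.mapComp f g).hom) ▷ η.app c ≫ (α_ _ _ _).hom ≫
        F.map f ◁ (η.naturality g).hom ≫ (α_ _ _ _).inv ≫ (η.naturality f).hom ▷ G.map g ≫
          (α_ _ _ _).hom := by
  rw [Bicategory.whiskerLeft_comp, comp_whiskerRight, Category.assoc, ← η.naturality_comp,
    ← Category.assoc, ← η.naturality_naturality, Category.assoc]

/-- The identity transformation. -/
def STrans.id (F : SPseudofunctor B C) : STrans F F where
  toStrongTrans := Pseudofunctor.StrongTrans.id F.toPseudofunctor
  naturality_cell {a b f g k} x := by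
    change comp (SimplicialCells.whiskerRight ((F.mapCell f g).app k x) (𝟙 (F.obj b)))
        (deg k ((ρ_ (F.map g)).hom ≫ (λ_ (F.map g)).inv)) =
      comp (deg k ((ρ_ (F.map f)).hom ≫ (λ_ (F.map f)).inv))
        (SimplicialCells.whiskerLeft (𝟙 (F.obj a)) ((F.mapCell f g).app k x))
    rw [deg_comp, deg_comp, comp_comp_eq (SimplicialBicategory.rightUnitor_naturality _),
      comp_deg_leftUnitor_inv, SimplicialBicategory.assoc]

/-- Vertical composition of transformations. -/
def STrans.vcomp {F G H : SPseudofunctor B C} (η : STrans F G) (θ : STrans G H) :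
    STrans F H where
  toStrongTrans := Pseudofunctor.StrongTrans.vcomp η.toStrongTrans θ.toStrongTrans
  naturality_cell {a b f g k} x := by
    exact naturality_cell_paste (η.naturality_cell x) (θ.naturality_cell x)

/-- Composition of a transformation with a pseudofunctor on the source side. -/
def STrans.precomp (H : SPseudofunctor A B) {F G : SPseudofunctor B C} (η : STrans F G) :
    STrans (H.comp F) (H.comp G) where
  app a := η.app (H.obj a)
  naturality f := η.naturality (H.map f)
  naturality_naturality ζ := η.naturality_naturality (H.map₂ ζ)
  naturality_id a := naturality_hom_comp_mapId η (H.mapId a).hom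
  naturality_comp f g := naturality_hom_comp_mapComp η (H.mapComp f g).hom
  naturality_cell x := η.naturality_cell ((H.mapCell _ _).app _ x)

/-- Transformations into a product. -/
def STrans.pi {ι : Type} {D : ι → Type u} [∀ i, Bicategory.{u, u} (D i)]
    [∀ i, SimplicialBicategory (D i)] {F G : ∀ i, SPseudofunctor B (D i)}
    (η : ∀ i, STrans (F i) (G i)) : STrans (piLift F) (piLift G) where
  app a := fun i => (η i).app a
  naturality f := Pi.isoMk fun i => (η i).naturality f
  naturality_naturality ζ := funext fun i => (η i).naturality_naturality ζ
  naturality_id a := funext fun i => (η i).naturality_id a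
  naturality_comp f g := funext fun i => (η i).naturality_comp f g
  naturality_cell x := funext fun i => (η i).naturality_cell x

/-- Transformations of pseudofunctors with augmented 1-morphisms are given on the underlying
pseudofunctors. -/
def STrans.reflect {F G : SPseudofunctor B (AugCat C)}
    (η : STrans (F.comp (augProj C)) (G.comp (augProj C))) : STrans F G where
  app a := Aug.old (η.app a)
  naturality f := augIso (C := C) (η.naturality f)
  naturality_naturality ζ := η.naturality_naturality ζ
  naturality_id a := by
    have h := η.naturality_id a
    -- The projection has identity constraints, so composing with it only appends identities.
    have hF : ((F.comp (augProj C)).mapId a).hom = (F.mapId a).hom := Category.comp_id (F.mapId a).hom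
    have hG : ((G.comp (augProj C)).mapId a).hom = (G.mapId a).hom := Category.comp_id (G.mapId a).hom
    rw [hF, hG] at h
    exact h
  naturality_comp f g := by
    have h := η.naturality_comp f g
    have hF : ((F.comp (augProj C)).mapComp f g).hom = (F.mapComp f g).hom :=
      Category.comp_id (F.mapComp f g).hom
    have hG : ((G.comp (augProj C)).mapComp f g).hom = (G.mapComp f g).hom :=
      Category.comp_id (G.mapComp f g).hom
    rw [hF, hG] at h
    exact h
  naturality_cell x := η.naturality_cell x

end Operations

end SegalGamma

namespace SegalGamma

open SimplicialCells

/-! ### Normalization -/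

section Normalization

variable {B C D : Type u} [Bicategory.{u, u} B] [SimplicialBicategory B] [Bicategory.{u, u} C]
  [SimplicialBicategory C] [Bicategory.{u, u} D] [SimplicialBicategory D]

/-- The data `m` and `θ` are typed over the pseudofunctor, and unit and associativity laws hold only
as propositional equalities; hence the heterogeneous form. -/
theorem augLift_congr {F F' : SPseudofunctor B C} (hF : F = F')
    {m : ∀ {a b : B}, (a ⟶ b) → Aug (F.obj a) (F.obj b)}
    {θ : ∀ {a b : B} (f : a ⟶ b), (m f).real ≅ F.map f}
    {m' : ∀ {a b : B}, (a ⟶ b) → Aug (F'.obj a) (F'.obj b)}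
    {θ' : ∀ {a b : B} (f : a ⟶ b), (m' f).real ≅ F'.map f}
    (hm : ∀ {a b : B} (f : a ⟶ b), HEq (m f) (m' f))
    (hθ : ∀ {a b : B} (f : a ⟶ b), HEq (θ f) (θ' f)) :
    augLift F m θ = augLift F' m' θ' := by
  subst hF
  obtain rfl : @m = @m' := by
    funext a b f
    exact eq_of_heq (hm f)
  obtain rfl : @θ = @θ' := by
    funext a b f
    exact eq_of_heq (hθ f)
  rfl

/-- The identity of the underlying 1-morphism. -/
abbrev Aug.reflIso {a b : C} (m : Aug a b) : m.real ≅ m.real := Iso.refl _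

theorem prelax_ext {B C : Type u} [Bicategory.{u, u} B] [Bicategory.{u, u} C]
    {F G : PrelaxFunctor B C} (h : F.toPrefunctor = G.toPrefunctor)
    (h₂ : ∀ {a b : B} {f g : a ⟶ b} (η : f ⟶ g), HEq (F.map₂ η) (G.map₂ η)) : F = G := by
  obtain ⟨⟨F, m⟩, _, _⟩ := F
  obtain ⟨⟨G, m'⟩, _, _⟩ := G
  obtain rfl : F = G := h
  obtain rfl : @m = @m' := by
    funext a b f g η
    exact eq_of_heq (h₂ η)
  rfl

section Strict

open Bicategory

theorem transport_map₂_refl {C : Type u} [Bicategory.{u, u} C] {a b : C} {f g : a ⟶ b}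
    (η : f ⟶ g) : (Iso.refl f).hom ≫ η ≫ (Iso.refl g).inv = η := by
  simp

theorem transport_mapId_refl {C : Type u} [Bicategory.{u, u} C] {a b : C} (f : a ⟶ b) :
    (Iso.refl f).hom ≫ (Iso.refl f).hom = 𝟙 f := by
  simp

theorem transport_mapComp_refl {C : Type u} [Bicategory.{u, u} C] {a b c : C} (f : a ⟶ b)
    (g : b ⟶ c) : (Iso.refl (f ≫ g)).hom ≫ (Iso.refl (f ≫ g)).hom ≫
      (Iso.refl f).inv ▷ g ≫ f ◁ (Iso.refl g).inv = 𝟙 (f ≫ g) := by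
  simp

theorem transport_cell_refl {a b : C} {f g : a ⟶ b} {k : SimplexCategoryᵒᵖ}
    (x : (cell f g).obj k) :
    comp (deg k (Iso.refl f).hom) (comp x (deg k (Iso.refl g).inv)) = x := by
  rw [Iso.refl_inv, Iso.refl_hom, SimplicialBicategory.comp_id, SimplicialBicategory.id_comp]

end Strict

theorem augLift_augProj : augLift (augProj C) (fun m => m) (fun m => Aug.reflIso (C := C) m) =
    SPseudofunctor.id (AugCat C) := by
  refine SPseudofunctor.ext' (SPseudofunctor.pseudo_ext (prelax_ext rfl fun {a b f g} η =>
    heq_of_eq ?_) (fun a => heq_of_eq ?_) (fun f g => heq_of_eq ?_)) (fun f g => heq_of_eq ?_)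
  · exact transport_map₂_refl (C := C) (f := Aug.real f) (g := Aug.real g) η
  · ext
    exact transport_mapId_refl (C := C) (Aug.real (Aug.new (C := C) a))
  · ext
    exact transport_mapComp_refl (C := C) (Aug.real f) (Aug.real g)
  · ext k x
    exact transport_cell_refl (C := C) (f := Aug.real f) (g := Aug.real g) x

theorem comp_map₂_comp_inv_comp_hom (G : SPseudofunctor C D) {a b : C} {f g h : a ⟶ b}
    {p r q : G.obj a ⟶ G.obj b} (x : p ⟶ G.map f) (θ : f ⟶ g) (ι : g ⟶ h) (e : r ≅ G.map h)
    (w : G.map h ⟶ q) : (x ≫ G.map₂ (θ ≫ ι) ≫ e.inv) ≫ e.hom ≫ G.map₂ (𝟙 h) ≫ w =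
      (x ≫ G.map₂ θ) ≫ G.map₂ ι ≫ w := by
  simp

open Bicategory in
-- Composites of lifts are lifts of composites, with the comparison isomorphisms pasted.
-- Functoriality of `augMap` thereby reduces to comparing 1-morphisms and isomorphisms for old and
-- new ones separately.
theorem augLift_comp_augLift (F : SPseudofunctor B C) (G : SPseudofunctor C D)
    (m : ∀ {a b : B}, (a ⟶ b) → Aug (F.obj a) (F.obj b))
    (θ : ∀ {a b : B} (f : a ⟶ b), (m f).real ≅ F.map f)
    (n : ∀ {a b : C}, Aug a b → Aug (G.obj a) (G.obj b))
    (φ : ∀ {a b : C} (f : Aug a b), (n f).real ≅ G.map f.real) :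
    (augLift F m θ).comp (augLift ((augProj C).comp G) (fun f => n f) (fun f => φ f)) =
      augLift (F.comp G) (fun f => n (m f)) (fun f => φ (m f) ≪≫ G.map₂Iso (θ f)) := by
  refine SPseudofunctor.ext' (SPseudofunctor.pseudo_ext (prelax_ext rfl fun {a b f g} η =>
    heq_of_eq ?_) (fun a => heq_of_eq ?_) (fun f g => heq_of_eq ?_)) (fun f g => heq_of_eq ?_)
  · change (φ (m f)).hom ≫ G.map₂ ((θ f).hom ≫ F.map₂ η ≫ (θ g).inv) ≫ (φ (m g)).inv =
      ((φ (m f)).hom ≫ G.map₂ (θ f).hom) ≫ G.map₂ (F.map₂ η) ≫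
        (G.map₂ (θ g).inv ≫ (φ (m g)).inv)
    simp
  · ext
    change ((φ (m (𝟙 a))).hom ≫ G.map₂ ((θ (𝟙 a)).hom ≫ (F.mapId a).hom) ≫
      (φ (.new (F.obj a))).inv) ≫ (φ (.new (F.obj a))).hom ≫ G.map₂ (𝟙 _) ≫
        (G.mapId (F.obj a)).hom =
      ((φ (m (𝟙 a))).hom ≫ G.map₂ (θ (𝟙 a)).hom) ≫ G.map₂ (F.mapId a).hom ≫
        (G.mapId (F.obj a)).hom
    exact comp_map₂_comp_inv_comp_hom G _ _ _ _ _
  · ext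
    change ((φ (m (f ≫ g))).hom ≫ G.map₂ ((θ (f ≫ g)).hom ≫ (F.mapComp f g).hom ≫
        (θ f).inv ▷ F.map g ≫ (m f).real ◁ (θ g).inv) ≫
          (φ (.old ((m f).real ≫ (m g).real))).inv) ≫
        (φ (.old ((m f).real ≫ (m g).real))).hom ≫ (G.map₂ (𝟙 ((m f).real ≫ (m g).real)) ≫
        (G.mapComp (m f).real (m g).real).hom) ≫ (φ (m f)).inv ▷ G.map (m g).real ≫
          (n (m f)).real ◁ (φ (m g)).inv =
      ((φ (m (f ≫ g))).hom ≫ G.map₂ (θ (f ≫ g)).hom) ≫ (G.map₂ (F.mapComp f g).hom ≫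
        (G.mapComp (F.map f) (F.map g)).hom) ≫ (G.map₂ (θ f).inv ≫ (φ (m f)).inv) ▷
          G.map (F.map g) ≫ (n (m f)).real ◁ (G.map₂ (θ g).inv ≫ (φ (m g)).inv)
    refine (congrArg (_ ≫ ·) (congrArg (_ ≫ ·) (Category.assoc _ _ _))).trans
      ((comp_map₂_comp_inv_comp_hom G _ _ _ _ _).trans ?_)
    simp
    rw [whisker_exchange_assoc]
  · ext k x
    change comp (deg k (φ (m f)).hom) (comp ((G.mapCell _ _).app k
        (comp (deg k (θ f).hom) (comp ((F.mapCell f g).app k x) (deg k (θ g).inv))))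
        (deg k (φ (m g)).inv)) =
      comp (deg k ((φ (m f)).hom ≫ G.map₂ (θ f).hom)) (comp ((G.mapCell _ _).app k
        ((F.mapCell f g).app k x)) (deg k (G.map₂ (θ g).inv ≫ (φ (m g)).inv)))
    simp only [G.mapCell_comp, deg_comp, SPseudofunctor.mapCell_deg, SimplicialBicategory.assoc]

/-- The action of a pseudofunctor on augmented 1-morphisms. -/
def augMapHom (F : SPseudofunctor C D) : ∀ {a b : C}, Aug a b → Aug (F.obj a) (F.obj b)
  | _, _, .old f => .old (F.map f)
  | _, _, .new a => .new (F.obj a)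

/-- The comparison of the actions of a pseudofunctor on 1-morphisms and augmented 1-morphisms. -/
def augMapIso (F : SPseudofunctor C D) : ∀ {a b : C} (m : Aug a b),
    (augMapHom F m).real ≅ F.map m.real
  | _, _, .old f => Iso.refl (F.map f)
  | _, _, .new a => (F.mapId a).symm

/-- The normal pseudofunctor between augmented bicategories induced by a pseudofunctor. -/
def augMap (F : SPseudofunctor C D) : SPseudofunctor (AugCat C) (AugCat D) :=
  augLift ((augProj C).comp F) (fun m => augMapHom F m) fun m => augMapIso F m

theorem mapId_inv_comp_map₂_id (F : SPseudofunctor C D) (a : C) :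
    ((F.mapId a).inv ≫ F.map₂ (𝟙 (𝟙 a)) ≫ (F.mapId a).hom) = 𝟙 (𝟙 (F.obj a)) := by
  simp

/-- A new identity is compared with `F (𝟙 a)` by the inverse of the identity constraint of `F`,
which cancels that constraint. -/
theorem augMap_isNormal (F : SPseudofunctor C D) : (augMap F).IsNormal := by
  refine ⟨fun a => rfl, fun a => ?_⟩
  ext
  exact mapId_inv_comp_map₂_id F a

theorem augMap_id : augMap (SPseudofunctor.id C) = SPseudofunctor.id (AugCat C) := by
  refine Eq.trans (augLift_congr (SPseudofunctor.comp_id _) ?_ ?_) augLift_augProj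
  · rintro _ _ (f | a) <;> rfl
  · rintro _ _ (f | a) <;> rfl

theorem augMap_comp (F : SPseudofunctor B C) (G : SPseudofunctor C D) :
    augMap (F.comp G) = (augMap F).comp (augMap G) := by
  refine Eq.trans (augLift_congr (SPseudofunctor.assoc _ _ _).symm ?_ ?_)
    (augLift_comp_augLift _ G _ _ _ _).symm
  · rintro _ _ (f | a) <;> rfl
  · rintro a b (f | a)
    · refine heq_of_eq (Iso.ext ?_)
      change 𝟙 (G.map (F.map f)) = 𝟙 (G.map (F.map f)) ≫ G.map₂ (𝟙 (F.map f))
      simp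
    · rfl

/-- Normalization of bicategories: adjoining new identities, as a functor to bicategories and
normal pseudofunctors. -/
def normalization : Bicat.{u} ⥤ NormalBicat.{u} where
  obj C := ⟨@Bicat.mk (AugCat C.carrier) augBicategory augSimplicialBicategory⟩
  map {C D} F := ⟨augMap (C := C.carrier) (D := D.carrier) (Bicat.toPseudo F),
    augMap_isNormal (C := C.carrier) (D := D.carrier) (Bicat.toPseudo F)⟩
  map_id C := by
    ext
    exact augMap_id
  map_comp F G := by
    ext
    exact augMap_comp _ _

end Normalization

end SegalGamma

namespace SegalGamma

open SimplicialCells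

/-! ### Choosing new identities for identity 1-morphisms. -/

section Augmentation

variable {C : Type u} [Bicategory.{u, u} C]

/-- The property of being an identity 1-morphism. -/
inductive IsIdentity : ∀ {a b : C}, (a ⟶ b) → Prop
  | id (a : C) : IsIdentity (𝟙 a)

/-- The relation between a 1-morphism and the corresponding augmented 1-morphism, which is a new
identity in the case of an identity. -/
inductive IsAugmentation : ∀ {a b : C} (f : a ⟶ b), (Σ m : Aug a b, m.real ≅ f) → Prop
  | id (a : C) : IsAugmentation (𝟙 a) ⟨.new a, Iso.refl (𝟙 a)⟩
  | old {a b : C} (f : a ⟶ b) (hf : ¬ IsIdentity f) : IsAugmentation f ⟨.old f, Iso.refl f⟩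

theorem exists_isAugmentation {a b : C} (f : a ⟶ b) : ∃ p, IsAugmentation f p := by
  by_cases hf : IsIdentity f
  · obtain ⟨a⟩ := hf
    exact ⟨_, .id a⟩
  · exact ⟨_, .old f hf⟩

/-- The `old` case excludes identities, so the choice made by `augOf` is forced there; this is the
source of normality below. Being an identity is an inductive predicate because `f = 𝟙 a` does not
typecheck for general endpoints. -/
theorem IsAugmentation.eq_new {a : C} {p : Σ m : Aug a a, m.real ≅ 𝟙 a}
    (h : IsAugmentation (𝟙 a) p) : p = ⟨.new a, Iso.refl (𝟙 a)⟩ := by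
  cases h with
  | id => rfl
  | old _ hf => exact (hf (.id a)).elim

/-- The augmented 1-morphism corresponding to a 1-morphism. -/
noncomputable def augOf {a b : C} (f : a ⟶ b) : Σ m : Aug a b, m.real ≅ f :=
  (exists_isAugmentation f).choose

theorem augOf_id (a : C) : augOf (𝟙 a) = ⟨.new a, Iso.refl (𝟙 a)⟩ :=
  (exists_isAugmentation (𝟙 a)).choose_spec.eq_new

theorem isEquivalence₁_id (a : C) : IsEquivalence₁ (𝟙 a) :=
  ⟨𝟙 a, ⟨Bicategory.leftUnitor _⟩, ⟨Bicategory.leftUnitor _⟩⟩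

end Augmentation

/-! ### Transformations between lifts, and existence of normalizations. -/

section Normalization

variable {B C D : Type u} [Bicategory.{u, u} B] [SimplicialBicategory B] [Bicategory.{u, u} C]
  [SimplicialBicategory C] [Bicategory.{u, u} D] [SimplicialBicategory D]

theorem nonempty_sTrans_augLift_comp_augProj (F : SPseudofunctor B C)
    (m : ∀ {a b : B}, (a ⟶ b) → Aug (F.obj a) (F.obj b))
    (θ : ∀ {a b : B} (f : a ⟶ b), (m f).real ≅ F.map f) :
    Nonempty (STrans ((augLift F m θ).comp (augProj C)) F) := by
  rw [augLift_comp_augProj]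
  exact ⟨ofTransport _ _ _⟩

theorem nonempty_sTrans_comp_augLift (F : SPseudofunctor B C)
    (m : ∀ {a b : B}, (a ⟶ b) → Aug (F.obj a) (F.obj b))
    (θ : ∀ {a b : B} (f : a ⟶ b), (m f).real ≅ F.map f) :
    Nonempty (STrans F ((augLift F m θ).comp (augProj C))) := by
  rw [augLift_comp_augProj]
  exact ⟨toTransport _ _ _⟩

theorem nonempty_sTrans_comp_augMap {F G : SPseudofunctor C D} (η : STrans F G) :
    Nonempty (STrans ((augProj C).comp F) ((augMap G).comp (augProj D))) := by
  obtain ⟨α⟩ := nonempty_sTrans_comp_augLift ((augProj C).comp G)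
    (fun m => augMapHom G m) fun m => augMapIso G m
  exact ⟨(η.precomp (augProj C)).vcomp α⟩

/-- Transformations of pseudofunctors into `AugCat D` can be given after projecting to `D`. There
both sides are transports of composites with the projection, and `η` connects them. -/
theorem nonempty_sTrans_augMap {F G : SPseudofunctor C D} (η : STrans F G) :
    Nonempty (STrans (augMap F) (augMap G)) := by
  obtain ⟨α⟩ := nonempty_sTrans_augLift_comp_augProj ((augProj C).comp F)
    (fun m => augMapHom F m) fun m => augMapIso F m
  obtain ⟨β⟩ := nonempty_sTrans_comp_augMap η
  exact ⟨STrans.reflect (α.vcomp β)⟩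

/-- The inclusion of a bicategory into the one with new identities adjoined, as a normal
pseudofunctor. -/
noncomputable def augIncl (C : Type u) [Bicategory.{u, u} C] [SimplicialBicategory C] :
    SPseudofunctor C (AugCat C) :=
  augLift (SPseudofunctor.id C) (fun f => (augOf f).1) (fun f => (augOf f).2)

theorem augIncl_isNormal : (augIncl C).IsNormal := by
  have h : ∀ a : C, (augOf (𝟙 a)).1 = .new a := fun a => congrArg Sigma.fst (augOf_id a)
  refine ⟨h, fun a => ?_⟩
  ext
  -- `augOf (𝟙 a)` is known only up to a propositional equality; generalizing it to `p` lets that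
  -- equation be substituted in the dependent types.
  have key : ∀ (p : Σ m : Aug a a, m.real ≅ 𝟙 a) (hp : p = ⟨.new a, Iso.refl (𝟙 a)⟩)
    (h' : p.1 = .new a), augIso (n := .new a) (p.2 ≪≫ Iso.refl (𝟙 a)) = eqToIso h' := by
    rintro p rfl h'
    ext
    exact Category.comp_id (𝟙 (𝟙 a))
  exact congrArg Iso.hom (key _ (augOf_id a) (h a))

theorem nonempty_sTrans_augIncl_comp_augProj :
    Nonempty (STrans ((augIncl C).comp (augProj C)) (SPseudofunctor.id C)) :=
  nonempty_sTrans_augLift_comp_augProj _ _ _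

theorem nonempty_sTrans_augProj_comp_augIncl :
    Nonempty (STrans ((augProj C).comp (augIncl C)) (SPseudofunctor.id (AugCat C))) := by
  obtain ⟨α⟩ := nonempty_sTrans_augIncl_comp_augProj (C := C)
  have β := α.precomp (augProj C)
  rw [SPseudofunctor.comp_id, ← SPseudofunctor.assoc] at β
  have h : STrans (((augProj C).comp (augIncl C)).comp (augProj C))
      ((SPseudofunctor.id (AugCat C)).comp (augProj C)) := by
    rw [SPseudofunctor.id_comp]
    exact β
  exact ⟨STrans.reflect h⟩

/-- Every pseudofunctor has a normalization. -/
theorem exists_normalization (F : SPseudofunctor C D) :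
    ∃ G : SPseudofunctor C D, G.IsNormal ∧ NatEquivalent G F := by
  -- Values of `F` are changed only on identities, where `F (𝟙 a)` is replaced by `𝟙` along the
  -- identity constraint.
  refine ⟨transport F (fun f => (augMapHom F (augOf f).1).real)
    (fun f => augMapIso F (augOf f).1 ≪≫ F.map₂Iso (augOf f).2), ?_, ofTransport _ _ _,
    fun a => isEquivalence₁_id _⟩
  have h : ∀ a : C, (augMapHom F (augOf (𝟙 a)).1).real = 𝟙 (F.obj a) := fun a => by
    rw [augOf_id]
    rfl
  refine ⟨h, fun a => ?_⟩
  have key : ∀ (p : Σ m : Aug a a, m.real ≅ 𝟙 a) (hp : p = ⟨.new a, Iso.refl (𝟙 a)⟩)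
    (h' : (augMapHom F p.1).real = 𝟙 (F.obj a)),
      (augMapIso F p.1 ≪≫ F.map₂Iso p.2) ≪≫ F.mapId a = eqToIso h' := by
    rintro p rfl h'
    ext
    change ((F.mapId a).inv ≫ F.map₂ (𝟙 (𝟙 a))) ≫ (F.mapId a).hom = 𝟙 (𝟙 (F.obj a))
    simp
  exact key _ (augOf_id a) (h a)

end Normalization

end SegalGamma

namespace SegalGamma

open SimplicialCells

/-! ### Cylinders of transformations -/

section Cylinder

open Bicategory

variable {D : Type u} [Bicategory.{u, u} D] {I : Type} [Preorder I] {c d : I → D}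

theorem associator_inv_naturality_square {a a' b b' e : D} {p : a ⟶ a'} {f : a' ⟶ b'}
    {g : a ⟶ b} {q : b ⟶ b'} (σ : p ≫ f ⟶ g ≫ q) {r r' : b' ⟶ e} (ζ : r ⟶ r') :
    (α_ p f r).inv ≫ σ ▷ r ≫ (α_ g q r).hom ≫ g ◁ q ◁ ζ =
      p ◁ f ◁ ζ ≫ (α_ p f r').inv ≫ σ ▷ r' ≫ (α_ g q r').hom := by
  rw [← associator_naturality_right, ← whisker_exchange_assoc, associator_inv_naturality_right_assoc]

/-- The structure of a transformation with components `α` between normal pseudofunctors. -/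
structure NorTrans (Y : NorHom D c) (Z : NorHom D d) (α : ∀ i, c i ⟶ d i) where
  /-- the naturality constraints -/
  nat {i j : I} (h : i ≤ j) : Y.map h ≫ α j ≅ α i ≫ Z.map h
  nat_id (i : I) : (nat (le_refl i)).hom ≫ α i ◁ (Z.mapId i).hom =
    (Y.mapId i).hom ▷ α i ≫ (λ_ (α i)).hom ≫ (ρ_ (α i)).inv
  nat_comp {i j l : I} (hij : i ≤ j) (hjl : j ≤ l) :
    (nat (hij.trans hjl)).hom ≫ α i ◁ (Z.mapComp hij hjl).hom =
      (Y.mapComp hij hjl).hom ▷ α l ≫ (α_ _ _ _).hom ≫ Y.map hij ◁ (nat hjl).hom ≫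
        (α_ _ _ _).inv ≫ (nat hij).hom ▷ Z.map hjl ≫ (α_ _ _ _).hom

namespace NorTrans

variable {Y : NorHom D c} {Z : NorHom D d} {α : ∀ i, c i ⟶ d i} (T : NorTrans Y Z α)

theorem nat_inv_comp_mapId (i : I) : (T.nat (le_refl i)).inv ≫ (Y.mapId i).hom ▷ α i =
    α i ◁ (Z.mapId i).hom ≫ (ρ_ (α i)).hom ≫ (λ_ (α i)).inv := by
  rw [Iso.inv_comp_eq, reassoc_of% T.nat_id i]
  simp

theorem nat_inv_comp_mapComp {i j l : I} (hij : i ≤ j) (hjl : j ≤ l) :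
    (T.nat (hij.trans hjl)).inv ≫ (Y.mapComp hij hjl).hom ▷ α l =
      α i ◁ (Z.mapComp hij hjl).hom ≫ (α_ _ _ _).inv ≫ (T.nat hij).inv ▷ Z.map hjl ≫
        (α_ _ _ _).hom ≫ Y.map hij ◁ (T.nat hjl).inv ≫ (α_ _ _ _).inv := by
  rw [Iso.inv_comp_eq, reassoc_of% T.nat_comp hij hjl]
  simp

/-- The composition constraint of the cylinder in the case where the first 1-morphism lies in the
source. -/
def compSource {i j l : I} (hij : i ≤ j) (hjl : j ≤ l) :
    α i ≫ Z.map (hij.trans hjl) ≅ Y.map hij ≫ α j ≫ Z.map hjl :=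
  whiskerLeftIso (α i) (Z.mapComp hij hjl) ≪≫ (α_ _ _ _).symm ≪≫
    whiskerRightIso (T.nat hij).symm (Z.map hjl) ≪≫ α_ _ _ _

/-- The composition constraint of the cylinder in the case where the second 1-morphism lies in the
target. -/
def compTarget (α : ∀ i, c i ⟶ d i) (Z : NorHom D d) {i j l : I} (hij : i ≤ j) (hjl : j ≤ l) :
    α i ≫ Z.map (hij.trans hjl) ≅ (α i ≫ Z.map hij) ≫ Z.map hjl :=
  whiskerLeftIso (α i) (Z.mapComp hij hjl) ≪≫ (α_ _ _ _).symm

/-- In a chain of three 1-morphisms the crossing from source to target may occur in the last, the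
middle or the first one. These are this lemma and the next two; only a crossing in the last uses
compatibility of the transformation with composition. -/
theorem compSource_assoc {i j k l : I} (hij : i ≤ j) (hjk : j ≤ k) (hkl : k ≤ l) :
    (T.compSource (hij.trans hjk) hkl).hom ≫ (Y.mapComp hij hjk).hom ▷ (α k ≫ Z.map hkl) ≫
        (α_ _ _ _).hom =
      (T.compSource hij (hjk.trans hkl)).hom ≫ Y.map hij ◁ (T.compSource hjk hkl).hom := by
  have h₁ := congrArg (fun x => (α_ _ _ _).inv ≫ x ▷ Z.map hkl ≫ (α_ _ _ _).hom)
    (T.nat_inv_comp_mapComp hij hjk)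
  have h₂ := congrArg (fun x => α i ◁ x ≫ α i ◁ (α_ _ _ _).inv) (Z.map_assoc hij hjk hkl)
  simp [compSource] at h₁ h₂ ⊢
  rw [reassoc_of% h₁, reassoc_of% h₂]
  rw [reassoc_of% associator_inv_naturality_square (T.nat hij).inv (Z.mapComp hjk hkl).hom]
  simp

theorem compSource_compTarget {i j k l : I} (hij : i ≤ j) (hjk : j ≤ k) (hkl : k ≤ l) :
    (compTarget α Z (hij.trans hjk) hkl).hom ≫ (T.compSource hij hjk).hom ▷ Z.map hkl ≫
        (α_ _ _ _).hom =
      (T.compSource hij (hjk.trans hkl)).hom ≫ Y.map hij ◁ (compTarget α Z hjk hkl).hom := by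
  have h₂ := congrArg (fun x => α i ◁ x ≫ α i ◁ (α_ _ _ _).inv) (Z.map_assoc hij hjk hkl)
  simp [compSource, compTarget] at h₂ ⊢
  rw [reassoc_of% h₂]
  rw [reassoc_of% associator_inv_naturality_square (T.nat hij).inv (Z.mapComp hjk hkl).hom]
  simp

theorem compTarget_assoc {i j k l : I} (hij : i ≤ j) (hjk : j ≤ k) (hkl : k ≤ l) :
    (compTarget α Z (hij.trans hjk) hkl).hom ≫ (compTarget α Z hij hjk).hom ▷ Z.map hkl ≫
        (α_ _ _ _).hom =
      (compTarget α Z hij (hjk.trans hkl)).hom ≫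
        (α i ≫ Z.map hij) ◁ (Z.mapComp hjk hkl).hom := by
  have h₂ := congrArg (fun x => α i ◁ x) (Z.map_assoc hij hjk hkl)
  simp [compTarget] at h₂ ⊢
  rw [reassoc_of% h₂]

theorem compSource_left_unitor {i j : I} (h : i ≤ j) :
    (T.compSource (le_refl i) h).hom ≫ (Y.mapId i).hom ▷ (α i ≫ Z.map h) ≫
      (λ_ (α i ≫ Z.map h)).hom = 𝟙 (α i ≫ Z.map h) := by
  have h₁ := congrArg (fun x => (α_ _ _ _).inv ≫ x ▷ Z.map h ≫ (α_ _ _ _).hom)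
    (T.nat_inv_comp_mapId i)
  have h₂ := congrArg (fun x => α i ◁ x) (Z.map_left_unitor h)
  simp [compSource] at h₁ h₂ ⊢
  rw [reassoc_of% h₁, Iso.inv_hom_id, Category.comp_id]
  exact h₂

theorem compTarget_right_unitor {i j : I} (h : i ≤ j) :
    (compTarget α Z h (le_refl j)).hom ≫ (α i ≫ Z.map h) ◁ (Z.mapId j).hom ≫
      (ρ_ (α i ≫ Z.map h)).hom = 𝟙 (α i ≫ Z.map h) := by
  have h₂ := congrArg (fun x => α i ◁ x) (Z.map_right_unitor h)
  simp [compTarget] at h₂ ⊢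
  exact h₂

end NorTrans

end Cylinder

end SegalGamma

namespace SegalGamma

open SimplicialCells

/-! ### The cylinder as a normal pseudofunctor on `Bool × I`. -/

section Cylinder

open Bicategory

variable {D : Type u} [Bicategory.{u, u} D] {I : Type} [Preorder I] {c d : I → D}

theorem not_true_le_false : ¬ true ≤ false := by decide

/-! ### Case distinctions over the interval `Bool`. -/

section Selection

/-- Selection of one of two objects. -/
def sel (x x' : D) : Bool → D
  | false => x
  | true => x'

/-- Selection of one of three 1-morphisms. -/
def selHom {x x' y y' : D} (f : x ⟶ y) (g : x ⟶ y') (f' : x' ⟶ y') :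
    ∀ {b b' : Bool}, b ≤ b' → (sel x x' b ⟶ sel y y' b')
  | false, false, _ => f
  | false, true, _ => g
  | true, true, _ => f'
  | true, false, h => (not_true_le_false h).elim

/-- Selection of one of two identity constraints. -/
def selId {x x' : D} {f : x ⟶ x} (g : x ⟶ x') {f' : x' ⟶ x'} (e : f ≅ 𝟙 x) (e' : f' ≅ 𝟙 x') :
    ∀ b : Bool, selHom f g f' (le_refl b) ≅ 𝟙 (sel x x' b)
  | false => e
  | true => e'

/-- Selection of one of four composition constraints. -/
def selComp {x x' y y' z z' : D} {f₁ : x ⟶ y} {g₁ : x ⟶ y'} {f₁' : x' ⟶ y'} {f₂ : y ⟶ z}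
    {g₂ : y ⟶ z'} {f₂' : y' ⟶ z'} {f₃ : x ⟶ z} {g₃ : x ⟶ z'} {f₃' : x' ⟶ z'}
    (e₁ : f₃ ≅ f₁ ≫ f₂) (e₂ : g₃ ≅ f₁ ≫ g₂) (e₃ : g₃ ≅ g₁ ≫ f₂') (e₄ : f₃' ≅ f₁' ≫ f₂') :
    ∀ {b b' b'' : Bool} (h : b ≤ b') (h' : b' ≤ b''),
      selHom f₃ g₃ f₃' (h.trans h') ≅ selHom f₁ g₁ f₁' h ≫ selHom f₂ g₂ f₂' h'
  | false, false, false, _, _ => e₁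
  | false, false, true, _, _ => e₂
  | false, true, true, _, _ => e₃
  | true, true, true, _, _ => e₄
  | true, false, _, h, _ => (not_true_le_false h).elim
  | _, true, false, _, h => (not_true_le_false h).elim

/-- Selection of one of three simplices of 2-cells. -/
def selCell [SimplicialBicategory D] {k : SimplexCategoryᵒᵖ} {x x' y y' : D} {f₁ f₂ : x ⟶ y}
    {g₁ g₂ : x ⟶ y'} {f₁' f₂' : x' ⟶ y'} (u : (cell f₁ f₂).obj k) (v : (cell g₁ g₂).obj k)
    (w : (cell f₁' f₂').obj k) : ∀ {b b' : Bool} (h : b ≤ b'),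
      (cell (selHom f₁ g₁ f₁' h) (selHom f₂ g₂ f₂' h)).obj k
  | false, false, _ => u
  | false, true, _ => v
  | true, true, _ => w
  | true, false, h => (not_true_le_false h).elim

end Selection

/-- The objects of a cylinder. -/
def cylObj (c d : I → D) (p : Bool × I) : D :=
  sel (c p.2) (d p.2) p.1

namespace NorTrans

variable {Y : NorHom D c} {Z : NorHom D d} {α : ∀ i, c i ⟶ d i}

/-- The 1-morphisms of a cylinder. -/
abbrev cylMap (Y : NorHom D c) (Z : NorHom D d) (α : ∀ i, c i ⟶ d i) {p q : Bool × I}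
    (h : p ≤ q) : cylObj c d p ⟶ cylObj c d q :=
  selHom (Y.map h.2) (α p.2 ≫ Z.map h.2) (Z.map h.2) h.1

/-- The cylinder of a transformation. -/
def cylinder (T : NorTrans Y Z α) : NorHom D (cylObj c d) where
  map h := cylMap Y Z α h
  mapId p := selId (α p.2 ≫ Z.map (le_refl p.2)) (Y.mapId p.2) (Z.mapId p.2) p.1
  mapComp h h' := selComp (Y.mapComp h.2 h'.2) (T.compSource h.2 h'.2) (compTarget α Z h.2 h'.2)
    (Z.mapComp h.2 h'.2) h.1 h'.1
  map_assoc := by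
    rintro ⟨b₁, i⟩ ⟨b₂, j⟩ ⟨b₃, k⟩ ⟨b₄, l⟩ h h' h''
    -- Five monotone patterns survive: two stay at one end and are the axioms of `Y` and `Z`, three
    -- cross and are the mixed cases above.
    cases b₁
    · cases b₂
      · cases b₃
        · cases b₄
          · exact Y.map_assoc h.2 h'.2 h''.2
          · exact T.compSource_assoc h.2 h'.2 h''.2
        · cases b₄
          · exact (not_true_le_false h''.1).elim
          · exact T.compSource_compTarget h.2 h'.2 h''.2
      · cases b₃
        · exact (not_true_le_false h'.1).elim
        · cases b₄
          · exact (not_true_le_false h''.1).elim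
          · exact compTarget_assoc h.2 h'.2 h''.2
    · cases b₂
      · exact (not_true_le_false h.1).elim
      · cases b₃
        · exact (not_true_le_false h'.1).elim
        · cases b₄
          · exact (not_true_le_false h''.1).elim
          · exact Z.map_assoc h.2 h'.2 h''.2
  map_left_unitor := by
    rintro ⟨b₁, i⟩ ⟨b₂, j⟩ h
    cases b₁ <;> cases b₂
    · exact Y.map_left_unitor h.2
    · exact T.compSource_left_unitor h.2
    · exact (not_true_le_false h.1).elim
    · exact Z.map_left_unitor h.2
  map_right_unitor := by
    rintro ⟨b₁, i⟩ ⟨b₂, j⟩ h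
    cases b₁ <;> cases b₂
    · exact Y.map_right_unitor h.2
    · exact compTarget_right_unitor h.2
    · exact (not_true_le_false h.1).elim
    · exact Z.map_right_unitor h.2
  normal := by
    obtain ⟨hY, hY'⟩ := Y.normal
    obtain ⟨hZ, hZ'⟩ := Z.normal
    refine ⟨?_, ?_⟩
    · rintro ⟨_ | _, i⟩
      · exact hY i
      · exact hZ i
    · rintro ⟨_ | _, i⟩
      · exact hY' i
      · exact hZ' i

variable [SimplicialBicategory D] {k : SimplexCategoryᵒᵖ} {Y' : NorHom D c} {Z' : NorHom D d}

theorem whiskerLeft_whiskerRight_comp_deg_associator_inv {a b c d : D} (f : a ⟶ b) {g g' : b ⟶ c}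
    (x : (cell g g').obj k) (h : c ⟶ d) :
    comp (SimplicialCells.whiskerLeft f (SimplicialCells.whiskerRight x h))
        (deg k (α_ f g' h).inv) =
      comp (deg k (α_ f g h).inv)
        (SimplicialCells.whiskerRight (SimplicialCells.whiskerLeft f x) h) := by
  refine comp_deg_iso_cancel (α_ f g' h) ?_
  rw [SimplicialBicategory.assoc, SimplicialBicategory.assoc, deg_inv_comp_deg',
    SimplicialBicategory.comp_id, SimplicialBicategory.associator_naturality_middle,
    deg_inv_comp_deg]

/-- Reverses a naturality square whose constraints are invertible; needed since the cylinder is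
built with the inverse naturality constraints. -/
theorem comp_deg_inv_eq {a b : D} {f g f' g' : a ⟶ b} {x : (cell f g).obj k}
    {y : (cell f' g').obj k} {e : f ≅ f'} {e' : g ≅ g'}
    (h : comp x (deg k e'.hom) = comp (deg k e.hom) y) :
    comp y (deg k e'.inv) = comp (deg k e.inv) x := by
  refine comp_deg_iso_cancel e' ?_
  rw [SimplicialBicategory.assoc, SimplicialBicategory.assoc, deg_inv_comp_deg',
    SimplicialBicategory.comp_id, h, deg_inv_comp_deg]

/-- The composition constraint with a crossing in the second 1-morphism is natural in icons: the
icon axiom at the target end splits `z''`, and the inverted naturality square turns `z` into `y`. -/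
theorem compSource_cell (T : NorTrans Y Z α) (T' : NorTrans Y' Z' α) {i j l : I} (hij : i ≤ j)
    (hjl : j ≤ l) {y : (cell (Y.map hij) (Y'.map hij)).obj k}
    {z : (cell (Z.map hij) (Z'.map hij)).obj k} {z' : (cell (Z.map hjl) (Z'.map hjl)).obj k}
    {z'' : (cell (Z.map (hij.trans hjl)) (Z'.map (hij.trans hjl))).obj k}
    (hy : comp (SimplicialCells.whiskerRight y (α j)) (deg k (T'.nat hij).hom) =
      comp (deg k (T.nat hij).hom) (SimplicialCells.whiskerLeft (α i) z))
    (hz : comp z'' (deg k (Z'.mapComp hij hjl).hom) = comp (deg k (Z.mapComp hij hjl).hom)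
      (comp (SimplicialCells.whiskerRight z (Z.map hjl))
        (SimplicialCells.whiskerLeft (Z'.map hij) z'))) :
    comp (SimplicialCells.whiskerLeft (α i) z'') (deg k (T'.compSource hij hjl).hom) =
      comp (deg k (T.compSource hij hjl).hom)
        (comp (SimplicialCells.whiskerRight y (α j ≫ Z.map hjl))
          (SimplicialCells.whiskerLeft (Y'.map hij) (SimplicialCells.whiskerLeft (α j) z'))) := by
  have hz' := congrArg (SimplicialCells.whiskerLeft (α i)) hz
  simp only [SimplicialBicategory.whiskerLeft_comp] at hz'
  simp only [compSource, Iso.trans_hom, Iso.symm_hom, whiskerLeftIso_hom, whiskerRightIso_hom,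
    deg_comp, deg_whiskerLeft, deg_whiskerRight, SimplicialBicategory.assoc]
  rw [comp_comp_eq hz']
  simp only [SimplicialBicategory.assoc]
  rw [comp_comp_eq (whiskerLeft_comp_deg_associator_inv (α i) (Z'.map hij) z'),
    comp_comp_eq (SimplicialBicategory.whisker_exchange (deg k (T'.nat hij).inv) z'),
    SimplicialBicategory.associator_naturality_right,
    comp_comp_eq (whiskerLeft_whiskerRight_comp_deg_associator_inv (α i) z (Z.map hjl)),
    ← SimplicialBicategory.assoc (SimplicialCells.whiskerRight
      (SimplicialCells.whiskerLeft (α i) z) (Z.map hjl)),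
    ← SimplicialBicategory.whiskerRight_comp, comp_deg_inv_eq hy,
    SimplicialBicategory.whiskerRight_comp, SimplicialBicategory.assoc,
    comp_comp_eq (SimplicialBicategory.associator_naturality_left y (α j) (Z.map hjl))]

theorem compTarget_cell {i j l : I} (hij : i ≤ j)
    (hjl : j ≤ l) 
    {z : (cell (Z.map hij) (Z'.map hij)).obj k} {z' : (cell (Z.map hjl) (Z'.map hjl)).obj k}
    {z'' : (cell (Z.map (hij.trans hjl)) (Z'.map (hij.trans hjl))).obj k}
    (hz : comp z'' (deg k (Z'.mapComp hij hjl).hom) = comp (deg k (Z.mapComp hij hjl).hom)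
      (comp (SimplicialCells.whiskerRight z (Z.map hjl))
        (SimplicialCells.whiskerLeft (Z'.map hij) z'))) :
    comp (SimplicialCells.whiskerLeft (α i) z'') (deg k (compTarget α Z' hij hjl).hom) =
      comp (deg k (compTarget α Z hij hjl).hom)
        (comp (SimplicialCells.whiskerRight (SimplicialCells.whiskerLeft (α i) z) (Z.map hjl))
          (SimplicialCells.whiskerLeft (α i ≫ Z'.map hij) z')) := by
  have hz' := congrArg (SimplicialCells.whiskerLeft (α i)) hz
  simp only [SimplicialBicategory.whiskerLeft_comp] at hz'
  simp only [compTarget, Iso.trans_hom, Iso.symm_hom, whiskerLeftIso_hom,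
    deg_comp, deg_whiskerLeft, SimplicialBicategory.assoc]
  rw [comp_comp_eq hz']
  simp only [SimplicialBicategory.assoc]
  rw [whiskerLeft_comp_deg_associator_inv,
    comp_comp_eq (whiskerLeft_whiskerRight_comp_deg_associator_inv (α i) z (Z.map hjl))]

/-- The cylinder of a compatible pair of icons. -/
def cylIcon (T : NorTrans Y Z α) (T' : NorTrans Y' Z' α) (y : Icon k Y Y') (z : Icon k Z Z')
    (hyz : ∀ {i j : I} (h : i ≤ j),
      comp (SimplicialCells.whiskerRight (y.app h) (α j)) (deg k (T'.nat h).hom) =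
        comp (deg k (T.nat h).hom) (SimplicialCells.whiskerLeft (α i) (z.app h))) :
    Icon k T.cylinder T'.cylinder where
  app {p q} h := selCell (y.app h.2) (SimplicialCells.whiskerLeft (α p.2) (z.app h.2))
    (z.app h.2) h.1
  app_id := by
    rintro ⟨_ | _, i⟩
    · exact y.app_id i
    · exact z.app_id i
  app_comp := by
    rintro ⟨b₁, i⟩ ⟨b₂, j⟩ ⟨b₃, l⟩ h h'
    cases b₁ <;> cases b₂ <;> cases b₃
    · exact y.app_comp h.2 h'.2
    · exact compSource_cell T T' h.2 h'.2 (hyz h.2) (z.app_comp h.2 h'.2)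
    · exact (not_true_le_false h'.1).elim
    · exact compTarget_cell h.2 h'.2 (z.app_comp h.2 h'.2)
    · exact (not_true_le_false h.1).elim
    · exact (not_true_le_false h.1).elim
    · exact (not_true_le_false h'.1).elim
    · exact z.app_comp h.2 h'.2

end NorTrans

variable {C : Type u} [Bicategory.{u, u} C] [SimplicialBicategory C] [SimplicialBicategory D]

/-- The transformation between composites of a normal pseudofunctor induced by a transformation. -/
def STrans.norTrans {F G : SPseudofunctor C D} (η : STrans F G) (hF : F.IsNormal)
    (hG : G.IsNormal) {c : I → C} (X : NorHom C c) :
    NorTrans (X.postcomp F hF) (X.postcomp G hG) (fun i => η.app (c i)) where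
  nat h := η.naturality (X.map h)
  nat_id i := naturality_hom_comp_mapId η (X.mapId i).hom
  nat_comp h h' := naturality_hom_comp_mapComp η (X.mapComp h h').hom

/-- The cylinder functor of a transformation. -/
def cylFunctor (I : Type) [Preorder I] {F G : SPseudofunctor C D} (η : STrans F G)
    (hF : F.IsNormal) (hG : G.IsNormal) (k : SimplexCategoryᵒᵖ) :
    NorCat I C k ⥤ NorCat (Bool × I) D k :=
  Sigma.desc fun c =>
    { obj := fun X => ⟨cylObj (F.obj ∘ c) (G.obj ∘ c), (η.norTrans hF hG X).cylinder⟩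
      map := fun {X Y} x => Sigma.SigmaHom.mk (NorTrans.cylIcon (η.norTrans hF hG X)
        (η.norTrans hF hG Y) (Icon.postcomp F hF x) (Icon.postcomp G hG x)
        fun h => η.naturality_cell (x.app h))
      map_id := fun X => congrArg Sigma.SigmaHom.mk (Icon.ext (by
        funext p q h
        obtain ⟨_ | _, i⟩ := p <;> obtain ⟨_ | _, j⟩ := q
        · exact (F.mapCell_deg k _).trans (congrArg (deg k) (F.map₂_id _))
        · refine ((congrArg (SimplicialCells.whiskerLeft (η.app (c i))) (G.mapCell_deg k _)).trans
            (deg_whiskerLeft k _ _).symm).trans (congrArg (deg k) ?_)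
          exact (congrArg _ (G.map₂_id _)).trans (Bicategory.whiskerLeft_id _ _)
        · exact (not_true_le_false h.1).elim
        · exact (G.mapCell_deg k _).trans (congrArg (deg k) (G.map₂_id _))))
      map_comp := fun x y => congrArg Sigma.SigmaHom.mk (Icon.ext (by
        funext p q h
        obtain ⟨_ | _, i⟩ := p <;> obtain ⟨_ | _, j⟩ := q
        · exact F.mapCell_comp _ _
        · exact (congrArg (SimplicialCells.whiskerLeft (η.app (c i))) (G.mapCell_comp _ _)).trans
            (SimplicialBicategory.whiskerLeft_comp _ _ _)
        · exact (not_true_le_false h.1).elim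
        · exact G.mapCell_comp _ _)) }

end Cylinder

end SegalGamma

namespace SegalGamma

open SimplicialCells

/-! ### Simplicial naturality of cylinders and their sections. -/

section CylinderNaturality

variable {C D : Type u} [Bicategory.{u, u} C] [SimplicialBicategory C] [Bicategory.{u, u} D]
  [SimplicialBicategory D] {I J : Type} [Preorder I] [Preorder J] {F G : SPseudofunctor C D}
  (η : STrans F G) (hF : F.IsNormal) (hG : G.IsNormal)

/-- The product of a monotone map with the identity of the interval. -/
def prodBool (t : J →o I) : Bool × J →o Bool × I where
  toFun p := (p.1, t p.2)
  monotone' _ _ h := ⟨h.1, t.monotone h.2⟩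

/-- The graph of a monotone map to the interval. -/
def graphBool (χ : I →o Bool) : I →o Bool × I where
  toFun i := (χ i, i)
  monotone' _ _ h := ⟨χ.monotone h, h⟩

theorem restrictFunctor_cylFunctor (t : J →o I) {k l : SimplexCategoryᵒᵖ} (θ : k ⟶ l) :
    restrictFunctor C t θ ⋙ cylFunctor J η hF hG l =
      cylFunctor I η hF hG k ⋙ restrictFunctor D (prodBool t) θ := by
  refine norCat_functor_ext (fun c X => rfl) fun c X Y x => sigmaHom_hext rfl rfl _ _ fun {p q} h =>
    heq_of_eq ?_
  obtain ⟨_ | _, i⟩ := p <;> obtain ⟨_ | _, j⟩ := q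
  · exact F.mapCell_map _ _
  · exact (congrArg (SimplicialCells.whiskerLeft _) (G.mapCell_map _ _)).trans
      (SimplicialBicategory.map_whiskerLeft _ _ _).symm
  · exact (not_true_le_false h.1).elim
  · exact G.mapCell_map _ _

/-- The section of the cylinder functor over the graph of a monotone map. -/
def cylSection (χ : I →o Bool) (k : SimplexCategoryᵒᵖ) : NorCat I C k ⥤ NorCat I D k :=
  cylFunctor I η hF hG k ⋙ restrictFunctor D (graphBool χ) (𝟙 k)

/-- Restricting the graph of `χ` along `t` gives the graph of `χ ∘ t`. As `χ` ranges over simplices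
of `Δ[1]`, this is exactly the naturality of the simplicial homotopy. -/
theorem restrictFunctor_cylSection (χ : I →o Bool) (t : J →o I) {k l : SimplexCategoryᵒᵖ}
    (θ : k ⟶ l) : restrictFunctor C t θ ⋙ cylSection η hF hG (χ.comp t) l =
      cylSection η hF hG χ k ⋙ restrictFunctor D t θ := by
  rw [cylSection, cylSection, ← Functor.assoc, restrictFunctor_cylFunctor, Functor.assoc,
    Functor.assoc, ← restrictFunctor_comp, ← restrictFunctor_comp, Category.comp_id,
    Category.id_comp]
  rfl

theorem cylSection_false (k : SimplexCategoryᵒᵖ) :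
    cylSection η hF hG (OrderHom.const I false) k = postcompFunctor I F hF k :=
  norCat_functor_ext (fun _ _ => rfl) fun _ _ _ _ => sigmaHom_hext rfl rfl _ _ fun _ =>
    heq_of_eq (Functor.map_id_apply _ _ _)

theorem cylSection_true (k : SimplexCategoryᵒᵖ) :
    cylSection η hF hG (OrderHom.const I true) k = postcompFunctor I G hG k :=
  norCat_functor_ext (fun _ _ => rfl) fun _ _ _ _ => sigmaHom_hext rfl rfl _ _ fun _ =>
    heq_of_eq (Functor.map_id_apply _ _ _)

end CylinderNaturality

end SegalGamma

namespace SegalGamma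

open SimplicialCells MonoidalCategory Simplicial

/-! ### Homotopies of classifying spaces -/

/-- The diagonal of the Segal nerve of a bicategory. -/
def nerveDiagonal : NormalBicat.{u} ⥤ SSet.{u} :=
  segalNerveFunctor ⋙ (Functor.whiskeringRight _ _ _).obj nerveFunctor ⋙ diagonal

section NerveDiagonal

variable {B C : NormalBicat.{u}}

/-- Simplices of the diagonal of the Segal nerve. -/
abbrev NerveSimplex (C : NormalBicat.{u}) (n : SimplexCategoryᵒᵖ) : Type u :=
  Fin (n.unop.len + 1) ⥤ NorCat (Fin (n.unop.len + 1)) C.obj.carrier n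

/-- The monotone map to the interval given by a simplex of `Δ[1]`. -/
def intervalMap {n : SimplexCategoryᵒᵖ} (s : (Δ[1] : SSet.{u}).obj n) :
    Fin (n.unop.len + 1) →o Bool where
  toFun i := decide ((SSet.stdSimplex.objEquiv s).toOrderHom i = 1)
  monotone' i j h := by
    have key : ∀ a b : Fin 2, a ≤ b → decide (a = 1) ≤ decide (b = 1) := by decide
    exact key _ _ ((SSet.stdSimplex.objEquiv s).toOrderHom.monotone h)

variable {F G : SPseudofunctor B.obj.carrier C.obj.carrier} (η : STrans F G) (hF : F.IsNormal)
  (hG : G.IsNormal)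

/-- The simplicial homotopy induced by a transformation. -/
def nerveHomotopy : nerveDiagonal.obj B ⊗ Δ[1] ⟶ nerveDiagonal.obj C where
  -- On the diagonal the three dimensions coincide. The simplex of `Δ[1]` acts through the chain
  -- direction `[n]`, and the section is applied to all objects and icons of the nerve simplex.
  app n := TypeCat.ofHom fun x =>
    ((show NerveSimplex B n from x.1) ⋙ cylSection η hF hG (intervalMap x.2) n : NerveSimplex C n)
  naturality m n θ := by
    ext ⟨x, s⟩
    have := restrictFunctor_cylSection η hF hG (intervalMap s) θ.unop.toOrderHom θ
    exact congrArg (fun K => (SimplexCategory.toCat.map θ.unop).toFunctor ⋙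
      ((show NerveSimplex B m from x) ⋙ K)) this

theorem ι₀_comp_nerveHomotopy : SSet.ι₀ ≫ nerveHomotopy η hF hG =
    nerveDiagonal.map (X := B) (Y := C) ⟨F, hF⟩ := by
  ext n x
  exact congrArg (fun K => (show NerveSimplex B _ from x) ⋙ K) (cylSection_false η hF hG _)

theorem ι₁_comp_nerveHomotopy : SSet.ι₁ ≫ nerveHomotopy η hF hG =
    nerveDiagonal.map (X := B) (Y := C) ⟨G, hG⟩ := by
  ext n x
  exact congrArg (fun K => (show NerveSimplex B _ from x) ⋙ K) (cylSection_true η hF hG _)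

end NerveDiagonal

/-- Transformations of normal pseudofunctors induce homotopies of classifying spaces. -/
theorem homotopic_classifyingSpaceMap {B C : Bicat.{u}} {F G : SPseudofunctor B.carrier C.carrier}
    (η : STrans F G) (hF : F.IsNormal) (hG : G.IsNormal) :
    (classifyingSpaceMap F hF).Homotopic (classifyingSpaceMap G hG) := by
  have h := homotopic_of_simplicialHomotopy (nerveHomotopy (B := ⟨B⟩) (C := ⟨C⟩) η hF hG)
  rw [ι₀_comp_nerveHomotopy, ι₁_comp_nerveHomotopy] at h
  exact h

end SegalGamma

namespace SegalGamma

open SimplicialCells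

/-! ### The Segal nerve of a product -/

/-! ### Strict products of categories and functors into them. -/

section FunctorBijective

/-- Composition with an isomorphism of categories is bijective on functors. -/
theorem bijective_comp_of_bijective {𝒯 𝒜 ℬ : Type*} [Category* 𝒯] [Category* 𝒜] [Category* ℬ]
    (R : 𝒜 ⥤ ℬ) [R.Full] [R.Faithful] (hR : Function.Bijective R.obj) :
    Function.Bijective fun x : 𝒯 ⥤ 𝒜 => x ⋙ R := by
  let e := Equiv.ofBijective R.obj hR
  have he : ∀ b, R.obj (e.symm b) = b := e.apply_symm_apply
  have he' : ∀ a, e.symm (R.obj a) = a := e.symm_apply_apply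
  -- A strict inverse is needed, since simplices of a nerve are functors up to equality; bijectivity
  -- on objects makes it possible, with `eqToHom` correcting the endpoints.
  let S : ℬ ⥤ 𝒜 :=
    { obj := fun b => e.symm b
      map := fun {b b'} f => R.preimage (eqToHom (he b) ≫ f ≫ eqToHom (he b').symm)
      map_id := fun b => R.map_injective (by simp)
      map_comp := fun f g => R.map_injective (by simp) }
  have h₁ : S ⋙ R = 𝟭 ℬ := CategoryTheory.Functor.ext he fun b b' f => by simp [S]
  have h₂ : R ⋙ S = 𝟭 𝒜 := CategoryTheory.Functor.ext he' fun a a' f =>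
    R.map_injective (by simp [S, eqToHom_map])
  refine ⟨fun x x' h => ?_, fun y => ⟨y ⋙ S, ?_⟩⟩
  · have := congrArg (· ⋙ S) h
    simpa only [Functor.assoc, h₂, Functor.comp_id] using this
  · simp only [Functor.assoc, h₁, Functor.comp_id]

/-- If a family of functors exhibits a category as a product, then it does so for categories of
functors. -/
theorem bijective_comp_pi {𝒯 𝒜 : Type*} [Category* 𝒯] [Category* 𝒜] {ι : Type*}
    {ℬ : ι → Type*} [∀ i, Category* (ℬ i)] (R : ∀ i, 𝒜 ⥤ ℬ i)
    (h₀ : Function.Bijective fun a i => (R i).obj a)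
    (h₁ : ∀ a a' : 𝒜, Function.Bijective fun (f : a ⟶ a') i => (R i).map f) :
    Function.Bijective fun (x : 𝒯 ⥤ 𝒜) i => x ⋙ R i := by
  have : (Functor.pi' R).Full := ⟨fun {a a'} => (h₁ a a').2⟩
  have : (Functor.pi' R).Faithful := ⟨fun {a a' _ _} h => (h₁ a a').1 h⟩
  obtain ⟨hi, hs⟩ := bijective_comp_of_bijective (𝒯 := 𝒯) (Functor.pi' R) h₀
  refine ⟨fun x x' h => hi (Functor.pi_ext _ _ fun i => congrFun h i), fun y => ?_⟩
  obtain ⟨x, hx⟩ := hs (Functor.pi' y)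
  exact ⟨x, funext fun i => (congrArg (· ⋙ Pi.eval _ i) hx).trans (Functor.pi'_eval y i)⟩

end FunctorBijective

/-! ### Products of bicategories and normal pseudofunctors into them. -/

section Product

variable {ι : Type} {C : ι → Type u} [∀ i, Bicategory.{u, u} (C i)]

theorem pi_isoMk_eqToIso {J : Type} {E : J → Type u} [∀ j, Category.{u} (E j)] {f g : ∀ j, E j}
    (h : f = g) (e : ∀ j, f j ≅ g j) (he : ∀ j, e j = eqToIso (congrFun h j)) :
    Pi.isoMk e = eqToIso h := by
  subst h
  ext j
  exact congrArg Iso.hom (he j)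

/-- The projections of a product of bicategories (without enrichment). -/
def piProj₀ (C : ι → Type u) [∀ i, Bicategory.{u, u} (C i)] (i : ι) :
    Pseudofunctor (∀ i, C i) (C i) where
  obj a := a i
  map f := f i
  map₂ η := η i
  mapId _ := Iso.refl _
  mapComp _ _ := Iso.refl _
  map₂_id _ := rfl
  map₂_comp _ _ := rfl
  map₂_whisker_left f _ _ η := eq_id_comp_comp_id (Bicategory.whiskerLeft (f i) (η i))
  map₂_whisker_right η h := eq_id_comp_comp_id (Bicategory.whiskerRight (η i) (h i))
  map₂_associator f g h := associator_eq_of_strict (f i) (g i) (h i)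
  map₂_left_unitor f := leftUnitor_eq_of_strict (f i)
  map₂_right_unitor f := rightUnitor_eq_of_strict (f i)

variable [∀ i, SimplicialBicategory (C i)]

/-- The projections of a product of bicategories. -/
def piProj (C : ι → Type u) [∀ i, Bicategory.{u, u} (C i)] [∀ i, SimplicialBicategory (C i)]
    (i : ι) : SPseudofunctor (∀ i, C i) (C i) where
  toPseudofunctor := piProj₀ C i
  mapCell _ _ :=
    { app := fun _ => TypeCat.ofHom fun x => x i
      naturality := fun _ _ _ => rfl }
  mapCell_vertex _ := rfl
  mapCell_comp _ _ := rfl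
  mapCell_whiskerLeft f _ _ _ x := comp_deg_id_eq (whiskerLeft (f i) (x i))
  mapCell_whiskerRight x h := comp_deg_id_eq (whiskerRight (x i) (h i))

theorem piProj_isNormal (i : ι) : (piProj C i).IsNormal :=
  ⟨fun _ => rfl, fun a => by ext; rfl⟩

variable {B : Type u} [Bicategory.{u, u} B] [SimplicialBicategory B]

theorem piLift_comp_piProj (F : ∀ i, SPseudofunctor B (C i)) (i : ι) :
    (piLift F).comp (piProj C i) = F i := by
  refine SPseudofunctor.ext' (SPseudofunctor.pseudo_ext rfl (fun a => heq_of_eq ?_)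
    (fun f g => heq_of_eq ?_)) (fun f g => HEq.rfl)
  · ext
    exact Category.comp_id _
  · ext
    exact Category.comp_id _

theorem piLift_isNormal {F : ∀ i, SPseudofunctor B (C i)} (hF : ∀ i, (F i).IsNormal) :
    (piLift F).IsNormal := by
  choose h h' using hF
  exact ⟨fun a => funext fun i => h i a, fun a => pi_isoMk_eqToIso _ _ fun i => h' i a⟩

variable {I : Type} [Preorder I]

/-- The normal pseudofunctor to a product with given components. -/
def NorHom.pi {c : ∀ i, I → C i} (Z : ∀ i, NorHom (C i) (c i)) :
    NorHom (∀ i, C i) (fun j i => c i j) where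
  map h := fun i => (Z i).map h
  mapId j := Pi.isoMk fun i => (Z i).mapId j
  mapComp h h' := Pi.isoMk fun i => (Z i).mapComp h h'
  map_assoc h h' h'' := funext fun i => (Z i).map_assoc h h' h''
  map_left_unitor h := funext fun i => (Z i).map_left_unitor h
  map_right_unitor h := funext fun i => (Z i).map_right_unitor h
  normal := by
    choose h h' using fun i => (Z i).normal
    exact ⟨fun j => funext fun i => h i j, fun j => pi_isoMk_eqToIso _ _ fun i => h' i j⟩

theorem NorHom.pi_postcomp {c : I → ∀ i, C i} (X : NorHom (∀ i, C i) c) :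
    NorHom.pi (fun i => X.postcomp (piProj C i) (piProj_isNormal i)) = X := by
  refine NorHom.ext rfl (heq_of_eq ?_) (heq_of_eq ?_)
  · funext j
    ext
    funext i
    exact Category.comp_id _
  · funext j k l h h'
    ext
    funext i
    exact Category.comp_id _

theorem NorHom.postcomp_pi {c : ∀ i, I → C i} (Z : ∀ i, NorHom (C i) (c i)) (i : ι) :
    (NorHom.pi Z).postcomp (piProj C i) (piProj_isNormal i) = Z i := by
  refine NorHom.ext rfl (heq_of_eq ?_) (heq_of_eq ?_)
  · funext j
    ext
    exact Category.comp_id _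
  · funext j k l h h'
    ext
    exact Category.comp_id _

/-- The icon of pseudofunctors to a product with given components. -/
def Icon.pi {k : SimplexCategoryᵒᵖ} {c : I → ∀ i, C i} {X Y : NorHom (∀ i, C i) c}
    (x : ∀ i, Icon k (X.postcomp (piProj C i) (piProj_isNormal i))
      (Y.postcomp (piProj C i) (piProj_isNormal i))) : Icon k X Y where
  app h := fun i => (x i).app h
  app_id j := funext fun i => by
    have e : ∀ W : NorHom (∀ i, C i) c,
        ((W.postcomp (piProj C i) (piProj_isNormal i)).mapId j).hom = (W.mapId j).hom i :=
      fun W => Category.comp_id ((W.mapId j).hom i)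
    have := (x i).app_id j
    rw [e, e] at this
    exact this
  app_comp h h' := funext fun i => by
    have e : ∀ W : NorHom (∀ i, C i) c,
        ((W.postcomp (piProj C i) (piProj_isNormal i)).mapComp h h').hom =
          (W.mapComp h h').hom i :=
      fun W => Category.comp_id ((W.mapComp h h').hom i)
    have := (x i).app_comp h h'
    rw [e, e] at this
    exact this

/-- The projections from the category of normal pseudofunctors to a product. -/
abbrev projFunctor (I : Type) [Preorder I] (C : ι → Type u) [∀ i, Bicategory.{u, u} (C i)]
    [∀ i, SimplicialBicategory (C i)] (k : SimplexCategoryᵒᵖ) (i : ι) :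
    NorCat I (∀ i, C i) k ⥤ NorCat I (C i) k :=
  postcompFunctor I (piProj C i) (piProj_isNormal i) k

theorem projFunctor_obj_bijective (k : SimplexCategoryᵒᵖ) :
    Function.Bijective fun (X : NorCat I (∀ i, C i) k) i => (projFunctor I C k i).obj X := by
  refine Function.bijective_iff_has_inverse.2
    ⟨fun Z => ⟨fun j i => (Z i).1 j, NorHom.pi fun i => (Z i).2⟩, fun X => ?_, fun Z => ?_⟩
  · exact congrArg (Sigma.mk X.1) (NorHom.pi_postcomp X.2)
  · funext i
    exact congrArg (Sigma.mk (Z i).1) (NorHom.postcomp_pi (fun i => (Z i).2) i)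

theorem sigmaHom_fst_eq {k : SimplexCategoryᵒᵖ} {D : Type u} [Bicategory.{u, u} D]
    [SimplicialBicategory D] {X Y : NorCat I D k} (f : X ⟶ Y) : X.1 = Y.1 := by
  obtain ⟨_⟩ := f
  rfl

theorem sigmaHom_mk_surjective {k : SimplexCategoryᵒᵖ} {D : Type u} [Bicategory.{u, u} D]
    [SimplicialBicategory D] {c : I → D} {X Y : NorLevel k c}
    (f : (⟨c, X⟩ : NorCat I D k) ⟶ ⟨c, Y⟩) : ∃ x : X ⟶ Y, Sigma.SigmaHom.mk x = f := by
  change Sigma.SigmaHom _ _ at f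
  cases f with
  | mk x => exact ⟨x, rfl⟩

theorem sigmaHom_mk_injective {k : SimplexCategoryᵒᵖ} {D : Type u} [Bicategory.{u, u} D]
    [SimplicialBicategory D] {c : I → D} {X Y : NorLevel k c} {x y : X ⟶ Y}
    (h : (Sigma.SigmaHom.mk x : (⟨c, X⟩ : NorCat I D k) ⟶ ⟨c, Y⟩) = Sigma.SigmaHom.mk y) :
    x = y := by
  cases h
  rfl

theorem projFunctor_map_bijective (k : SimplexCategoryᵒᵖ) (X Y : NorCat I (∀ i, C i) k) :
    Function.Bijective fun (f : X ⟶ Y) i => (projFunctor I C k i).map f := by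
  obtain ⟨c, X⟩ := X
  obtain ⟨d, Y⟩ := Y
  constructor
  · rintro f g h
    obtain rfl := sigmaHom_fst_eq f
    obtain ⟨x, rfl⟩ := sigmaHom_mk_surjective f
    obtain ⟨y, rfl⟩ := sigmaHom_mk_surjective g
    refine congrArg Sigma.SigmaHom.mk (Icon.ext ?_)
    funext j l hjl i
    have := sigmaHom_mk_injective (congrFun h i)
    exact congrArg (fun z : Icon k _ _ => z.app hjl) this
  · intro f
    -- Icons exist only over equal actions on objects, so the components force the actions on
    -- objects to agree.
    obtain rfl : c = d := funext fun j => funext fun i => congrFun (sigmaHom_fst_eq (f i)) j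
    choose x hx using fun i => sigmaHom_mk_surjective (f i)
    refine ⟨Sigma.SigmaHom.mk (C := NorLevel k) (X := X) (Y := Y)
      (Icon.pi (X := X) (Y := Y) x), funext fun i => ?_⟩
    exact hx i

end Product

end SegalGamma

namespace SegalGamma

/-! ### Classifying spaces and the Segal condition -/

section ClassifyingSpace

theorem classifyingSpaceMap_comp {B C D : Bicat.{u}} (F : SPseudofunctor B.carrier C.carrier)
    (hF : F.IsNormal) (G : SPseudofunctor C.carrier D.carrier) (hG : G.IsNormal) :
    classifyingSpaceMap (F.comp G) (hF.comp hG) =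
      (classifyingSpaceMap G hG).comp (classifyingSpaceMap F hF) :=
  congrArg TopCat.Hom.hom (classifyingSpace.map_comp (X := ⟨B⟩) (Y := ⟨C⟩) (Z := ⟨D⟩)
    ⟨F, hF⟩ ⟨G, hG⟩)

theorem classifyingSpaceMap_id (B : Bicat.{u}) :
    classifyingSpaceMap (SPseudofunctor.id B.carrier) SPseudofunctor.isNormal_id =
      ContinuousMap.id (classifyingSpaceObj B) :=
  congrArg TopCat.Hom.hom (classifyingSpace.map_id ⟨B⟩)

theorem homotopic_comp_id {B C : Bicat.{u}} (F : SPseudofunctor B.carrier C.carrier)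
    (hF : F.IsNormal) (G : SPseudofunctor C.carrier B.carrier) (hG : G.IsNormal)
    (η : STrans (SPseudofunctor.id B.carrier) (F.comp G)) :
    ((classifyingSpaceMap G hG).comp (classifyingSpaceMap F hF)).Homotopic
      (ContinuousMap.id (classifyingSpaceObj B)) := by
  rw [← classifyingSpaceMap_comp, ← classifyingSpaceMap_id]
  exact (homotopic_classifyingSpaceMap η _ _).symm

theorem homotopic_comp_id' {B C : Bicat.{u}} (F : SPseudofunctor B.carrier C.carrier)
    (hF : F.IsNormal) (G : SPseudofunctor C.carrier B.carrier) (hG : G.IsNormal)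
    (η : STrans (F.comp G) (SPseudofunctor.id B.carrier)) :
    ((classifyingSpaceMap G hG).comp (classifyingSpaceMap F hF)).Homotopic
      (ContinuousMap.id (classifyingSpaceObj B)) := by
  rw [← classifyingSpaceMap_comp, ← classifyingSpaceMap_id]
  exact homotopic_classifyingSpaceMap η _ _

/-- The bicategory with new identities adjoined. -/
abbrev augBicat (B : Bicat.{u}) : Bicat.{u} := (normalization.obj B).obj

/-- Adjoining new identities does not change the homotopy type of the classifying space. -/
noncomputable def augHomotopyEquiv (B : Bicat.{u}) :
    ContinuousMap.HomotopyEquiv (classifyingSpaceObj B) (classifyingSpaceObj (augBicat B)) where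
  toFun := classifyingSpaceMap (B := B) (C := augBicat B) (augIncl B.carrier) augIncl_isNormal
  invFun := classifyingSpaceMap (B := augBicat B) (C := B) (augProj B.carrier) augProj_isNormal
  left_inv := homotopic_comp_id' (B := B) (C := augBicat B) _ _ _ _
    nonempty_sTrans_augIncl_comp_augProj.some
  right_inv := homotopic_comp_id' (B := augBicat B) (C := B) _ _ _ _
    nonempty_sTrans_augProj_comp_augIncl.some

/-- The map of classifying spaces induced by a pseudofunctor on the bicategories with new
identities adjoined. -/
noncomputable abbrev augClassifyingSpaceMap {B C : Bicat.{u}}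
    (F : SPseudofunctor B.carrier C.carrier) :
    C(classifyingSpaceObj (augBicat B), classifyingSpaceObj (augBicat C)) :=
  classifyingSpaceMap (B := augBicat B) (C := augBicat C)
    (augMap (C := B.carrier) (D := C.carrier) F)
    (augMap_isNormal (C := B.carrier) (D := C.carrier) F)

/-- The square with the projections commutes up to homotopy, because a transformation joins
`augProj` followed by `F` to `augMap G` followed by `augProj`. Conjugating by the homotopy
equivalences gives the square with the inclusions. -/
theorem homotopic_augClassifyingSpaceMap {B C : Bicat.{u}}
    {F G : SPseudofunctor B.carrier C.carrier} (hF : F.IsNormal) (η : STrans F G) :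
    ((augClassifyingSpaceMap G).comp (augHomotopyEquiv B).toFun).Homotopic
      ((augHomotopyEquiv C).toFun.comp (classifyingSpaceMap F hF)) := by
  have h : ((classifyingSpaceMap F hF).comp (augHomotopyEquiv B).invFun).Homotopic
      ((augHomotopyEquiv C).invFun.comp (augClassifyingSpaceMap G)) := by
    exact Eq.mp (congrArg₂ ContinuousMap.Homotopic
      (classifyingSpaceMap_comp (B := augBicat B) (C := B) (D := C) _ augProj_isNormal F hF)
      (classifyingSpaceMap_comp (B := augBicat B) (C := augBicat C) (D := C) _
        (augMap_isNormal G) _ augProj_isNormal))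
      (homotopic_classifyingSpaceMap (B := augBicat B) (C := C)
        (nonempty_sTrans_comp_augMap η).some _ _)
  have h₁ : ((augClassifyingSpaceMap G).comp (augHomotopyEquiv B).toFun).Homotopic
      ((augHomotopyEquiv C).toFun.comp (((augHomotopyEquiv C).invFun.comp
        (augClassifyingSpaceMap G)).comp (augHomotopyEquiv B).toFun)) :=
    ((augHomotopyEquiv C).right_inv.comp
      (.refl ((augClassifyingSpaceMap G).comp (augHomotopyEquiv B).toFun))).symm
  have h₂ : ((augHomotopyEquiv C).toFun.comp (((classifyingSpaceMap F hF).comp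
      (augHomotopyEquiv B).invFun).comp (augHomotopyEquiv B).toFun)).Homotopic
        ((augHomotopyEquiv C).toFun.comp (classifyingSpaceMap F hF)) :=
    .comp (.refl _) (.comp (.refl (classifyingSpaceMap F hF)) (augHomotopyEquiv B).left_inv)
  exact h₁.trans (.trans (.comp (.refl _) (.comp h.symm (.refl _))) h₂)

/-- Strict functoriality of `augMap` turns the unit and counit of the equivalence into
transformations from identities to composites of normal pseudofunctors, hence into homotopies. -/
theorem isWeakEquivalence_augClassifyingSpaceMap {B C : Bicat.{u}}
    {F : SPseudofunctor B.carrier C.carrier} (hF : IsBiequivalence F) :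
    IsWeakEquivalence (augClassifyingSpaceMap F) := by
  obtain ⟨G, ⟨η, -⟩, ⟨θ, -⟩⟩ := hF
  obtain ⟨η'⟩ := nonempty_sTrans_augMap η
  obtain ⟨θ'⟩ := nonempty_sTrans_augMap θ
  rw [augMap_id, augMap_comp] at η' θ'
  exact isWeakEquivalence_of_homotopyInverse (g := augClassifyingSpaceMap G)
    (homotopic_comp_id (B := augBicat B) (C := augBicat C) _ _ _ _ η')
    (homotopic_comp_id (B := augBicat C) (C := augBicat B) _ _ _ _ θ')

theorem isWeakEquivalence_of_comp_homotopyEquiv {X Y Z : Type u} [TopologicalSpace X]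
    [TopologicalSpace Y] [TopologicalSpace Z] (e : ContinuousMap.HomotopyEquiv X Y) {f : C(Y, Z)}
    (h : IsWeakEquivalence (f.comp e.toFun)) : IsWeakEquivalence f := by
  refine IsWeakEquivalence.of_homotopic (f := (f.comp e.toFun).comp e.invFun) ?_
    (h.comp (isWeakEquivalence_homotopyEquiv e.symm))
  exact .comp (.refl f) e.right_inv

theorem isWeakEquivalence_of_homotopyEquiv_comp {X Y Z : Type u} [TopologicalSpace X]
    [TopologicalSpace Y] [TopologicalSpace Z] (e : ContinuousMap.HomotopyEquiv Y Z) {f : C(X, Y)}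
    (h : IsWeakEquivalence (e.toFun.comp f)) : IsWeakEquivalence f := by
  refine IsWeakEquivalence.of_homotopic (f := e.invFun.comp (e.toFun.comp f)) ?_
    ((isWeakEquivalence_homotopyEquiv e.symm).comp h)
  exact .comp e.left_inv (.refl f)

/-- A normal pseudofunctor related by a transformation to an equivalence of bicategories induces a
weak homotopy equivalence of classifying spaces. -/
theorem isWeakEquivalence_classifyingSpaceMap {B C : Bicat.{u}}
    {F G : SPseudofunctor B.carrier C.carrier} (hF : F.IsNormal) (η : STrans F G)
    (hG : IsBiequivalence G) : IsWeakEquivalence (classifyingSpaceMap F hF) := by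
  refine isWeakEquivalence_of_homotopyEquiv_comp (augHomotopyEquiv C) ?_
  exact IsWeakEquivalence.of_homotopic (homotopic_augClassifyingSpaceMap hF η)
    ((isWeakEquivalence_augClassifyingSpaceMap hG).comp (isWeakEquivalence_homotopyEquiv _))

/-- The power of a bicategory. -/
abbrev powBicat (B : Bicat.{u}) (n : ℕ) : Bicat.{u} := ⟨Fin n → B.carrier⟩

/-- A simplex of the diagonal is a functor from `[m]` to a category of normal pseudofunctors and
icons, and these categories are strict products. -/
theorem isLevelwiseProduct_nerveDiagonal (B : Bicat.{u}) (n : ℕ) :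
    IsLevelwiseProduct fun i : Fin n => nerveDiagonal.map (X := ⟨powBicat B n⟩) (Y := ⟨B⟩)
      ⟨piProj (fun _ : Fin n => B.carrier) i, piProj_isNormal i⟩ :=
  fun m => bijective_comp_pi (𝒯 := Fin (m.len + 1))
    (projFunctor (Fin (m.len + 1)) (fun _ : Fin n => B.carrier) (op m))
    (projFunctor_obj_bijective (op m)) (projFunctor_map_bijective (op m))

/-- The map factors through the classifying space of the power of `C`: first the map induced by the
normal `piLift F`, which is related to an equivalence, then the comparison for realizations of
products. -/
theorem isWeakEquivalence_pi_classifyingSpaceMap {B C : Bicat.{u}} {n : ℕ}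
    {F G : Fin n → SPseudofunctor B.carrier C.carrier} (hF : ∀ i, (F i).IsNormal)
    (η : ∀ i, STrans (F i) (G i)) (hG : IsBiequivalence (piLift G)) :
    IsWeakEquivalence (ContinuousMap.pi fun i => classifyingSpaceMap (F i) (hF i)) := by
  have h₁ := isWeakEquivalence_classifyingSpaceMap (B := B) (C := powBicat C n)
    (piLift_isNormal hF) (STrans.pi η) hG
  have h₂ := isWeakEquivalence_realizationPi (isLevelwiseProduct_nerveDiagonal C n)
  have h₃ := h₂.comp h₁
  have h₄ : ∀ i, classifyingSpaceMap (F i) (hF i) =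
      (classifyingSpaceMap (B := powBicat C n) (C := C) (piProj (fun _ : Fin n => C.carrier) i)
        (piProj_isNormal i)).comp
          (classifyingSpaceMap (B := B) (C := powBicat C n) (piLift F) (piLift_isNormal hF)) := by
    intro i
    rw [← classifyingSpaceMap_comp]
    congr 1
    exact (piLift_comp_piProj F i).symm
  simp only [h₄]
  exact h₃

end ClassifyingSpace

end SegalGamma

open SegalGamma

theorem lemma3p5 :
    (∀ A : SegalGamma.FinStar ⥤ SegalGamma.NormalBicat.{u},
      SegalGamma.IsSpecialΓBicategory (A ⋙ wideSubcategoryInclusion SegalGamma.normal.{u}) →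
        SegalGamma.IsSpecialΓSpace (A ⋙ SegalGamma.classifyingSpace.{u})) ∧
    (∀ A : SegalGamma.FinStar ⥤ SegalGamma.Bicat.{u},
      SegalGamma.IsSpecialΓBicategory A →
        (∃ X : SegalGamma.FinStar ⥤ TopCat.{u}, SegalGamma.IsClassifyingΓSpace A X) ∧
        ∀ X : SegalGamma.FinStar ⥤ TopCat.{u},
          SegalGamma.IsClassifyingΓSpace A X → SegalGamma.IsSpecialΓSpace X) := by
  -- Adjoining identities makes the whole diagram normal and strictly functorial at once, which
  -- choosing a normalization of each `A(f)` would not.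
  refine ⟨fun A hA n => ?_, fun A hA => ⟨⟨A ⋙ normalization ⋙ classifyingSpace,
    fun s => augHomotopyEquiv (A.obj s), fun s t f => ⟨exists_normalization _,
      fun F hF ⟨η, _⟩ => homotopic_augClassifyingSpaceMap hF η⟩⟩, fun X ⟨e, he⟩ n => ?_⟩⟩
  · exact isWeakEquivalence_pi_classifyingSpaceMap (B := (A.obj ⟨n⟩).obj) (C := (A.obj ⟨1⟩).obj)
      (F := fun k => Bicat.toPseudo (A.map (proj n k)).hom) (fun k => (A.map (proj n k)).property)
      (fun k => STrans.id _) (hA n)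
  -- For an arbitrary model, normalizations of the `n` projections are assembled. The square
  -- relating them to the Segal map of `X` through the equivalences `e` commutes up to homotopy
  -- coordinate by coordinate.
  · choose F hF hFA using fun k => (he (proj n k)).1
    refine isWeakEquivalence_of_comp_homotopyEquiv (e ⟨n⟩) ?_
    have h := isWeakEquivalence_pi_classifyingSpaceMap hF (fun k => (hFA k).choose) (hA n)
    refine IsWeakEquivalence.of_homotopic ?_ ((isWeakEquivalence_homotopyEquiv
      (ContinuousMap.HomotopyEquiv.piCongrRight fun _ : Fin n => e ⟨1⟩)).comp h)
    exact ContinuousMap.Homotopic.pi fun k => ((he (proj n k)).2 (F k) (hF k) (hFA k)).symm
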